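/- Finite game $\Gamma_n$ ($n\ge 1$). A state $\theta\in\{0,1\}$ is uniformly distributed. Nature chooses a probability measure $\gamma_n$ on $[0,\sqrt n/2]$; a local parameter $c$ corresponds to the precision $\pi=\tfrac12+c/\sqrt n\in[\tfrac12,1]$, and given $c$ and $\theta$ the number $k$ of high signals is binomial with $n$ trials and success probability $\pi$ if $\theta=1$, $1-\pi$ if $\theta=0$. The decision maker (DM) chooses $\boldsymbol a_n=(a_0,\dots,a_n)\in[0,1]^{n+1}$. In this zero-sum game Nature receives, and the DM pays, $$R_n(\boldsymbol a_n,\gamma_n)=\int\sum_{k=0}^n\Pr(k\mid c)\bigl(\Pr(\theta=1\mid k,c)-a_k\bigr)^2\,\gamma_n(dc),$$ where $$\Pr(k\mid c)=\tfrac12\tbinom nk\bigl[\pi^k(1-\pi)^{n-k}+(1-\pi)^k\pi^{n-k}\bigr],\qquad \Pr(\theta=1\mid k,c)=\frac{\pi^k(1-\pi)^{n-k}}{\pi^k(1-\pi)^{n-k}+(1-\pi)^k\pi^{n-k}}.$$ Limit game $\tilde\Gamma$. Nature chooses a probability measure $\gamma$ on $[0,\infty)$, the DM a nondecreasing function $\boldsymbol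 a:\mathbb R\to[0,1]$. With $\phi$ the standard normal density and $\Pr(\theta=1\mid z,c)=\phi(z-2c)/(\phi(z-2c)+\phi(z+2c))$, Nature receives, and the DM pays, $$\tilde R(\boldsymbol a,\gamma)=\tfrac12\int\!\!\int_{-\infty}^{\infty}\bigl[\phi(z+2c)+\phi(z-2c)\bigr]\bigl(\Pr(\theta=1\mid z,c)-\boldsymbol a(z)\bigr)^2\,dz\,\gamma(dc).$$ Embedding. Let $\mathcal A$ be the set of nondecreasing functions $[0,1]\to[0,1]$ and $\Phi$ the standard normal distribution function. For a limit strategy $\boldsymbol a$ put $\tilde{\boldsymbol a}(y)=\boldsymbol a(\Phi^{-1}(y))$ for $y\in(0,1)$, with $\tilde{\boldsymbol a}(0)$ and $\tilde{\boldsymbol a}(1)$ the limits of $\boldsymbol a$ at $-\infty$ and $+\infty$. For $\boldsymbol a_n\in[0,1]^{n+1}$ let $\tilde{\boldsymbol a}_n:[0,1]\to[0,1]$ be the piecewise linear interpolation of the points $(y_{n,k},a_k)$, $0\le k\le n$, where $y_{n,k}=\Phi\bigl(\frac{k-n/2}{\sqrt n/2}\bigr)$, extended by the constants $a_0$ on $[0,y_{n,0}]$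 and $a_n$ on $[y_{n,n},1]$. Theorem (Convergence of Equilibria). The limit game $\tilde\Gamma$ has a unique Nash equilibrium $(\boldsymbol a^*,\gamma^*)$. The equilibria lie in common compact spaces: $\tilde{\boldsymbol a}^*\in\mathcal A$, and there is $C>0$ with $\gamma^*([0,C])=1$ such that for every $n\ge1$ every Nash equilibrium $(\boldsymbol a_n,\gamma_n)$ of $\Gamma_n$ satisfies $\tilde{\boldsymbol a}_n\in\mathcal A$ and $\gamma_n([0,C])=1$. If $(\boldsymbol a_n^*,\gamma_n^*)$ is a Nash equilibrium of $\Gamma_n$ for every $n\ge 1$, then, as $n\to\infty$: 1. $\gamma_n^*\to\gamma^*$ weakly; 2. $\tilde{\boldsymbol a}_n^*(y)\to\tilde{\boldsymbol a}^*(y)$ at every $y\in[0,1]$ at which $\tilde{\boldsymbol a}^*$ is continuous. -/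

import Mathlib

open MeasureTheory ProbabilityTheory Filter Topology Set

noncomputable section

namespace RobustLearning

/-! Zero-sum games -/

/-- `(a, γ)` is a Nash equilibrium (in pure strategies of the sets `A` and `S`) of the zero-sum
game in which the first player chooses a point of `A` and pays `R a γ` to the second player, who
chooses a point of `S`. -/
structure IsNash {α β : Type*} (A : Set α) (S : Set β) (R : α → β → ℝ) (a : α) (γ : β) :
    Prop where
  dm_mem : a ∈ A
  nature_mem : γ ∈ S
  dm_best : ∀ a' ∈ A, R a γ ≤ R a' γ
  nature_best : ∀ γ' ∈ S, R a γ' ≤ R a γ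

/-! The finite game with `n` binary signals -/

/-- The precision `π = 1/2 + c/√n` with local parameter `c`. -/
def precision (n : ℕ) (c : ℝ) : ℝ := 1 / 2 + c / √(n : ℝ)

/-- The likelihood (up to the binomial coefficient) of `k` high signals in state `1`. -/
def likOne (n : ℕ) (c : ℝ) (k : ℕ) : ℝ :=
  precision n c ^ k * (1 - precision n c) ^ (n - k)

/-- The likelihood (up to the binomial coefficient) of `k` high signals in state `0`. -/
def likZero (n : ℕ) (c : ℝ) (k : ℕ) : ℝ :=
  (1 - precision n c) ^ k * precision n c ^ (n - k)

/-- The marginal probability of `k` high signals under the uniform prior on the state. -/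
def prCount (n : ℕ) (c : ℝ) (k : ℕ) : ℝ :=
  1 / 2 * (n.choose k : ℝ) * (likOne n c k + likZero n c k)

/-- The oracle's posterior probability of state `1` after `k` high signals. Counts with
`prCount n c k = 0` have weight zero in the regret. -/
def oraclePosterior (n : ℕ) (c : ℝ) (k : ℕ) : ℝ :=
  likOne n c k / (likOne n c k + likZero n c k)

/-- The ex-ante regret of the belief rule `a` at the local parameter `c`. -/
def regretAt (n : ℕ) (a : Fin (n + 1) → ℝ) (c : ℝ) : ℝ :=
  ∑ k : Fin (n + 1), prCount n c k * (oraclePosterior n c k - a k) ^ 2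

/-- Nature's payoff `R_n(a, γ)` from a mixed strategy `γ`. -/
def regret (n : ℕ) (a : Fin (n + 1) → ℝ) (γ : ProbabilityMeasure ℝ) : ℝ :=
  ∫ c, regretAt n a c ∂(γ : Measure ℝ)

/-- The DM's strategies in the finite game: `[0,1]^(n+1)`. -/
def dmStrategies (n : ℕ) : Set (Fin (n + 1) → ℝ) := {a | ∀ k, a k ∈ Icc (0 : ℝ) 1}

/-- Nature's strategies in the finite game: probability measures on `[0, √n/2]`, viewed as
probability measures on `ℝ`. -/
def natureStrategies (n : ℕ) : Set (ProbabilityMeasure ℝ) :=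
  {γ | (γ : Measure ℝ) (Icc 0 (√(n : ℝ) / 2)) = 1}

/-- Nash equilibria of the finite game with `n` signals. -/
def IsFiniteNash (n : ℕ) (a : Fin (n + 1) → ℝ) (γ : ProbabilityMeasure ℝ) : Prop :=
  IsNash (dmStrategies n) (natureStrategies n) (regret n) a γ

/-! The Gaussian limit game -/

/-- The standard normal density. -/
def stdDensity (z : ℝ) : ℝ := gaussianPDFReal 0 1 z

/-- The standard normal cumulative distribution function. -/
def stdCDF (z : ℝ) : ℝ := cdf (gaussianReal 0 1) z

/-- The oracle's posterior probability of state `1` after the signal `z`, when the signal is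
`N(2c,1)` in state `1` and `N(-2c,1)` in state `0`. -/
def limitPosterior (c z : ℝ) : ℝ :=
  stdDensity (z - 2 * c) / (stdDensity (z - 2 * c) + stdDensity (z + 2 * c))

/-- The regret of the belief rule `a` in the limit game at the local parameter `c`. -/
def limitRegretAt (a : ℝ → ℝ) (c : ℝ) : ℝ :=
  1 / 2 * (∫ z, stdDensity (z + 2 * c) * (limitPosterior c z - a z) ^ 2) +
    1 / 2 * (∫ z, stdDensity (z - 2 * c) * (limitPosterior c z - a z) ^ 2)

/-- Nature's payoff in the limit game from a mixed strategy `γ`. -/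
def limitRegret (a : ℝ → ℝ) (γ : ProbabilityMeasure ℝ) : ℝ :=
  ∫ c, limitRegretAt a c ∂(γ : Measure ℝ)

/-- The DM's strategies in the limit game: nondecreasing functions `ℝ → [0,1]`. -/
def limitDMStrategies : Set (ℝ → ℝ) := {a | Monotone a ∧ ∀ z, a z ∈ Icc (0 : ℝ) 1}

/-- Nature's strategies in the limit game: probability measures on `[0, ∞)`. -/
def limitNatureStrategies : Set (ProbabilityMeasure ℝ) :=
  {γ | (γ : Measure ℝ) (Ici 0) = 1}

/-- Nash equilibria of the limit game. -/
def IsLimitNash (a : ℝ → ℝ) (γ : ProbabilityMeasure ℝ) : Prop :=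
  IsNash limitDMStrategies limitNatureStrategies limitRegret a γ

/-! The embedding into a common space -/

/-- The common space of belief rules: nondecreasing functions `[0,1] → [0,1]` (as functions on
`ℝ`, of which only the values on `[0,1]` matter). -/
def commonDMSpace : Set (ℝ → ℝ) :=
  {f | MonotoneOn f (Icc 0 1) ∧ ∀ y ∈ Icc (0 : ℝ) 1, f y ∈ Icc (0 : ℝ) 1}

/-- The standard normal quantile function `Φ⁻¹` on `(0,1)`. -/
def stdQuantile (y : ℝ) : ℝ := sInf {z : ℝ | y ≤ stdCDF z}

/-- The embedding `y ↦ a (Φ⁻¹ y)` of a (bounded nondecreasing) limit strategy. Since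
`Φ⁻¹ 0 = -∞` and `Φ⁻¹ 1 = +∞`, the values at the endpoints are the limits of `a` there. -/
def embedLimit (a : ℝ → ℝ) (y : ℝ) : ℝ :=
  if y ≤ 0 then ⨅ z, a z else if 1 ≤ y then ⨆ z, a z else a (stdQuantile y)

/-- The grid point `y_{n,k} = Φ((k - n/2)/(√n/2))`. -/
def gridPoint (n k : ℕ) : ℝ := stdCDF (((k : ℝ) - (n : ℝ) / 2) / (√(n : ℝ) / 2))

/-- The piecewise linear interpolation of the points `(y_{n,k}, a_k)`, `0 ≤ k ≤ n`, constant to the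
left of `y_{n,0}` and to the right of `y_{n,n}`: as `y` crosses the interval
`[y_{n,k}, y_{n,k+1}]`, the `k`-th summand grows linearly from `0` to `a_{k+1} - a_k`, and it is
constant outside of this interval. -/
def embedFinite (n : ℕ) (a : Fin (n + 1) → ℝ) (y : ℝ) : ℝ :=
  a 0 + ∑ k : Fin n, (a k.succ - a k.castSucc) *
    max 0 (min 1 ((y - gridPoint n k) / (gridPoint n (k + 1) - gridPoint n k)))

end RobustLearning

end

/-! Under quadratic loss, the regret of any rule against a mixed strategy `γ` exceeds that of the
posterior rule `bayes γ` by a weighted squared distance (`SignalModel.average_risk_eq`). The DM's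
best reply is therefore `bayes γ`, and Nature looks for the `γ` at which this reply costs most.

The binomial experiments and the Gaussian limit are instances of one structure, `SignalModel`. For
all of them at once, `SignalModel.exists_risk_lt` shows that very precise signals are not worth
choosing: a strategy whose parameters all have regret at least `v` puts a definite mass on a fixed
interval `[δ, D)`, so a strong signal makes its Bayes rule nearly certain, and the regret at a large
`c` falls below `v`. Hence the equilibrium strategies of Nature live on one interval `[0, C]`, over
which the probability measures form a weakly compact set.

Existence in the limit game: the value of `γ` is an infimum of weakly continuous functionals, so it
has a maximiser on `[0, C]`, and perturbing the maximiser towards point masses shows that it forms a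
saddle point with its Bayes rule (`exists_limit_saddle`).

Uniqueness: as a function of `t = 2 c`, the regret against a Bayes rule has derivative `-exp (-t ^ 2
/ 2) * G t` with `G` strictly convex. Two positive maximisers would give, with Rolle's theorem,
three zeros of `G` (`argmax_unique`). So Nature mixes between `0` and a single positive `c₀`. Saddle
points being interchangeable, all equilibria share the DM's rule, and this rule determines the
weight on `0` (`limitNash_unique`).

Convergence: a central limit theorem for varying integrands (`tendsto_integral_countLaw`) passes the
equilibrium inequalities to the limit along any ultrafilter, so compactness and uniqueness force
convergence of Nature's strategies. The DM's finite equilibrium rules are Bayes rules too. They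
converge at converging scores, and monotonicity carries this over to the interpolations. -/

noncomputable section

namespace RobustLearning

/-! ### Quadratic loss and posterior for two states. -/

/-- The loss, weighted by likelihood, of the belief `b` when the two states have the
likelihoods `u` and `w`. -/
def lossKernel (u w b : ℝ) : ℝ := 1 / 2 * (u + w) * (u / (u + w) - b) ^ 2

/-- Bias-variance decomposition: the expected quadratic loss of `b` less that of the oracle. If `u +
w = 0`, both sides vanish because division by zero gives zero. -/
lemma lossKernel_eq {u w : ℝ} (hu : 0 ≤ u) (hw : 0 ≤ w) (b : ℝ) :
    lossKernel u w b = 1 / 2 * (u * (1 - b) ^ 2 + w * b ^ 2) - 1 / 2 * (u * w / (u + w)) := by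
  unfold lossKernel
  rcases (add_nonneg hu hw).eq_or_lt with h | h
  · have h1 : u = 0 := by linarith
    have h2 : w = 0 := by linarith
    simp [h1, h2]
  · field_simp
    ring

lemma lossKernel_nonneg {u w : ℝ} (hu : 0 ≤ u) (hw : 0 ≤ w) (b : ℝ) : 0 ≤ lossKernel u w b := by
  unfold lossKernel; positivity

lemma lossKernel_le {u w : ℝ} (hu : 0 ≤ u) (hw : 0 ≤ w) (b : ℝ) :
    lossKernel u w b ≤ 1 / 2 * (u * (1 - b) ^ 2 + w * b ^ 2) := by
  rw [lossKernel_eq hu hw]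
  have : 0 ≤ u * w / (u + w) := by positivity
  linarith

lemma lossKernel_le_half {u w b : ℝ} (hu : 0 ≤ u) (hw : 0 ≤ w) (hb : b ∈ Icc (0 : ℝ) 1) :
    lossKernel u w b ≤ 1 / 2 * (u + w) := by
  have h1 : (1 - b) ^ 2 ≤ 1 := by nlinarith [hb.1, hb.2]
  have h2 : b ^ 2 ≤ 1 := by nlinarith [hb.1, hb.2]
  have := lossKernel_le hu hw b
  nlinarith

/-- The oracle's loss cancels, so the difference is linear in the likelihoods and can be averaged
over Nature's mixed strategy. -/
lemma lossKernel_sub {u w : ℝ} (hu : 0 ≤ u) (hw : 0 ≤ w) (b b' : ℝ) :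
    lossKernel u w b - lossKernel u w b' =
      u * (1 / 2 * ((1 - b) ^ 2 - (1 - b') ^ 2)) + w * (1 / 2 * (b ^ 2 - b' ^ 2)) := by
  rw [lossKernel_eq hu hw, lossKernel_eq hu hw]; ring

lemma Measurable.lossKernel {α : Type*} [MeasurableSpace α] {f g h : α → ℝ} (hf : Measurable f)
    (hg : Measurable g) (hh : Measurable h) :
    Measurable fun x => lossKernel (f x) (g x) (h x) := by
  unfold RobustLearning.lossKernel; fun_prop

/-- The posterior of two states with (unnormalised) marginal likelihoods `u` and `w`, equal to
`1/2` when both vanish. -/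
def posterior (u w : ℝ) : ℝ := 1 / 2 * (1 + (u - w) / (u + w))

lemma posterior_eq {u w : ℝ} (h : u + w ≠ 0) : posterior u w = u / (u + w) := by
  unfold posterior; field_simp; ring

/-- The default `1/2` in `posterior` makes this hold even when both likelihoods vanish, where `u /
(u + w)` would violate it. -/
lemma posterior_swap (u w : ℝ) : posterior w u = 1 - posterior u w := by
  unfold posterior
  rw [add_comm w u, ← neg_sub u w, neg_div]; ring

lemma posterior_mem {u w : ℝ} (hu : 0 ≤ u) (hw : 0 ≤ w) : posterior u w ∈ Icc (0 : ℝ) 1 := by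
  rcases (add_nonneg hu hw).eq_or_lt with h | h
  · unfold posterior; rw [← h]; norm_num
  · rw [posterior_eq h.ne']
    exact ⟨by positivity, (div_le_one h).2 (by linarith)⟩

lemma posterior_mul {u w : ℝ} (hu : 0 ≤ u) (hw : 0 ≤ w) : (u + w) * posterior u w = u := by
  rcases (add_nonneg hu hw).eq_or_lt with h | h
  · rw [← h]; linarith
  · rw [posterior_eq h.ne']; field_simp

lemma measurable_posterior {α : Type*} [MeasurableSpace α] {f g : α → ℝ} (hf : Measurable f)
    (hg : Measurable g) : Measurable fun x => posterior (f x) (g x) := by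
  unfold posterior; fun_prop

/-! ### Symmetric experiments with a local precision, and the optimality of the Bayes rule. -/

/-- A binary-state experiment family with a local precision parameter: `lik c` is the density of
the signal in state `1` with respect to a reference measure `base`, the density in state `0`
is its image under an involution `flip`, and `score` is a real statistic of mean about `2 c` and
variance at most one. -/
structure SignalModel (Ω : Type) [MeasurableSpace Ω] where
  base : Measure Ω
  prob : IsProbabilityMeasure base
  flip : Ω → Ω
  score : Ω → ℝ
  lik : ℝ → Ω → ℝ
  params : Set ℝ
  params_nonneg : ∀ c ∈ params, 0 ≤ c
  flip_mp : MeasurePreserving flip base base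
  flip_flip : ∀ ω, flip (flip ω) = ω
  score_meas : Measurable score
  score_flip : ∀ ω, score (flip ω) = -score ω
  lik_meas : Measurable fun p : ℝ × Ω => lik p.1 p.2
  lik_nonneg : ∀ c ∈ params, ∀ ω, 0 ≤ lik c ω
  -- A bound uniform in the parameter makes the marginal likelihood finite for every mixed strategy.
  lik_bdd : ∀ ω, ∃ K, ∀ c ∈ params, lik c ω ≤ K
  lik_integral : ∀ c ∈ params, ∫ ω, lik c ω ∂base = 1
  moment_integrable : ∀ c ∈ params, Integrable (fun ω => lik c ω * (score ω - 2 * c) ^ 2) base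
  moment_le : ∀ c ∈ params, ∫ ω, lik c ω * (score ω - 2 * c) ^ 2 ∂base ≤ 1
  -- This and the next field make strong signals decisive: the likelihood in the wrong state stays
  -- bounded while that in the right state grows exponentially.
  lik_le_one : ∀ c ∈ params, ∀ ω, score ω ≤ 0 → lik c ω ≤ 1
  exp_le_lik : ∀ c ∈ params, ∀ c' ∈ params, 2 * c' ≤ c → ∀ ω, 3 / 2 * c ≤ score ω →
    Real.exp (c' * c) ≤ lik c' ω
  -- Nearly uninformative signals move the posterior by at most order `c * |score|`.
  lik_sub_le : ∀ c ∈ params, 4 * c ≤ 1 → ∀ ω,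
    |lik c ω - lik c (flip ω)| ≤ 4 * c * |score ω| * (lik c ω + lik c (flip ω))

namespace SignalModel

variable {Ω : Type} [MeasurableSpace Ω] (M : SignalModel Ω)

instance : IsProbabilityMeasure M.base := M.prob

/-- The regret of a belief rule at a parameter. -/
def risk (b : Ω → ℝ) (c : ℝ) : ℝ :=
  ∫ ω, lossKernel (M.lik c ω) (M.lik c (M.flip ω)) (b ω) ∂M.base

/-- The marginal likelihood of a signal in state `1`. -/
def marg (ν : Measure ℝ) (ω : Ω) : ℝ := ∫ c, M.lik c ω ∂ν

/-- The belief rule that is optimal against a mixed strategy of Nature. -/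
def bayes (ν : Measure ℝ) (ω : Ω) : ℝ := posterior (M.marg ν ω) (M.marg ν (M.flip ω))

lemma flip_meas : Measurable M.flip := M.flip_mp.measurable

lemma lik_meas_right (c : ℝ) : Measurable (M.lik c) :=
  M.lik_meas.comp (measurable_const.prodMk measurable_id)

lemma lik_meas_left (ω : Ω) : Measurable fun c => M.lik c ω :=
  M.lik_meas.comp (measurable_id.prodMk measurable_const)

lemma lik_flip_meas : Measurable fun p : ℝ × Ω => M.lik p.1 (M.flip p.2) :=
  M.lik_meas.comp (measurable_fst.prodMk (M.flip_meas.comp measurable_snd))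

lemma lik_integrable {c : ℝ} (hc : c ∈ M.params) : Integrable (M.lik c) M.base := by
  -- The integral of a nonintegrable function is `0`, whereas here it is `1`.
  by_contra h
  have := M.lik_integral c hc
  rw [integral_undef h] at this
  exact zero_ne_one this

lemma lik_flip_integrable {c : ℝ} (hc : c ∈ M.params) :
    Integrable (fun ω => M.lik c (M.flip ω)) M.base :=
  M.flip_mp.integrable_comp_of_integrable (M.lik_integrable hc)

lemma integral_comp_flip (f : Ω → ℝ) (hf : Measurable f) :
    ∫ ω, f (M.flip ω) ∂M.base = ∫ ω, f ω ∂M.base := by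
  conv_rhs => rw [← M.flip_mp.map_eq]
  rw [integral_map M.flip_meas.aemeasurable hf.aestronglyMeasurable]

lemma lik_flip_integral {c : ℝ} (hc : c ∈ M.params) :
    ∫ ω, M.lik c (M.flip ω) ∂M.base = 1 := by
  rw [M.integral_comp_flip _ (M.lik_meas_right c), M.lik_integral c hc]

section Average

variable {ν : Measure ℝ} [IsProbabilityMeasure ν]

lemma lik_integrable_left (hν : ∀ᵐ c ∂ν, c ∈ M.params) (ω : Ω) :
    Integrable (fun c => M.lik c ω) ν := by
  obtain ⟨K, hK⟩ := M.lik_bdd ω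
  refine Integrable.of_bound (M.lik_meas_left ω).aestronglyMeasurable K ?_
  filter_upwards [hν] with c hc
  rw [Real.norm_of_nonneg (M.lik_nonneg c hc ω)]
  exact hK c hc

omit [IsProbabilityMeasure ν] in
lemma marg_nonneg (hν : ∀ᵐ c ∂ν, c ∈ M.params) (ω : Ω) : 0 ≤ M.marg ν ω := by
  refine integral_nonneg_of_ae ?_
  filter_upwards [hν] with c hc using M.lik_nonneg c hc ω

lemma marg_meas : Measurable (M.marg ν) := by
  have h : StronglyMeasurable fun p : Ω × ℝ => M.lik p.2 p.1 :=
    (M.lik_meas.comp measurable_swap).stronglyMeasurable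
  exact h.integral_prod_right.measurable

lemma bayes_meas : Measurable (M.bayes ν) :=
  measurable_posterior M.marg_meas (M.marg_meas.comp M.flip_meas)

omit [IsProbabilityMeasure ν] in
lemma bayes_mem (hν : ∀ᵐ c ∂ν, c ∈ M.params) (ω : Ω) : M.bayes ν ω ∈ Icc (0 : ℝ) 1 :=
  posterior_mem (M.marg_nonneg hν _) (M.marg_nonneg hν _)

omit [IsProbabilityMeasure ν] in
lemma bayes_flip (ω : Ω) : M.bayes ν (M.flip ω) = 1 - M.bayes ν ω := by
  unfold bayes
  rw [M.flip_flip, posterior_swap]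

lemma lik_prod_integrable (hν : ∀ᵐ c ∂ν, c ∈ M.params) :
    Integrable (fun p : ℝ × Ω => M.lik p.1 p.2) (ν.prod M.base) := by
  rw [integrable_prod_iff M.lik_meas.aestronglyMeasurable]
  refine ⟨?_, ?_⟩
  · filter_upwards [hν] with c hc using M.lik_integrable hc
  · refine (integrable_congr ?_).2 (integrable_const (1 : ℝ))
    filter_upwards [hν] with c hc
    rw [← M.lik_integral c hc]
    exact integral_congr_ae (.of_forall fun ω => Real.norm_of_nonneg (M.lik_nonneg c hc ω))

lemma lik_flip_prod_integrable (hν : ∀ᵐ c ∂ν, c ∈ M.params) :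
    Integrable (fun p : ℝ × Ω => M.lik p.1 (M.flip p.2)) (ν.prod M.base) := by
  rw [integrable_prod_iff M.lik_flip_meas.aestronglyMeasurable]
  refine ⟨?_, ?_⟩
  · filter_upwards [hν] with c hc using M.lik_flip_integrable hc
  · refine (integrable_congr ?_).2 (integrable_const (1 : ℝ))
    filter_upwards [hν] with c hc
    rw [← M.lik_flip_integral hc]
    exact integral_congr_ae (.of_forall fun _ => Real.norm_of_nonneg (M.lik_nonneg c hc _))

lemma lossKernel_integrable {b : Ω → ℝ} (hb : Measurable b) (hb' : ∀ ω, b ω ∈ Icc (0 : ℝ) 1)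
    {c : ℝ} (hc : c ∈ M.params) :
    Integrable (fun ω => lossKernel (M.lik c ω) (M.lik c (M.flip ω)) (b ω)) M.base := by
  refine Integrable.mono' (((M.lik_integrable hc).add (M.lik_flip_integrable hc)).const_mul
    (1 / 2)) ?_ (.of_forall fun ω => ?_)
  · exact (Measurable.lossKernel (M.lik_meas_right c) ((M.lik_meas_right c).comp M.flip_meas)
      hb).aestronglyMeasurable
  · rw [Real.norm_of_nonneg (lossKernel_nonneg (M.lik_nonneg c hc _) (M.lik_nonneg c hc _) _)]
    exact lossKernel_le_half (M.lik_nonneg c hc _) (M.lik_nonneg c hc _) (hb' ω)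

lemma risk_nonneg (b : Ω → ℝ) {c : ℝ} (hc : c ∈ M.params) : 0 ≤ M.risk b c :=
  integral_nonneg fun _ => lossKernel_nonneg (M.lik_nonneg c hc _) (M.lik_nonneg c hc _) _

lemma risk_le_one {b : Ω → ℝ} (hb : Measurable b) (hb' : ∀ ω, b ω ∈ Icc (0 : ℝ) 1)
    {c : ℝ} (hc : c ∈ M.params) : M.risk b c ≤ 1 := by
  calc M.risk b c ≤ ∫ ω, 1 / 2 * (M.lik c ω + M.lik c (M.flip ω)) ∂M.base := by
        refine integral_mono (M.lossKernel_integrable hb hb' hc)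
          (((M.lik_integrable hc).add (M.lik_flip_integrable hc)).const_mul (1 / 2)) fun ω => ?_
        exact lossKernel_le_half (M.lik_nonneg c hc _) (M.lik_nonneg c hc _) (hb' ω)
    _ = 1 := by
        rw [integral_const_mul, integral_add (M.lik_integrable hc) (M.lik_flip_integrable hc),
          M.lik_integral c hc, M.lik_flip_integral hc]
        norm_num

lemma risk_meas {b : Ω → ℝ} (hb : Measurable b) : Measurable (M.risk b) := by
  have h : StronglyMeasurable fun p : ℝ × Ω =>
      lossKernel (M.lik p.1 p.2) (M.lik p.1 (M.flip p.2)) (b p.2) :=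
    (Measurable.lossKernel M.lik_meas M.lik_flip_meas (hb.comp measurable_snd)).stronglyMeasurable
  exact h.integral_prod_right.measurable

lemma risk_integrable {b : Ω → ℝ} (hb : Measurable b) (hb' : ∀ ω, b ω ∈ Icc (0 : ℝ) 1)
    (hν : ∀ᵐ c ∂ν, c ∈ M.params) : Integrable (M.risk b) ν := by
  refine Integrable.of_bound (M.risk_meas hb).aestronglyMeasurable 1 ?_
  filter_upwards [hν] with c hc
  rw [Real.norm_of_nonneg (M.risk_nonneg b hc)]
  exact M.risk_le_one hb hb' hc

/-- The excess regret of a belief rule over the Bayes rule. -/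
lemma average_risk_eq {b : Ω → ℝ} (hb : Measurable b) (hb' : ∀ ω, b ω ∈ Icc (0 : ℝ) 1)
    (hν : ∀ᵐ c ∂ν, c ∈ M.params) :
    ∫ c, M.risk b c ∂ν = ∫ c, M.risk (M.bayes ν) c ∂ν +
      ∫ ω, 1 / 2 * (M.marg ν ω + M.marg ν (M.flip ω)) * (b ω - M.bayes ν ω) ^ 2 ∂M.base := by
  set β := M.bayes ν with hβ
  have hβm : Measurable β := M.bayes_meas
  have hβ' : ∀ ω, β ω ∈ Icc (0 : ℝ) 1 := M.bayes_mem hν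
  rw [← sub_eq_iff_eq_add', ← integral_sub (M.risk_integrable hb hb' hν)
    (M.risk_integrable hβm hβ' hν)]
  -- The bounded coefficients of the two likelihoods in `lossKernel_sub`. They do not depend on `c`,
  -- so after Fubini only the marginal likelihoods remain.
  set p : Ω → ℝ := fun ω => 1 / 2 * ((1 - b ω) ^ 2 - (1 - β ω) ^ 2) with hp
  set q : Ω → ℝ := fun ω => 1 / 2 * (b ω ^ 2 - β ω ^ 2) with hq
  have hpm : Measurable p := by fun_prop
  have hqm : Measurable q := by fun_prop
  have hpb : ∀ ω, ‖p ω‖ ≤ 1 := fun ω => by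
    rw [Real.norm_eq_abs, abs_le]
    constructor <;> simp only [hp] <;>
      nlinarith [(hb' ω).1, (hb' ω).2, (hβ' ω).1, (hβ' ω).2]
  have hqb : ∀ ω, ‖q ω‖ ≤ 1 := fun ω => by
    rw [Real.norm_eq_abs, abs_le]
    constructor <;> simp only [hq] <;>
      nlinarith [(hb' ω).1, (hb' ω).2, (hβ' ω).1, (hβ' ω).2]
  have hint : Integrable (fun x : ℝ × Ω =>
      M.lik x.1 x.2 * p x.2 + M.lik x.1 (M.flip x.2) * q x.2) (ν.prod M.base) := by
    refine Integrable.add ?_ ?_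
    · exact (M.lik_prod_integrable hν).mul_bdd (c := 1)
        (hpm.comp measurable_snd).aestronglyMeasurable (.of_forall fun x => hpb x.2)
    · exact (M.lik_flip_prod_integrable hν).mul_bdd (c := 1)
        (hqm.comp measurable_snd).aestronglyMeasurable (.of_forall fun x => hqb x.2)
  have h1 : ∀ᵐ c ∂ν, M.risk b c - M.risk β c =
      ∫ ω, M.lik c ω * p ω + M.lik c (M.flip ω) * q ω ∂M.base := by
    filter_upwards [hν] with c hc
    unfold risk
    rw [← integral_sub (M.lossKernel_integrable hb hb' hc) (M.lossKernel_integrable hβm hβ' hc)]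
    refine integral_congr_ae (.of_forall fun ω => ?_)
    exact lossKernel_sub (M.lik_nonneg c hc _) (M.lik_nonneg c hc _) _ _
  rw [integral_congr_ae h1, integral_integral_swap hint]
  refine integral_congr_ae (.of_forall fun ω => ?_)
  -- The identity `(u + w) * β = u` removes the cross term and leaves a perfect square.
  have hm := posterior_mul (M.marg_nonneg hν ω) (M.marg_nonneg hν (M.flip ω))
  change _ * β ω = _ at hm
  have e1 : ∫ c, M.lik c ω * p ω + M.lik c (M.flip ω) * q ω ∂ν =
      M.marg ν ω * p ω + M.marg ν (M.flip ω) * q ω := by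
    rw [integral_add ((M.lik_integrable_left hν ω).mul_const _)
      ((M.lik_integrable_left hν _).mul_const _), integral_mul_const, integral_mul_const]
    rfl
  refine e1.trans ?_
  simp only [hp, hq]
  linear_combination (b ω - β ω) * hm

end Average

end SignalModel

/-! ### Large parameters are dominated, uniformly over all experiments. -/

namespace SignalModel

variable {Ω : Type} [MeasurableSpace Ω] (M : SignalModel Ω)

lemma lik_mul_integrable {c : ℝ} (hc : c ∈ M.params) {f : Ω → ℝ} (hf : Measurable f)
    (hf' : ∀ ω, f ω ∈ Icc (0 : ℝ) 1) : Integrable (fun ω => M.lik c ω * f ω) M.base :=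
  (M.lik_integrable hc).mul_bdd (c := 1) hf.aestronglyMeasurable
    (.of_forall fun ω => by rw [Real.norm_of_nonneg (hf' ω).1]; exact (hf' ω).2)

/-- The regret of a symmetric belief rule is at most its expected loss in state `1`. -/
lemma risk_le_of_flip {b : Ω → ℝ} (hb : Measurable b) (hb' : ∀ ω, b ω ∈ Icc (0 : ℝ) 1)
    (hflip : ∀ ω, b (M.flip ω) = 1 - b ω) {c : ℝ} (hc : c ∈ M.params) :
    M.risk b c ≤ ∫ ω, M.lik c ω * (1 - b ω) ∂M.base := by
  have hi1 : Integrable (fun ω => M.lik c ω * (1 - b ω)) M.base :=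
    M.lik_mul_integrable hc (measurable_const.sub hb) fun ω =>
      ⟨by linarith [(hb' ω).2], by linarith [(hb' ω).1]⟩
  have hi2 : Integrable (fun ω => M.lik c (M.flip ω) * b ω) M.base := by
    have := M.flip_mp.integrable_comp_of_integrable hi1
    refine this.congr (.of_forall fun ω => ?_)
    simp [hflip]
  have h2 : ∫ ω, M.lik c (M.flip ω) * b ω ∂M.base = ∫ ω, M.lik c ω * (1 - b ω) ∂M.base := by
    rw [← M.integral_comp_flip (fun ω => M.lik c ω * (1 - b ω))
      ((M.lik_meas_right c).mul (measurable_const.sub hb))]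
    refine integral_congr_ae (.of_forall fun ω => ?_)
    simp [hflip]
  calc M.risk b c
      ≤ ∫ ω, 1 / 2 * (M.lik c ω * (1 - b ω) + M.lik c (M.flip ω) * b ω) ∂M.base := by
        refine integral_mono (M.lossKernel_integrable hb hb' hc) ((hi1.add hi2).const_mul _)
          fun ω => ?_
        refine (lossKernel_le (M.lik_nonneg c hc _) (M.lik_nonneg c hc _) _).trans ?_
        -- First powers replace squares because `marg * (1 - b)` is the quantity that Bayes' formula
        -- controls.
        have h1 : (1 - b ω) ^ 2 ≤ 1 - b ω := by nlinarith [(hb' ω).1, (hb' ω).2]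
        have h2 : b ω ^ 2 ≤ b ω := by nlinarith [(hb' ω).1, (hb' ω).2]
        have h3 := mul_le_mul_of_nonneg_left h1 (M.lik_nonneg c hc ω)
        have h4 := mul_le_mul_of_nonneg_left h2 (M.lik_nonneg c hc (M.flip ω))
        linarith
    _ = ∫ ω, M.lik c ω * (1 - b ω) ∂M.base := by
        rw [integral_const_mul, integral_add hi1 hi2, h2]; ring

/-- Chebyshev's inequality for the score, whose second moment about `2 * c` is at most one. -/
lemma setIntegral_lik_le {c d : ℝ} (hc : c ∈ M.params) (hd : 0 < d) {T : Set Ω}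
    (hT : MeasurableSet T) (hTd : ∀ ω ∈ T, M.score ω ≤ 2 * c - d) :
    ∫ ω in T, M.lik c ω ∂M.base ≤ 1 / d ^ 2 := by
  have hm := M.moment_integrable c hc
  calc ∫ ω in T, M.lik c ω ∂M.base
      ≤ ∫ ω in T, 1 / d ^ 2 * (M.lik c ω * (M.score ω - 2 * c) ^ 2) ∂M.base := by
        refine setIntegral_mono_on (M.lik_integrable hc).integrableOn
          (hm.const_mul _).integrableOn hT fun ω hω => ?_
        have h1 : d ^ 2 ≤ (M.score ω - 2 * c) ^ 2 := by nlinarith [hTd ω hω]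
        have h2 := mul_le_mul_of_nonneg_left h1 (M.lik_nonneg c hc ω)
        rw [one_div, ← div_eq_inv_mul, le_div_iff₀ (by positivity)]
        exact h2
    _ ≤ ∫ ω, 1 / d ^ 2 * (M.lik c ω * (M.score ω - 2 * c) ^ 2) ∂M.base := by
        refine setIntegral_le_integral (hm.const_mul _) (.of_forall fun ω => ?_)
        have := M.lik_nonneg c hc ω
        simp only [Pi.zero_apply]
        positivity
    _ ≤ 1 / d ^ 2 := by
        rw [integral_const_mul]
        exact mul_le_of_le_one_right (by positivity) (M.moment_le c hc)

/-- By `lik_sub_le` the oracle's belief is within `2 * c * |score|` of `1/2`, and the score has a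
bounded second moment. -/
lemma risk_half_le {c : ℝ} (hc : c ∈ M.params) (h4 : 4 * c ≤ 1) :
    M.risk (fun _ => 1 / 2) c ≤ 16 * c ^ 2 := by
  have hc0 := M.params_nonneg c hc
  -- Only the moment about `2 * c` is controlled, so `score ^ 2` is dominated by `2 * (score - 2 *
  -- c) ^ 2 + 8 * c ^ 2`.
  set g : Ω → ℝ := fun ω => M.lik c ω * (2 * (M.score ω - 2 * c) ^ 2 + 8 * c ^ 2) with hg
  have hgi : Integrable g M.base := by
    have := ((M.moment_integrable c hc).const_mul 2).add ((M.lik_integrable hc).const_mul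
      (8 * c ^ 2))
    refine this.congr (.of_forall fun ω => ?_)
    simp only [hg, Pi.add_apply]; ring
  have hgm : Measurable g := (M.lik_meas_right c).mul (by have := M.score_meas; fun_prop)
  have hgI : ∫ ω, g ω ∂M.base ≤ 2 + 8 * c ^ 2 := by
    have : ∫ ω, g ω ∂M.base = ∫ ω, (2 * (M.lik c ω * (M.score ω - 2 * c) ^ 2) +
        8 * c ^ 2 * M.lik c ω) ∂M.base := integral_congr_ae (.of_forall fun ω => by
      simp only [hg]; ring)
    rw [this, integral_add ((M.moment_integrable c hc).const_mul 2)
      ((M.lik_integrable hc).const_mul _), integral_const_mul, integral_const_mul,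
      M.lik_integral c hc]
    linarith [M.moment_le c hc]
  have hgf : Integrable (fun ω => g (M.flip ω)) M.base :=
    M.flip_mp.integrable_comp_of_integrable hgi
  have hgfI : ∫ ω, g (M.flip ω) ∂M.base ≤ 2 + 8 * c ^ 2 := by
    rw [M.integral_comp_flip g hgm]; exact hgI
  calc M.risk (fun _ => 1 / 2) c ≤ ∫ ω, 2 * c ^ 2 * (g ω + g (M.flip ω)) ∂M.base := by
        refine integral_mono (M.lossKernel_integrable measurable_const
          (fun _ => by norm_num) hc) ((hgi.add hgf).const_mul _) fun ω => ?_
        have hu := M.lik_nonneg c hc ω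
        have hw := M.lik_nonneg c hc (M.flip ω)
        have hd := M.lik_sub_le c hc h4 ω
        set u := M.lik c ω
        set w := M.lik c (M.flip ω)
        set Z := M.score ω with hZ
        have key : lossKernel u w (1 / 2) ≤ 2 * c ^ 2 * Z ^ 2 * (u + w) := by
          unfold lossKernel
          rcases (add_nonneg hu hw).eq_or_lt with h | h
          · rw [← h]; simp
          · have e : u / (u + w) - 1 / 2 = (u - w) / (u + w) / 2 := by field_simp; ring
            have h5 : ((u - w) / (u + w)) ^ 2 ≤ (4 * c * |Z|) ^ 2 := by
              rw [← sq_abs, abs_div, abs_of_pos h]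
              refine pow_le_pow_left₀ (by positivity) ?_ 2
              rwa [div_le_iff₀ h]
            rw [mul_pow, mul_pow, sq_abs] at h5
            rw [e, div_pow]
            have := mul_le_mul_of_nonneg_left h5 h.le
            nlinarith
        refine key.trans ?_
        have e1 : Z ^ 2 ≤ 2 * (Z - 2 * c) ^ 2 + 8 * c ^ 2 := by nlinarith [sq_nonneg (Z - 4 * c)]
        have e2 : Z ^ 2 ≤ 2 * (-Z - 2 * c) ^ 2 + 8 * c ^ 2 := by nlinarith [sq_nonneg (Z + 4 * c)]
        have e3 := mul_le_mul_of_nonneg_left e1 hu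
        have e4 := mul_le_mul_of_nonneg_left e2 hw
        have e5 : Z ^ 2 * (u + w) ≤ g ω + g (M.flip ω) := by
          simp only [hg, M.score_flip, ← hZ]
          linarith
        have := mul_le_mul_of_nonneg_left e5 (by positivity : 0 ≤ 2 * c ^ 2)
        linarith
    _ ≤ 16 * c ^ 2 := by
        rw [integral_const_mul, integral_add hgi hgf]
        nlinarith [sq_nonneg c, mul_nonneg (sq_nonneg c) hc0]

variable {ν : Measure ℝ} [IsProbabilityMeasure ν]

-- With marginals `m` and `m'`, the left side is `m * m' / (m + m')`, which is at most `m'`.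
omit [IsProbabilityMeasure ν] in
lemma marg_mul_one_sub_bayes_le (hν : ∀ᵐ c ∂ν, c ∈ M.params) (ω : Ω) :
    M.marg ν ω * (1 - M.bayes ν ω) ≤ M.marg ν (M.flip ω) := by
  have h := posterior_mul (M.marg_nonneg hν (M.flip ω)) (M.marg_nonneg hν ω)
  rw [posterior_swap] at h
  change _ * (1 - M.bayes ν ω) = _ at h
  have := mul_nonneg (M.marg_nonneg hν (M.flip ω)) (sub_nonneg.2 (M.bayes_mem hν ω).2)
  nlinarith

/-- For `c ≥ d` a score below `d` has probability at most `1 / d ^ 2`. On scores above `d`, the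
averaged error of the Bayes rule is at most the probability of such scores in the wrong state, again
at most `1 / d ^ 2`. Thus the parameters beyond `d` contribute at most `2 / d ^ 2` in total, while
each of them has regret at least `v`. -/
lemma tail_mass_le {v : ℝ} (hv : 0 < v) (hν : ∀ᵐ c ∂ν, c ∈ M.params)
    (hrisk : ∀ᵐ c ∂ν, v ≤ M.risk (M.bayes ν) c) {d : ℝ} (hd : 0 < d) :
    ν.real (Ici d) ≤ 2 / (d ^ 2 * v) := by
  set b := M.bayes ν with hb
  have hbm : Measurable b := M.bayes_meas
  have hb' : ∀ ω, b ω ∈ Icc (0 : ℝ) 1 := M.bayes_mem hν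
  have h1b : ∀ ω, 1 - b ω ∈ Icc (0 : ℝ) 1 := fun ω =>
    ⟨by linarith [(hb' ω).2], by linarith [(hb' ω).1]⟩
  set T : Set Ω := {ω | d ≤ M.score ω} with hT
  have hTm : MeasurableSet T := measurableSet_le measurable_const M.score_meas
  set g : ℝ → ℝ := fun c => ∫ ω in T, M.lik c ω * (1 - b ω) ∂M.base with hg
  have hprod : Integrable (fun p : ℝ × Ω => M.lik p.1 p.2 * (1 - b p.2))
      (ν.prod M.base) :=
    (M.lik_prod_integrable hν).mul_bdd (c := 1)
      ((measurable_const.sub hbm).comp measurable_snd).aestronglyMeasurable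
      (.of_forall fun x => by rw [Real.norm_of_nonneg (h1b _).1]; exact (h1b _).2)
  have hprodT : Integrable (fun p : ℝ × Ω => M.lik p.1 p.2 * (1 - b p.2))
      (ν.prod (M.base.restrict T)) := by
    refine hprod.mono_measure ?_
    exact Measure.prod_mono le_rfl Measure.restrict_le_self
  have hflipT : Integrable (fun p : ℝ × Ω => M.lik p.1 (M.flip p.2))
      (ν.prod (M.base.restrict T)) :=
    (M.lik_flip_prod_integrable hν).mono_measure
      (Measure.prod_mono le_rfl Measure.restrict_le_self)
  have hgi : Integrable g ν := hprodT.integral_prod_left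
  have hg0 : 0 ≤ᵐ[ν] g := by
    filter_upwards [hν] with c hc
    exact integral_nonneg fun ω => mul_nonneg (M.lik_nonneg c hc ω) (h1b ω).1
  have hgI : ∫ c, g c ∂ν ≤ 1 / d ^ 2 := by
    calc ∫ c, g c ∂ν = ∫ ω in T, ∫ c, M.lik c ω * (1 - b ω) ∂ν ∂M.base :=
          integral_integral_swap hprodT
      _ ≤ ∫ ω in T, ∫ c, M.lik c (M.flip ω) ∂ν ∂M.base := by
          refine integral_mono hprodT.integral_prod_right hflipT.integral_prod_right fun ω => ?_
          simp only [integral_mul_const]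
          exact M.marg_mul_one_sub_bayes_le hν ω
      _ = ∫ c, ∫ ω in T, M.lik c (M.flip ω) ∂M.base ∂ν := (integral_integral_swap hflipT).symm
      _ ≤ ∫ _, 1 / d ^ 2 ∂ν := by
          refine integral_mono_ae hflipT.integral_prod_left (integrable_const _) ?_
          filter_upwards [hν] with c hc
          -- A score above `d` in state `0` is, after flipping, a score below `-d` in state `1`,
          -- which is at least `d` below the mean `2 * c`.
          have hpre : T = M.flip ⁻¹' {ω | M.score ω ≤ -d} := by
            ext ω; simp [hT, M.score_flip]
          have hm : MeasurableSet {ω | M.score ω ≤ -d} :=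
            measurableSet_le M.score_meas measurable_const
          calc ∫ ω in T, M.lik c (M.flip ω) ∂M.base
              = ∫ ω in {ω | M.score ω ≤ -d}, M.lik c ω ∂M.base := by
                rw [hpre]
                conv_rhs => rw [← M.flip_mp.map_eq]
                rw [setIntegral_map hm (M.lik_meas_right c).aestronglyMeasurable
                  M.flip_meas.aemeasurable]
            _ ≤ 1 / d ^ 2 := M.setIntegral_lik_le hc hd hm fun ω hω => by
                have := M.params_nonneg c hc
                simp only [mem_ofPred_eq] at hω
                linarith
      _ = 1 / d ^ 2 := by simp
  have hup : ∀ᵐ c ∂ν.restrict (Ici d), v ≤ g c + 1 / d ^ 2 := by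
    filter_upwards [ae_restrict_of_ae hν, ae_restrict_of_ae hrisk,
      ae_restrict_mem measurableSet_Ici] with c hc hr hcd
    have hi : Integrable (fun ω => M.lik c ω * (1 - b ω)) M.base :=
      M.lik_mul_integrable hc (measurable_const.sub hbm) h1b
    have h1 := M.risk_le_of_flip hbm hb' M.bayes_flip hc
    rw [← integral_add_compl hTm hi] at h1
    have h2 : ∫ ω in Tᶜ, M.lik c ω * (1 - b ω) ∂M.base ≤ ∫ ω in Tᶜ, M.lik c ω ∂M.base := by
      refine integral_mono hi.integrableOn (M.lik_integrable hc).integrableOn fun ω => ?_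
      exact mul_le_of_le_one_right (M.lik_nonneg c hc ω) (h1b ω).2
    have h3 := M.setIntegral_lik_le hc hd hTm.compl fun ω hω => by
      simp only [hT, mem_compl_iff, mem_ofPred_eq, not_le] at hω
      have : d ≤ c := hcd
      linarith
    linarith
  have h4 : v * ν.real (Ici d) ≤ 1 / d ^ 2 + 1 / d ^ 2 := by
    calc v * ν.real (Ici d) = ∫ _ in Ici d, v ∂ν := by
          rw [setIntegral_const, smul_eq_mul, mul_comm]
      _ ≤ ∫ c in Ici d, (g c + 1 / d ^ 2) ∂ν :=
          integral_mono_ae (integrable_const _) (hgi.restrict.add (integrable_const _)) hup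
      _ = ∫ c in Ici d, g c ∂ν + ν.real (Ici d) * (1 / d ^ 2) := by
          rw [integral_add hgi.integrableOn (integrable_const _), setIntegral_const, smul_eq_mul]
      _ ≤ 1 / d ^ 2 + 1 / d ^ 2 := by
          refine add_le_add ((setIntegral_le_integral hgi hg0).trans hgI) ?_
          exact mul_le_of_le_one_left (by positivity) measureReal_le_one
  rw [le_div_iff₀ (by positivity)]
  have h5 : 1 / d ^ 2 + 1 / d ^ 2 = 2 / d ^ 2 := by ring
  rw [h5, le_div_iff₀ (by positivity)] at h4
  linarith

/-- The constant rule `1/2` has regret at most `v / 2` below `d` and at most `1` above. The Bayes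
rule averages at least `v` and does no worse than this constant rule. -/
lemma le_mass_Ici {v : ℝ} (hν : ∀ᵐ c ∂ν, c ∈ M.params)
    (hrisk : ∀ᵐ c ∂ν, v ≤ M.risk (M.bayes ν) c) {d : ℝ} (hd4 : 4 * d ≤ 1)
    (hdv : 16 * d ^ 2 ≤ v / 2) (hv : 0 < v) :
    v / 2 ≤ ν.real (Ici d) := by
  have hh : Measurable fun _ : Ω => (1 / 2 : ℝ) := measurable_const
  have hh' : ∀ _ : Ω, (1 / 2 : ℝ) ∈ Icc (0 : ℝ) 1 := fun _ => by norm_num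
  have h1 : ∫ c, M.risk (M.bayes ν) c ∂ν ≤ ∫ c, M.risk (fun _ => 1 / 2) c ∂ν := by
    rw [M.average_risk_eq hh hh' hν]
    refine le_add_of_nonneg_right (integral_nonneg fun ω => ?_)
    have := M.marg_nonneg hν ω
    have := M.marg_nonneg hν (M.flip ω)
    simp only [Pi.zero_apply]
    positivity
  have h2 : v ≤ ∫ c, M.risk (M.bayes ν) c ∂ν := by
    calc v = ∫ _, v ∂ν := by simp
      _ ≤ _ := integral_mono_ae (integrable_const _)
        (M.risk_integrable M.bayes_meas (M.bayes_mem hν) hν) hrisk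
  have h3 : ∫ c, M.risk (fun _ => 1 / 2) c ∂ν ≤ v / 2 + ν.real (Ici d) := by
    calc ∫ c, M.risk (fun _ => 1 / 2) c ∂ν
        ≤ ∫ c, (v / 2 + (Ici d).indicator (fun _ => (1 : ℝ)) c) ∂ν := by
          refine integral_mono_ae (M.risk_integrable hh hh' hν) ((integrable_const _).add
            ((integrable_const _).indicator measurableSet_Ici)) ?_
          filter_upwards [hν] with c hc
          by_cases hcd : d ≤ c
          · have : c ∈ Ici d := hcd
            simp only [indicator_of_mem this]
            have := M.risk_le_one hh hh' hc
            linarith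
          · have : c ∉ Ici d := hcd
            simp only [indicator_of_notMem this]
            push Not at hcd
            have h0 := M.params_nonneg c hc
            have := M.risk_half_le hc (by linarith)
            nlinarith
      _ = v / 2 + ν.real (Ici d) := by
          rw [integral_add (integrable_const _)
            ((integrable_const _).indicator measurableSet_Ici),
            integral_indicator measurableSet_Ici]
          simp
  linarith

/-- A uniform bound on the parameters that are not dominated: if Nature's strategy `ν` only uses
parameters of regret at least `v` against its own Bayes rule, then parameters beyond a constant
that depends on `v` only have a smaller regret. -/
theorem exists_risk_lt {v : ℝ} (hv : 0 < v) : ∃ C : ℝ, 0 < C ∧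
    ∀ (Ω : Type) [MeasurableSpace Ω] (M : SignalModel Ω) (ν : Measure ℝ)
      [IsProbabilityMeasure ν], (∀ᵐ c ∂ν, c ∈ M.params) →
      (∀ᵐ c ∂ν, v ≤ M.risk (M.bayes ν) c) → ∀ c ∈ M.params, C ≤ c → M.risk (M.bayes ν) c < v := by
  -- From `δ ≤ 1/4` and `δ ≤ v/8` one gets `16 * δ ^ 2 ≤ v / 2`, as `le_mass_Ici` requires.
  obtain ⟨δ, hδ, hδ4, hδv⟩ : ∃ δ : ℝ, 0 < δ ∧ 4 * δ ≤ 1 ∧ 16 * δ ^ 2 ≤ v / 2 := by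
    refine ⟨min (1 / 4) (v / 8), by positivity, by linarith [min_le_left (1 / 4 : ℝ) (v / 8)], ?_⟩
    have h1 := min_le_left (1 / 4 : ℝ) (v / 8)
    have h2 := min_le_right (1 / 4 : ℝ) (v / 8)
    have h3 : (0 : ℝ) < min (1 / 4) (v / 8) := by positivity
    nlinarith
  -- The mass beyond `D` is then at most `v / 4`, so at least `v / 4` of the mass `v / 2` beyond `δ`
  -- lies in `[δ, D)`.
  obtain ⟨D, hD, hDv⟩ : ∃ D : ℝ, 0 < D ∧ 2 / (D ^ 2 * v) ≤ v / 4 := by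
    refine ⟨1 + 8 / v ^ 2, by positivity, ?_⟩
    rw [div_le_iff₀ (by positivity)]
    have : (1 + 8 / v ^ 2) ^ 2 ≥ 8 / v ^ 2 := by
      have : 0 ≤ 8 / v ^ 2 := by positivity
      nlinarith
    have h2 : v / 4 * (8 / v ^ 2 * v) = 2 := by field_simp; norm_num
    nlinarith [mul_le_mul_of_nonneg_left this (by positivity : 0 ≤ v / 4 * v)]
  have hlim : Tendsto (fun c : ℝ => 4 / c ^ 2 + 4 / v * Real.exp (-(δ * c))) atTop (𝓝 0) := by
    have h1 : Tendsto (fun c : ℝ => 4 / c ^ 2) atTop (𝓝 0) :=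
      tendsto_const_nhds.div_atTop (tendsto_pow_atTop two_ne_zero)
    have h2 : Tendsto (fun c : ℝ => Real.exp (-(δ * c))) atTop (𝓝 0) :=
      Real.tendsto_exp_neg_atTop_nhds_zero.comp (tendsto_id.const_mul_atTop hδ)
    simpa using h1.add (h2.const_mul (4 / v))
  obtain ⟨C₁, hC₁⟩ := eventually_atTop.1 (hlim.eventually (gt_mem_nhds hv))
  -- The bound `2 * D ≤ c` makes `exp_le_lik` applicable to every parameter in `[δ, D)`.
  refine ⟨max C₁ (2 * D), by positivity, ?_⟩
  intro Ω _ M ν _ hν hrisk c hc hcC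
  refine lt_of_le_of_lt ?_ (hC₁ c ((le_max_left _ _).trans hcC))
  have hcD : 2 * D ≤ c := (le_max_right _ _).trans hcC
  have hc0 : 0 < c := by linarith
  set b := M.bayes ν with hb
  have hbm : Measurable b := M.bayes_meas
  have hb' : ∀ ω, b ω ∈ Icc (0 : ℝ) 1 := M.bayes_mem hν
  have h1b : ∀ ω, 1 - b ω ∈ Icc (0 : ℝ) 1 := fun ω =>
    ⟨by linarith [(hb' ω).2], by linarith [(hb' ω).1]⟩
  have hmass : v / 4 ≤ ν.real (Ico δ D) := by
    have h1 := M.le_mass_Ici hν hrisk hδ4 hδv hv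
    have h2 := M.tail_mass_le hv hν hrisk hD
    have h3 : ν.real (Ici δ) ≤ ν.real (Ico δ D) + ν.real (Ici D) := by
      refine (measureReal_mono (fun x hx => ?_)).trans (measureReal_union_le _ _)
      rcases lt_or_ge x D with h | h
      · exact Or.inl ⟨hx, h⟩
      · exact Or.inr h
    linarith
  set T : Set Ω := {ω | 3 / 2 * c ≤ M.score ω} with hT
  have hTm : MeasurableSet T := measurableSet_le measurable_const M.score_meas
  have hi : Integrable (fun ω => M.lik c ω * (1 - b ω)) M.base :=
    M.lik_mul_integrable hc (measurable_const.sub hbm) h1b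
  -- At a score above `3/2 * c` the marginal is at least `v / 4 * exp (δ * c)` in state `1`, from
  -- the mass on `[δ, D)`, and at most `1` in state `0`.
  have hbound : ∀ ω ∈ T, 1 - b ω ≤ 4 / v * Real.exp (-(δ * c)) := by
    intro ω hω
    have hm' : M.marg ν (M.flip ω) ≤ 1 := by
      calc M.marg ν (M.flip ω) ≤ ∫ _, (1 : ℝ) ∂ν := by
            refine integral_mono_ae (M.lik_integrable_left hν _) (integrable_const _) ?_
            filter_upwards [hν] with c' hc'
            refine M.lik_le_one c' hc' _ ?_
            have : 3 / 2 * c ≤ M.score ω := hω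
            rw [M.score_flip]; linarith
        _ = 1 := by simp
    have hm : v / 4 * Real.exp (δ * c) ≤ M.marg ν ω := by
      calc v / 4 * Real.exp (δ * c) ≤ ν.real (Ico δ D) * Real.exp (δ * c) := by gcongr
        _ = ∫ _ in Ico δ D, Real.exp (δ * c) ∂ν := by rw [setIntegral_const, smul_eq_mul]
        _ ≤ ∫ c' in Ico δ D, M.lik c' ω ∂ν := by
            refine integral_mono_ae (integrable_const _)
              (M.lik_integrable_left hν ω).integrableOn ?_
            filter_upwards [ae_restrict_of_ae hν, ae_restrict_mem measurableSet_Ico] with c' hc' hm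
            refine le_trans (Real.exp_le_exp.2 ?_)
              (M.exp_le_lik c hc c' hc' (by linarith [hm.2]) ω hω)
            exact mul_le_mul_of_nonneg_right hm.1 hc0.le
        _ ≤ M.marg ν ω := by
            refine setIntegral_le_integral (M.lik_integrable_left hν ω) ?_
            filter_upwards [hν] with c' hc' using M.lik_nonneg c' hc' ω
    have h1 := (M.marg_mul_one_sub_bayes_le hν ω).trans hm'
    have h2 := (mul_le_mul_of_nonneg_right hm (h1b ω).1).trans h1
    rw [Real.exp_neg]
    have hE := Real.exp_pos (δ * c)
    have : 4 / v * (Real.exp (δ * c))⁻¹ = 1 / (v / 4 * Real.exp (δ * c)) := by field_simp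
    rw [this, le_div_iff₀ (by positivity), mul_comm]
    exact h2
  have h1 := M.risk_le_of_flip hbm hb' M.bayes_flip hc
  rw [← integral_add_compl hTm hi] at h1
  have h2 : ∫ ω in Tᶜ, M.lik c ω * (1 - b ω) ∂M.base ≤ ∫ ω in Tᶜ, M.lik c ω ∂M.base := by
    refine integral_mono hi.integrableOn (M.lik_integrable hc).integrableOn fun ω => ?_
    exact mul_le_of_le_one_right (M.lik_nonneg c hc ω) (h1b ω).2
  have h3 := M.setIntegral_lik_le hc (half_pos hc0) hTm.compl fun ω hω => by
    simp only [hT, mem_compl_iff, mem_ofPred_eq, not_le] at hω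
    linarith
  have h4 : ∫ ω in T, M.lik c ω * (1 - b ω) ∂M.base ≤ 4 / v * Real.exp (-(δ * c)) := by
    calc ∫ ω in T, M.lik c ω * (1 - b ω) ∂M.base
        ≤ ∫ ω in T, M.lik c ω * (4 / v * Real.exp (-(δ * c))) ∂M.base := by
          refine setIntegral_mono_on hi.integrableOn
            ((M.lik_integrable hc).mul_const _).integrableOn hTm fun ω hω => ?_
          exact mul_le_mul_of_nonneg_left (hbound ω hω) (M.lik_nonneg c hc ω)
      _ ≤ ∫ ω, M.lik c ω * (4 / v * Real.exp (-(δ * c))) ∂M.base := by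
          refine setIntegral_le_integral ((M.lik_integrable hc).mul_const _)
            (.of_forall fun ω => ?_)
          exact mul_nonneg (M.lik_nonneg c hc ω) (by positivity)
      _ = 4 / v * Real.exp (-(δ * c)) := by
          rw [integral_mul_const, M.lik_integral c hc, one_mul]
  have h5 : 1 / (c / 2) ^ 2 = 4 / c ^ 2 := by field_simp; norm_num
  linarith

end SignalModel

/-! ### The Gaussian experiment of the limit game. -/

/-- The standard normal distribution. -/
abbrev stdNormal : Measure ℝ := gaussianReal 0 1

lemma stdDensity_eq (z : ℝ) : stdDensity z = (√(2 * Real.pi))⁻¹ * Real.exp (-z ^ 2 / 2) := by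
  simp [stdDensity, gaussianPDFReal]

lemma stdDensity_pos (z : ℝ) : 0 < stdDensity z := gaussianPDFReal_pos 0 1 z one_ne_zero

lemma stdDensity_neg (z : ℝ) : stdDensity (-z) = stdDensity z := by simp [stdDensity_eq]

lemma stdDensity_sub (z t : ℝ) :
    stdDensity (z - t) = stdDensity z * Real.exp (t * z - t ^ 2 / 2) := by
  rw [stdDensity_eq, stdDensity_eq, mul_assoc, ← Real.exp_add]
  congr 2; ring

@[fun_prop]
lemma continuous_stdDensity : Continuous stdDensity := by
  have : stdDensity = fun z => (√(2 * Real.pi))⁻¹ * Real.exp (-z ^ 2 / 2) := funext stdDensity_eq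
  rw [this]; fun_prop

lemma integral_stdNormal (f : ℝ → ℝ) : ∫ z, f z ∂stdNormal = ∫ z, stdDensity z * f z := by
  rw [integral_gaussianReal_eq_integral_smul one_ne_zero]; rfl

lemma integrable_stdNormal_iff {f : ℝ → ℝ} :
    Integrable f stdNormal ↔ Integrable fun z => stdDensity z * f z := by
  rw [stdNormal, gaussianReal_of_var_ne_zero _ one_ne_zero,
    integrable_withDensity_iff_integrable_smul' (measurable_gaussianPDF 0 1)
      (.of_forall fun _ => gaussianPDF_lt_top)]
  simp only [toReal_gaussianPDF, smul_eq_mul]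
  rfl

/-- Exponential tilting translates the standard normal distribution by `t` (the Cameron-Martin
formula). -/
lemma integral_exp_mul_stdNormal (f : ℝ → ℝ) (t : ℝ) :
    ∫ z, Real.exp (t * z - t ^ 2 / 2) * f z ∂stdNormal = ∫ z, f (z + t) ∂stdNormal := by
  rw [integral_stdNormal, integral_stdNormal,
    ← integral_add_right_eq_self (fun z => stdDensity z * (Real.exp (t * z - t ^ 2 / 2) * f z)) t]
  refine integral_congr_ae (.of_forall fun z => ?_)
  have := stdDensity_sub (z + t) t
  rw [add_sub_cancel_right] at this
  simp only [this]
  ring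

lemma integrable_exp_mul_stdNormal_iff {f : ℝ → ℝ} (t : ℝ) :
    Integrable (fun z => Real.exp (t * z - t ^ 2 / 2) * f z) stdNormal ↔
      Integrable (fun z => f (z + t)) stdNormal := by
  rw [integrable_stdNormal_iff, integrable_stdNormal_iff,
    ← (measurePreserving_add_right volume t).integrable_comp_emb (measurableEmbedding_addRight t)]
  refine integrable_congr (.of_forall fun z => ?_)
  have := stdDensity_sub (z + t) t
  rw [add_sub_cancel_right] at this
  simp only [Function.comp_apply, this]
  ring

lemma measurePreserving_neg_stdNormal : MeasurePreserving (fun z : ℝ => -z) stdNormal stdNormal :=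
  ⟨measurable_neg, by rw [gaussianReal_map_neg, neg_zero]⟩

lemma integrable_sq_stdNormal : Integrable (fun z : ℝ => z ^ 2) stdNormal :=
  (memLp_id_gaussianReal 2).integrable_sq

lemma integral_sq_stdNormal : ∫ z : ℝ, z ^ 2 ∂stdNormal = 1 := by
  have h := variance_id_gaussianReal (μ := 0) (v := 1)
  rw [variance_eq_integral measurable_id.aemeasurable] at h
  simpa using h

lemma integrable_exp_mul_abs_stdNormal (K : ℝ) :
    Integrable (fun z : ℝ => Real.exp (K * |z|)) stdNormal := by
  refine Integrable.mono' ((integrable_exp_mul_gaussianReal (μ := 0) (v := 1) K).add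
    (integrable_exp_mul_gaussianReal (μ := 0) (v := 1) (-K))) (by fun_prop)
    (.of_forall fun z => ?_)
  rw [Real.norm_of_nonneg (Real.exp_pos _).le]
  simp only [Pi.add_apply]
  rcases abs_cases z with ⟨h, _⟩ | ⟨h, _⟩ <;> rw [h]
  · linarith [Real.exp_pos (-K * z)]
  · have : K * -z = -K * z := by ring
    rw [this]
    linarith [Real.exp_pos (K * z)]

/-- The likelihood of a signal in the limit game relative to the standard normal distribution. -/
def limitLik (c z : ℝ) : ℝ := Real.exp (2 * c * z - (2 * c) ^ 2 / 2)

lemma limitLik_pos (c z : ℝ) : 0 < limitLik c z := Real.exp_pos _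

@[fun_prop]
lemma continuous_limitLik : Continuous fun p : ℝ × ℝ => limitLik p.1 p.2 := by
  unfold limitLik; fun_prop

lemma stdDensity_mul_limitLik (c z : ℝ) : stdDensity z * limitLik c z = stdDensity (z - 2 * c) :=
  (stdDensity_sub z (2 * c)).symm

lemma stdDensity_mul_limitLik_neg (c z : ℝ) :
    stdDensity z * limitLik c (-z) = stdDensity (z + 2 * c) := by
  rw [← stdDensity_neg z, stdDensity_mul_limitLik, ← stdDensity_neg]
  congr 1; ring

/-- The experiments of the limit game. -/
def limitModel : SignalModel ℝ where
  base := stdNormal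
  prob := inferInstance
  flip z := -z
  score z := z
  lik := limitLik
  params := Ici 0
  params_nonneg _ h := h
  flip_mp := measurePreserving_neg_stdNormal
  flip_flip := neg_neg
  score_meas := measurable_id
  score_flip _ := rfl
  lik_meas := continuous_limitLik.measurable
  lik_nonneg _ _ _ := (limitLik_pos _ _).le
  -- The exponent `2 * c * z - 2 * c ^ 2` is largest at `c = z / 2`.
  lik_bdd z := ⟨Real.exp (z ^ 2 / 2), fun c _ => Real.exp_le_exp.2 (by
    nlinarith [sq_nonneg (z - 2 * c)])⟩
  lik_integral c _ := by
    have := integral_exp_mul_stdNormal (fun _ => 1) (2 * c)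
    simpa [limitLik] using this
  moment_integrable c _ := by
    unfold limitLik
    rw [integrable_exp_mul_stdNormal_iff (f := fun z => (z - 2 * c) ^ 2)]
    simpa using integrable_sq_stdNormal
  moment_le c _ := by
    unfold limitLik
    rw [integral_exp_mul_stdNormal (fun z => (z - 2 * c) ^ 2)]
    simp [integral_sq_stdNormal]
  lik_le_one c hc z hz := by
    unfold limitLik
    rw [Real.exp_le_one_iff]
    have := mul_nonneg (mem_Ici.1 hc) (neg_nonneg.2 hz)
    nlinarith [sq_nonneg c]
  exp_le_lik c hc c' hc' h z hz := by
    refine Real.exp_le_exp.2 ?_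
    have hc0 : 0 ≤ c := hc
    have hc0' : 0 ≤ c' := hc'
    -- The exponent is at least `3 * c' * c - c' * c`. The slack beyond `c' * c` is kept for the
    -- binomial case.
    nlinarith [mul_nonneg hc0' (sub_nonneg.2 hz), mul_nonneg hc0' (sub_nonneg.2 h),
      mul_nonneg hc0' hc0]
  lik_sub_le c hc _ z := by
    have hc0 : 0 ≤ c := hc
    -- The likelihood ratio of `-y` to `y` is exactly `exp (-(4 * c * y))`, and `1 - exp (-x) ≤ x`.
    have key : ∀ y, 0 ≤ y → limitLik c y - limitLik c (-y) ≤
        4 * c * y * (limitLik c y + limitLik c (-y)) := by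
      intro y hy
      have e : limitLik c (-y) = limitLik c y * Real.exp (-(4 * c * y)) := by
        unfold limitLik; rw [← Real.exp_add]; congr 1; ring
      have h1 := Real.add_one_le_exp (-(4 * c * y))
      have h2 := mul_le_mul_of_nonneg_left h1 (limitLik_pos c y).le
      have h3 : 0 ≤ 4 * c * y * limitLik c (-y) := by
        have := limitLik_pos c (-y); positivity
      nlinarith
    have mono : ∀ y, 0 ≤ y → limitLik c (-y) ≤ limitLik c y := fun y hy =>
      Real.exp_le_exp.2 (by nlinarith [mul_nonneg hc0 hy])
    rcases le_total 0 z with hz | hz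
    · rw [abs_of_nonneg hz, abs_of_nonneg (sub_nonneg.2 (mono z hz))]
      exact key z hz
    · have hz' : 0 ≤ -z := by linarith
      have h1 := key (-z) hz'
      have h2 := mono (-z) hz'
      rw [neg_neg] at h1 h2
      rw [abs_of_nonpos hz, abs_of_nonpos (sub_nonpos.2 h2)]
      linarith

lemma limitPosterior_eq (c z : ℝ) :
    limitPosterior c z = limitLik c z / (limitLik c z + limitLik c (-z)) := by
  have h := stdDensity_pos z
  have h1 := limitLik_pos c z
  have h2 := limitLik_pos c (-z)
  rw [limitPosterior, ← stdDensity_mul_limitLik, ← stdDensity_mul_limitLik_neg, ← mul_add,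
    mul_div_mul_left _ _ h.ne']

lemma limitRegretAt_eq {a : ℝ → ℝ} (ha : Measurable a) (ha' : ∀ z, a z ∈ Icc (0 : ℝ) 1) {c : ℝ}
    (hc : 0 ≤ c) : limitRegretAt a c = limitModel.risk a c := by
  set r : ℝ → ℝ := fun z => (limitPosterior c z - a z) ^ 2 with hr
  have hrm : Measurable r := by
    have h1 : Measurable (limitPosterior c) := by unfold limitPosterior; fun_prop
    fun_prop
  have hp : ∀ z, limitPosterior c z ∈ Icc (0 : ℝ) 1 := fun z => by
    rw [limitPosterior_eq]
    have h1 := limitLik_pos c z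
    have h2 := limitLik_pos c (-z)
    exact ⟨by positivity, (div_le_one (by positivity)).2 (by linarith)⟩
  have hr1 : ∀ z, ‖r z‖ ≤ 1 := fun z => by
    rw [Real.norm_eq_abs, abs_le]
    constructor <;> simp only [hr] <;> nlinarith [(hp z).1, (hp z).2, (ha' z).1, (ha' z).2]
  have e1 : ∫ z, stdDensity (z + 2 * c) * r z = ∫ z, limitLik c (-z) * r z ∂stdNormal := by
    rw [integral_stdNormal]
    refine integral_congr_ae (.of_forall fun z => ?_)
    simp only [← stdDensity_mul_limitLik_neg]; ring
  have e2 : ∫ z, stdDensity (z - 2 * c) * r z = ∫ z, limitLik c z * r z ∂stdNormal := by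
    rw [integral_stdNormal]
    refine integral_congr_ae (.of_forall fun z => ?_)
    simp only [← stdDensity_mul_limitLik]; ring
  have i1 : Integrable (fun z => limitLik c (-z) * r z) stdNormal :=
    (limitModel.lik_flip_integrable (c := c) hc).mul_bdd (c := 1) hrm.aestronglyMeasurable
      (.of_forall hr1)
  have i2 : Integrable (fun z => limitLik c z * r z) stdNormal :=
    (limitModel.lik_integrable (c := c) hc).mul_bdd (c := 1) hrm.aestronglyMeasurable
      (.of_forall hr1)
  rw [limitRegretAt, e1, e2, ← integral_const_mul, ← integral_const_mul,
    ← integral_add (i1.const_mul _) (i2.const_mul _)]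
  refine integral_congr_ae (.of_forall fun z => ?_)
  change _ = lossKernel (limitLik c z) (limitLik c (-z)) (a z)
  simp only [lossKernel, hr, limitPosterior_eq]
  ring

lemma limitRegret_eq {a : ℝ → ℝ} (ha : Measurable a) (ha' : ∀ z, a z ∈ Icc (0 : ℝ) 1)
    {γ : ProbabilityMeasure ℝ} (hγ : ∀ᵐ c ∂(γ : Measure ℝ), c ∈ limitModel.params) :
    limitRegret a γ = ∫ c, limitModel.risk a c ∂(γ : Measure ℝ) := by
  refine integral_congr_ae ?_
  filter_upwards [hγ] with c hc using limitRegretAt_eq ha ha' hc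

lemma ae_mem_of_measure_eq_one {γ : ProbabilityMeasure ℝ} {s : Set ℝ}
    (hs : MeasurableSet s) : (γ : Measure ℝ) s = 1 ↔ ∀ᵐ c ∂(γ : Measure ℝ), c ∈ s :=
  (mem_ae_iff_prob_eq_one hs).symm

/-! ### Continuity of the limit regret in the parameter and in the rule. -/

/-- The integrand of the regret is dominated locally uniformly in the parameter. -/
lemma limitLik_le {c K : ℝ} (hc : |c| ≤ K) (z : ℝ) :
    limitLik c z ≤ Real.exp (2 * K * |z|) := by
  refine Real.exp_le_exp.2 ?_
  have h1 : c * z ≤ K * |z| := by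
    calc c * z ≤ |c * z| := le_abs_self _
      _ = |c| * |z| := abs_mul _ _
      _ ≤ K * |z| := by gcongr
  nlinarith [sq_nonneg c]

lemma lossKernel_limitLik_le {c K : ℝ} (hc : |c| ≤ K) {b : ℝ} (hb : b ∈ Icc (0 : ℝ) 1) (z : ℝ) :
    ‖lossKernel (limitLik c z) (limitLik c (-z)) b‖ ≤ Real.exp (2 * K * |z|) := by
  rw [Real.norm_of_nonneg (lossKernel_nonneg (limitLik_pos _ _).le (limitLik_pos _ _).le _)]
  refine (lossKernel_le_half (limitLik_pos _ _).le (limitLik_pos _ _).le hb).trans ?_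
  have h1 := limitLik_le hc z
  have h2 := limitLik_le hc (-z)
  rw [abs_neg] at h2
  linarith

lemma continuousAt_lossKernel {u w b : ℝ} (h : u + w ≠ 0) :
    ContinuousAt (fun p : ℝ × ℝ × ℝ => lossKernel p.1 p.2.1 p.2.2) (u, w, b) := by
  unfold lossKernel
  have : ContinuousAt (fun p : ℝ × ℝ × ℝ => p.1 / (p.1 + p.2.1)) (u, w, b) :=
    ContinuousAt.div (by fun_prop) (by fun_prop) h
  fun_prop

lemma tendsto_lossKernel {ι : Type*} {l : Filter ι} {u w b : ι → ℝ} {u₀ w₀ b₀ : ℝ}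
    (hu : Tendsto u l (𝓝 u₀)) (hw : Tendsto w l (𝓝 w₀)) (hb : Tendsto b l (𝓝 b₀))
    (h : u₀ + w₀ ≠ 0) :
    Tendsto (fun i => lossKernel (u i) (w i) (b i)) l (𝓝 (lossKernel u₀ w₀ b₀)) :=
  (continuousAt_lossKernel h).tendsto.comp (hu.prodMk_nhds (hw.prodMk_nhds hb))

lemma continuous_limitRisk {b : ℝ → ℝ} (hb : Measurable b) (hb' : ∀ z, b z ∈ Icc (0 : ℝ) 1) :
    Continuous (limitModel.risk b) := by
  rw [continuous_iff_continuousAt]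
  intro c₀
  refine continuousAt_of_dominated (F := fun c z => lossKernel (limitLik c z) (limitLik c (-z))
    (b z)) (bound := fun z => Real.exp (2 * (|c₀| + 1) * |z|)) ?_ ?_ ?_ ?_
  · refine .of_forall fun c => (Measurable.lossKernel ?_ ?_ hb).aestronglyMeasurable <;>
      unfold limitLik <;> fun_prop
  · have : ∀ᶠ c in 𝓝 c₀, |c| < |c₀| + 1 :=
      continuous_abs.continuousAt.eventually (gt_mem_nhds (by linarith))
    filter_upwards [this] with c hc
    exact .of_forall fun z => lossKernel_limitLik_le hc.le (hb' z) z
  · exact integrable_exp_mul_abs_stdNormal _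
  · refine .of_forall fun z => ?_
    have h1 : Continuous fun c => limitLik c z := by unfold limitLik; fun_prop
    have h2 : Continuous fun c => limitLik c (-z) := by unfold limitLik; fun_prop
    exact tendsto_lossKernel h1.continuousAt h2.continuousAt tendsto_const_nhds
      (add_pos (limitLik_pos _ _) (limitLik_pos _ _)).ne'

/-- Convergence of the regret for pointwise convergent belief rules. -/
lemma tendsto_limitRisk {b : ℕ → ℝ → ℝ} {b₀ : ℝ → ℝ} (hb : ∀ n, Measurable (b n))
    (hb' : ∀ n z, b n z ∈ Icc (0 : ℝ) 1)
    (hlim : ∀ z, Tendsto (fun n => b n z) atTop (𝓝 (b₀ z))) (c : ℝ) :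
    Tendsto (fun n => limitModel.risk (b n) c) atTop (𝓝 (limitModel.risk b₀ c)) := by
  refine tendsto_integral_of_dominated_convergence (F := fun n z => lossKernel (limitLik c z)
    (limitLik c (-z)) (b n z)) (fun z => Real.exp (2 * |c| * |z|)) ?_
    (integrable_exp_mul_abs_stdNormal _) ?_ ?_
  · refine fun n => (Measurable.lossKernel ?_ ?_ (hb n)).aestronglyMeasurable <;>
      unfold limitLik <;> fun_prop
  · exact fun n => .of_forall fun z => lossKernel_limitLik_le le_rfl (hb' n z) z
  · exact .of_forall fun z => tendsto_lossKernel tendsto_const_nhds tendsto_const_nhds (hlim z)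
      (add_pos (limitLik_pos _ _) (limitLik_pos _ _)).ne'

/-! ### Existence of an equilibrium of the limit game. -/

/-- The probability measures that are concentrated on `[0, C]`. -/
def boundedStrategies (C : ℝ) : Set (ProbabilityMeasure ℝ) :=
  {γ | (γ : Measure ℝ) (Icc 0 C) = 1}

lemma ae_mem_Icc {C : ℝ} {γ : ProbabilityMeasure ℝ} (h : γ ∈ boundedStrategies C) :
    ∀ᵐ c ∂(γ : Measure ℝ), c ∈ Icc 0 C := (ae_mem_of_measure_eq_one measurableSet_Icc).1 h

lemma ae_mem_params {C : ℝ} {γ : ProbabilityMeasure ℝ} (h : γ ∈ boundedStrategies C) :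
    ∀ᵐ c ∂(γ : Measure ℝ), c ∈ limitModel.params :=
  (ae_mem_Icc h).mono fun _ hc => hc.1

/-- By the portmanteau theorem the mass of a closed set cannot drop in a weak limit. -/
lemma isClosed_boundedStrategies (C : ℝ) : IsClosed (boundedStrategies C) := by
  refine isClosed_iff_clusterPt.2 fun γ hγ => ?_
  rw [← mem_closure_iff_clusterPt, mem_closure_iff_ultrafilter] at hγ
  obtain ⟨u, hu, huγ⟩ := hγ
  have h := ProbabilityMeasure.limsup_measure_closed_le_of_tendsto (L := (u : Filter _))
    (μs := fun x => x) (tendsto_id'.2 huγ) (isClosed_Icc (a := (0 : ℝ)) (b := C))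
  have h1 : limsup (fun x : ProbabilityMeasure ℝ => (x : Measure ℝ) (Icc 0 C)) (u : Filter _) =
      1 := by
    rw [limsup_congr (v := fun _ => 1)]
    · exact limsup_const _
    · exact hu
  exact le_antisymm prob_le_one (h1 ▸ h)

/-- Prokhorov's theorem, with the single compact set `Icc 0 C` witnessing tightness. -/
lemma isCompact_boundedStrategies (C : ℝ) : IsCompact (boundedStrategies C) := by
  rw [← (isClosed_boundedStrategies C).closure_eq]
  refine isCompact_closure_of_isTightMeasureSet ?_
  rw [isTightMeasureSet_iff_exists_isCompact_measure_compl_le]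
  refine fun ε _ => ⟨Icc 0 C, isCompact_Icc, ?_⟩
  rintro _ ⟨γ, hγ, rfl⟩
  rw [(prob_compl_eq_zero_iff measurableSet_Icc).2 hγ]
  exact zero_le

/-- Weak convergence on `[0, C]` tests against functions that are continuous there. -/
lemma tendsto_integral_of_boundedStrategies {ι : Type*} {l : Filter ι} {C : ℝ} (hC : 0 ≤ C)
    {γs : ι → ProbabilityMeasure ℝ} {γ : ProbabilityMeasure ℝ} (h : Tendsto γs l (𝓝 γ))
    (hγs : ∀ᶠ i in l, γs i ∈ boundedStrategies C) (hγ : γ ∈ boundedStrategies C) {f : ℝ → ℝ}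
    (hf : ContinuousOn f (Icc 0 C)) :
    Tendsto (fun i => ∫ c, f c ∂(γs i : Measure ℝ)) l (𝓝 (∫ c, f c ∂(γ : Measure ℝ))) := by
  -- The constant extension beyond the endpoints is bounded and continuous on the line and has the
  -- same integrals.
  have hcont : Continuous (IccExtend hC ((Icc 0 C).domRestrict f)) :=
    (continuousOn_iff_continuous_domRestrict.1 hf).Icc_extend'
  obtain ⟨K, hK⟩ := isCompact_Icc.exists_bound_of_continuousOn hf
  let F : BoundedContinuousFunction ℝ ℝ := .ofNormedAddCommGroup
    (IccExtend hC ((Icc 0 C).domRestrict f)) hcont K fun x => hK _ (projIcc 0 C hC x).2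
  have hF : ∀ δ : ProbabilityMeasure ℝ, δ ∈ boundedStrategies C →
      ∫ c, F c ∂(δ : Measure ℝ) = ∫ c, f c ∂(δ : Measure ℝ) := by
    intro δ hδ
    refine integral_congr_ae ?_
    filter_upwards [ae_mem_Icc hδ] with c hc
    exact IccExtend_of_mem hC ((Icc 0 C).domRestrict f) hc
  have h1 := ProbabilityMeasure.tendsto_iff_forall_integral_tendsto.1 h F
  rw [hF γ hγ] at h1
  exact h1.congr' (hγs.mono fun i hi => hF _ hi)

/-- The value that Nature secures in the limit game with a mixed strategy. -/
def limitValue (γ : ProbabilityMeasure ℝ) : ℝ :=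
  ∫ c, limitModel.risk (limitModel.bayes γ) c ∂(γ : Measure ℝ)

lemma limitValue_le {b : ℝ → ℝ} (hb : Measurable b) (hb' : ∀ z, b z ∈ Icc (0 : ℝ) 1)
    {γ : ProbabilityMeasure ℝ} (hγ : ∀ᵐ c ∂(γ : Measure ℝ), c ∈ limitModel.params) :
    limitValue γ ≤ ∫ c, limitModel.risk b c ∂(γ : Measure ℝ) := by
  rw [limitModel.average_risk_eq hb hb' hγ]
  refine le_add_of_nonneg_right (integral_nonneg fun z => ?_)
  have := limitModel.marg_nonneg hγ z
  have := limitModel.marg_nonneg hγ (limitModel.flip z)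
  simp only [Pi.zero_apply]
  positivity

/-- The value is an infimum over rules of weakly continuous functionals, hence upper semicontinuous.
At `γ` it suffices to hold the rule `bayes γ` fixed. -/
lemma exists_isMaxOn_limitValue {C : ℝ} (hC : 0 ≤ C) :
    ∃ γ ∈ boundedStrategies C, ∀ γ' ∈ boundedStrategies C, limitValue γ' ≤ limitValue γ := by
  have hne : (boundedStrategies C).Nonempty :=
    ⟨⟨Measure.dirac 0, inferInstance⟩, by
      change Measure.dirac (0 : ℝ) (Icc 0 C) = 1
      rw [Measure.dirac_apply' _ measurableSet_Icc]
      simp [hC]⟩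
  suffices h : UpperSemicontinuousOn limitValue (boundedStrategies C) from
    h.exists_isMaxOn hne (isCompact_boundedStrategies C)
  intro γ hγ y hy
  have hγp := ae_mem_params hγ
  have hbm : Measurable (limitModel.bayes γ) := limitModel.bayes_meas
  have hb' := limitModel.bayes_mem hγp
  have ht : Tendsto (fun γ' : ProbabilityMeasure ℝ =>
      ∫ c, limitModel.risk (limitModel.bayes γ) c ∂(γ' : Measure ℝ))
      (𝓝[boundedStrategies C] γ) (𝓝 (limitValue γ)) :=
    tendsto_integral_of_boundedStrategies hC (tendsto_id.mono_left nhdsWithin_le_nhds)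
      eventually_mem_nhdsWithin hγ (continuous_limitRisk hbm hb').continuousOn
  filter_upwards [ht.eventually (gt_mem_nhds hy), eventually_mem_nhdsWithin] with γ' h1 h2
  exact (limitValue_le hbm hb' (ae_mem_params h2)).trans_lt h1

/-- The mixture of two mixed strategies. -/
def mixture (ε : ℝ) (h : ε ∈ Icc (0 : ℝ) 1) (γ δ : ProbabilityMeasure ℝ) : ProbabilityMeasure ℝ :=
  ⟨ENNReal.ofReal (1 - ε) • (γ : Measure ℝ) + ENNReal.ofReal ε • (δ : Measure ℝ), ⟨by
    simp only [Measure.add_apply, Measure.smul_apply, measure_univ, smul_eq_mul, mul_one]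
    rw [← ENNReal.ofReal_add (by linarith [h.2]) h.1]
    simp⟩⟩

lemma integral_mixture {ε : ℝ} (h : ε ∈ Icc (0 : ℝ) 1) {γ δ : ProbabilityMeasure ℝ} {f : ℝ → ℝ}
    (hf : Integrable f (γ : Measure ℝ)) (hf' : Integrable f (δ : Measure ℝ)) :
    ∫ c, f c ∂(mixture ε h γ δ : Measure ℝ) =
      (1 - ε) * ∫ c, f c ∂(γ : Measure ℝ) + ε * ∫ c, f c ∂(δ : Measure ℝ) := by
  change ∫ c, f c ∂(ENNReal.ofReal (1 - ε) • (γ : Measure ℝ) +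
    ENNReal.ofReal ε • (δ : Measure ℝ)) = _
  rw [integral_add_measure (hf.smul_measure (by simp)) (hf'.smul_measure (by simp)),
    integral_smul_measure, integral_smul_measure,
    ENNReal.toReal_ofReal (by linarith [h.2]), ENNReal.toReal_ofReal h.1]
  rfl

lemma ae_mixture {ε : ℝ} (h : ε ∈ Icc (0 : ℝ) 1) {γ δ : ProbabilityMeasure ℝ} {p : ℝ → Prop}
    (h1 : ∀ᵐ c ∂(γ : Measure ℝ), p c) (h2 : ∀ᵐ c ∂(δ : Measure ℝ), p c) :
    ∀ᵐ c ∂(mixture ε h γ δ : Measure ℝ), p c :=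
  ae_add_measure_iff.2 ⟨Measure.ae_smul_measure h1 _, Measure.ae_smul_measure h2 _⟩

/-- A point mass as a mixed strategy. -/
def pointMass (c : ℝ) : ProbabilityMeasure ℝ := ⟨Measure.dirac c, inferInstance⟩

lemma integral_pointMass (f : ℝ → ℝ) (c : ℝ) :
    ∫ x, f x ∂(pointMass c : Measure ℝ) = f c := integral_dirac f c

lemma integrable_pointMass (f : ℝ → ℝ) (c : ℝ) : Integrable f (pointMass c : Measure ℝ) :=
  integrable_dirac (by simp)

lemma ae_pointMass {p : ℝ → Prop} {c : ℝ} (h : p c) : ∀ᵐ x ∂(pointMass c : Measure ℝ), p x := by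
  change ∀ᵐ x ∂(Measure.dirac c), p x
  rw [ae_dirac_eq]; exact h

lemma limitMarg_pos {γ : ProbabilityMeasure ℝ}
    (hγ : ∀ᵐ c ∂(γ : Measure ℝ), c ∈ limitModel.params) (z : ℝ) :
    0 < limitModel.marg γ z := by
  refine (integral_pos_iff_support_of_nonneg (fun c => (limitLik_pos c z).le)
    (limitModel.lik_integrable_left hγ z)).2 ?_
  have : Function.support (fun c => limitLik c z) = univ :=
    eq_univ_of_forall fun c => (limitLik_pos c z).ne'
  rw [this]; simp

/-- Against the Bayes rule of an optimal strategy of Nature no parameter has a larger regret. -/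
lemma risk_le_limitValue {C : ℝ} {γ : ProbabilityMeasure ℝ} (hγ : γ ∈ boundedStrategies C)
    (hmax : ∀ γ' ∈ boundedStrategies C, limitValue γ' ≤ limitValue γ) {c : ℝ}
    (hc : c ∈ Icc 0 C) : limitModel.risk (limitModel.bayes γ) c ≤ limitValue γ := by
  -- Nature's strategy is perturbed towards the point mass at `c` with weight `ε n`, which tends to
  -- `0`.
  set ε : ℕ → ℝ := fun n => 1 / ((n : ℝ) + 1) with hε
  have hε0 : ∀ n, 0 < ε n := fun n => by positivity
  have hε1 : ∀ n, ε n ∈ Icc (0 : ℝ) 1 := fun n =>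
    ⟨(hε0 n).le, (div_le_one (by positivity)).2 (by linarith [n.cast_nonneg (α := ℝ)])⟩
  have hεlim : Tendsto ε atTop (𝓝 0) := tendsto_one_div_add_atTop_nhds_zero_nat
  set γs : ℕ → ProbabilityMeasure ℝ := fun n => mixture (ε n) (hε1 n) γ (pointMass c) with hγs
  have hγp := ae_mem_params hγ
  have hγsp : ∀ n, γs n ∈ boundedStrategies C := fun n =>
    (ae_mem_of_measure_eq_one measurableSet_Icc).2
      (ae_mixture _ (ae_mem_Icc hγ) (ae_pointMass hc))
  have hbm : ∀ n, Measurable (limitModel.bayes (γs n)) := fun n => limitModel.bayes_meas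
  have hb' : ∀ n z, limitModel.bayes (γs n) z ∈ Icc (0 : ℝ) 1 := fun n =>
    limitModel.bayes_mem (ae_mem_params (hγsp n))
  -- An envelope argument without derivatives: the value of the mixture is at least `(1 - ε) *
  -- limitValue γ + ε * risk c` and at most `limitValue γ`. The risk here is that of the mixture's
  -- Bayes rule, which converges to the Bayes rule of `γ`.
  have hle : ∀ n, limitModel.risk (limitModel.bayes (γs n)) c ≤ limitValue γ := by
    intro n
    have h1 := hmax _ (hγsp n)
    have h2 : limitValue (γs n) = (1 - ε n) *
        ∫ c, limitModel.risk (limitModel.bayes (γs n)) c ∂(γ : Measure ℝ) +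
        ε n * limitModel.risk (limitModel.bayes (γs n)) c := by
      rw [limitValue, integral_mixture (hε1 n) (limitModel.risk_integrable (hbm n) (hb' n) hγp)
        (integrable_pointMass _ _), integral_pointMass]
    have h3 := limitValue_le (hbm n) (hb' n) hγp
    have h4 : 0 ≤ 1 - ε n := by linarith [(hε1 n).2]
    have h5 := mul_le_mul_of_nonneg_left h3 h4
    have h6 : ε n * limitModel.risk (limitModel.bayes (γs n)) c ≤ ε n * limitValue γ := by
      linarith
    exact le_of_mul_le_mul_left h6 (hε0 n)
  have hm : ∀ z, Tendsto (fun n => limitModel.marg (γs n) z) atTop (𝓝 (limitModel.marg γ z)) := by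
    intro z
    have e : ∀ n, limitModel.marg (γs n) z =
        (1 - ε n) * limitModel.marg γ z + ε n * limitLik c z := fun n => by
      unfold SignalModel.marg
      rw [integral_mixture (hε1 n) (limitModel.lik_integrable_left hγp z)
        (integrable_pointMass _ _), integral_pointMass]
      rfl
    simp only [e]
    simpa using (((tendsto_const_nhds (x := (1 : ℝ))).sub hεlim).mul_const (limitModel.marg γ z)).add
      (hεlim.mul_const (limitLik c z))
  refine le_of_tendsto (tendsto_limitRisk hbm hb' (fun z => ?_) c) (.of_forall hle)
  have hpos := add_pos (limitMarg_pos hγp z) (limitMarg_pos hγp (-z))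
  unfold SignalModel.bayes posterior
  exact (((hm z).sub (hm _)).div ((hm z).add (hm _)) hpos.ne').const_add 1 |>.const_mul (1 / 2)

/-- Nature's reference strategy, which mixes the parameters `0` and `1` evenly. -/
def referenceStrategy : ProbabilityMeasure ℝ :=
  mixture (1 / 2) (by norm_num) (pointMass 0) (pointMass 1)

lemma ae_referenceStrategy {p : ℝ → Prop} (h0 : p 0) (h1 : p 1) :
    ∀ᵐ c ∂(referenceStrategy : Measure ℝ), p c :=
  ae_mixture _ (ae_pointMass h0) (ae_pointMass h1)

lemma referenceStrategy_mem {C : ℝ} (hC : 1 ≤ C) : referenceStrategy ∈ boundedStrategies C :=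
  (ae_mem_of_measure_eq_one measurableSet_Icc).2
    (ae_referenceStrategy ⟨le_rfl, by linarith⟩ ⟨zero_le_one, hC⟩)

lemma integral_referenceStrategy (f : ℝ → ℝ) :
    ∫ c, f c ∂(referenceStrategy : Measure ℝ) = 1 / 2 * f 0 + 1 / 2 * f 1 := by
  rw [referenceStrategy, integral_mixture _ (integrable_pointMass _ _) (integrable_pointMass _ _),
    integral_pointMass, integral_pointMass]
  norm_num

/-- At `c = 0` the oracle believes `1/2`, whereas the Bayes rule differs from `1/2` at every `z ≠ 0`
because the parameter `1` makes `z` informative. -/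
lemma limitValue_referenceStrategy_pos : 0 < limitValue referenceStrategy := by
  set b := limitModel.bayes referenceStrategy with hb
  have hp := ae_mem_params (referenceStrategy_mem le_rfl)
  have hbm : Measurable b := limitModel.bayes_meas
  have hb' : ∀ z, b z ∈ Icc (0 : ℝ) 1 := limitModel.bayes_mem hp
  rw [limitValue, integral_referenceStrategy]
  have h1 : 0 ≤ limitModel.risk b 1 := limitModel.risk_nonneg b (zero_le_one (α := ℝ))
  have h0 : 0 < limitModel.risk b 0 := by
    have hi := limitModel.lossKernel_integrable hbm hb' (c := 0) (le_refl (0 : ℝ))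
    refine (integral_pos_iff_support_of_nonneg (fun z =>
      lossKernel_nonneg (limitLik_pos _ _).le (limitLik_pos _ _).le _) hi).2 ?_
    have hsub : ({0}ᶜ : Set ℝ) ⊆ Function.support (fun z => lossKernel (limitModel.lik 0 z)
        (limitModel.lik 0 (limitModel.flip z)) (b z)) := by
      intro z hz
      have e : ∀ y, limitLik 0 y = 1 := fun y => by simp [limitLik]
      change lossKernel (limitLik 0 z) (limitLik 0 (-z)) (b z) ≠ 0
      have hbz : b z ≠ 1 / 2 := by
        have hpos := add_pos (limitMarg_pos hp z) (limitMarg_pos hp (-z))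
        intro h
        have h2 := posterior_eq hpos.ne'
        change b z = _ at h2
        rw [h] at h2
        have h3 : limitModel.marg referenceStrategy z = limitModel.marg referenceStrategy (-z) := by
          field_simp at h2
          linarith
        unfold SignalModel.marg at h3
        rw [integral_referenceStrategy, integral_referenceStrategy] at h3
        change 1 / 2 * limitLik 0 z + 1 / 2 * limitLik 1 z =
          1 / 2 * limitLik 0 (-z) + 1 / 2 * limitLik 1 (-z) at h3
        rw [e, e] at h3
        have h4 : limitLik 1 z = limitLik 1 (-z) := by linarith
        have h5 := Real.exp_injective h4
        exact hz (by simp only [mem_singleton_iff]; linarith)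
      rw [e, e, lossKernel]
      have : (1 : ℝ) / (1 + 1) - b z ≠ 0 := fun h => hbz (by linarith)
      positivity
    refine lt_of_lt_of_le ?_ (measure_mono hsub)
    have : NullSingletonClass stdNormal := nullSingletonClass_gaussianReal one_ne_zero
    rw [prob_compl_eq_one_sub (measurableSet_singleton _)]
    change 0 < 1 - stdNormal {0}
    simp
  linarith

/-- The limit game has a saddle point with a compactly supported strategy of Nature. -/
lemma exists_limit_saddle : ∃ (γ : ProbabilityMeasure ℝ) (C : ℝ), 0 < C ∧
    γ ∈ boundedStrategies C ∧ 0 < limitValue γ ∧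
    (∀ c, 0 ≤ c → limitModel.risk (limitModel.bayes γ) c ≤ limitValue γ) := by
  obtain ⟨C₀, hC₀, htail⟩ :=
    SignalModel.exists_risk_lt limitValue_referenceStrategy_pos
  -- Both parameters of the reference strategy must be admissible, so that the maximal value is at
  -- least its value.
  set C := max C₀ 1 with hC
  have hC0 : 0 < C := by positivity
  obtain ⟨γ, hγ, hmax⟩ := exists_isMaxOn_limitValue hC0.le
  have hv := hmax _ (referenceStrategy_mem (le_max_right C₀ 1))
  have hγp := ae_mem_params hγ
  have hbm : Measurable (limitModel.bayes γ) := limitModel.bayes_meas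
  have hb' := limitModel.bayes_mem hγp
  have hle : ∀ c ∈ Icc 0 C, limitModel.risk (limitModel.bayes γ) c ≤ limitValue γ :=
    fun c hc => risk_le_limitValue hγ hmax hc
  refine ⟨γ, C, hC0, hγ, limitValue_referenceStrategy_pos.trans_le hv, fun c hc => ?_⟩
  rcases le_total c C with h | h
  · exact hle c ⟨hc, h⟩
  -- The regret is at most the value on `[0, C]` and averages to it, so it equals the value almost
  -- surely. This is the premise of the tail bound.
  · have hae : ∀ᵐ c ∂(γ : Measure ℝ),
        limitValue γ - limitModel.risk (limitModel.bayes γ) c = 0 := by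
      have hnn : 0 ≤ᵐ[(γ : Measure ℝ)]
          fun c => limitValue γ - limitModel.risk (limitModel.bayes γ) c := by
        filter_upwards [ae_mem_Icc hγ] with c hc using sub_nonneg.2 (hle c hc)
      have hi := limitModel.risk_integrable hbm hb' hγp
      refine (integral_eq_zero_iff_of_nonneg_ae hnn ((integrable_const _).sub hi)).1 ?_
      rw [integral_sub (integrable_const _) hi]
      simp [limitValue]
    refine ((htail ℝ limitModel γ hγp ?_ c hc ((le_max_left _ _).trans h)).trans_le hv).le
    filter_upwards [hae] with c' hc'
    linarith

/-! ### Derivative and concavity of the oracle's part of the regret. -/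

/-- The derivative of `bend` is `2 / cosh ^ 3`. -/
def bend (y : ℝ) : ℝ := Real.arctan (Real.sinh y) + Real.sinh y / Real.cosh y ^ 2

lemma hasDerivAt_arctan_sinh (y : ℝ) :
    HasDerivAt (fun y => Real.arctan (Real.sinh y)) (1 / Real.cosh y) y := by
  have h := (Real.hasDerivAt_arctan (Real.sinh y)).comp y (Real.hasDerivAt_sinh y)
  refine h.congr_deriv ?_
  have := Real.cosh_pos y
  rw [← Real.cosh_sq' y]
  field_simp

lemma hasDerivAt_bend (y : ℝ) : HasDerivAt bend (2 / Real.cosh y ^ 3) y := by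
  have hc := Real.cosh_pos y
  have h := (hasDerivAt_arctan_sinh y).add ((Real.hasDerivAt_sinh y).div
    ((Real.hasDerivAt_cosh y).pow 2) (by simpa using hc.ne'))
  refine h.congr_deriv ?_
  simp only [Pi.pow_apply]
  have := Real.cosh_sq y
  field_simp
  simp only [Nat.cast_ofNat, Nat.add_one_sub_one, pow_one]
  have e : Real.sinh y ^ 2 = Real.cosh y ^ 2 - 1 := by linarith
  linear_combination (-2 * Real.cosh y) * e

lemma continuous_bend : Continuous bend :=
  continuous_iff_continuousAt.2 fun y => (hasDerivAt_bend y).continuousAt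

lemma bend_neg (y : ℝ) : bend (-y) = -bend y := by
  unfold bend
  rw [Real.sinh_neg, Real.cosh_neg, Real.arctan_neg]; ring

lemma abs_sinh_le_cosh (y : ℝ) : |Real.sinh y| ≤ Real.cosh y := by
  exact abs_le_of_sq_le_sq (by linarith [Real.cosh_sq y]) (Real.cosh_pos y).le

lemma abs_sinh_div_cosh_sq_le (y : ℝ) : |Real.sinh y / Real.cosh y ^ 2| ≤ 1 := by
  have h1 := Real.one_le_cosh y
  rw [abs_div, abs_of_pos (by positivity : 0 < Real.cosh y ^ 2), div_le_one (by positivity)]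
  exact (abs_sinh_le_cosh y).trans (by nlinarith)

lemma abs_arctan_le (y : ℝ) : |Real.arctan y| ≤ 2 := by
  have h1 := Real.arctan_lt_pi_div_two y
  have h2 := Real.neg_pi_div_two_lt_arctan y
  have h3 := Real.pi_le_four
  exact abs_le.2 ⟨by linarith, by linarith⟩

lemma abs_bend_le (y : ℝ) : |bend y| ≤ 3 :=
  (abs_add_le _ _).trans (by linarith [abs_arctan_le (Real.sinh y), abs_sinh_div_cosh_sq_le y])

lemma concaveOn_bend : ConcaveOn ℝ (Ici 0) bend := by
  refine AntitoneOn.concaveOn_of_deriv (convex_Ici 0) continuous_bend.continuousOn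
    (fun y _ => (hasDerivAt_bend y).differentiableAt.differentiableWithinAt) ?_
  intro x hx y hy hxy
  rw [interior_Ici, mem_Ioi] at hx hy
  rw [(hasDerivAt_bend x).deriv, (hasDerivAt_bend y).deriv]
  have h1 : Real.cosh x ≤ Real.cosh y := by
    rw [Real.cosh_le_cosh, abs_of_pos hx, abs_of_pos hy]; exact hxy
  have := Real.cosh_pos x
  gcongr

/-- Since `bend` is odd, only `|z|` matters, and `bend` is concave on the half-line. -/
lemma concaveOn_mul_bend (z : ℝ) : ConcaveOn ℝ (Ici 0) fun t => z * bend (t * z) := by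
  have key : ∀ z : ℝ, 0 ≤ z → ConcaveOn ℝ (Ici 0) fun t => z * bend (t * z) := by
    intro z hz
    refine ⟨convex_Ici 0, fun x hx y hy a b ha hb hab => ?_⟩
    have h := concaveOn_bend.2 (mul_nonneg hx hz) (mul_nonneg hy hz) ha hb hab
    simp only [smul_eq_mul] at h ⊢
    have e : (a * x + b * y) * z = a * (x * z) + b * (y * z) := by ring
    rw [e]
    nlinarith [mul_le_mul_of_nonneg_left h hz]
  rcases le_total 0 z with hz | hz
  · exact key z hz
  · have := key (-z) (by linarith)
    simpa [bend_neg] using this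

/-- The Gaussian average of `z * bend (t z)`. -/
def bendAverage (t : ℝ) : ℝ := ∫ z, z * bend (t * z) ∂stdNormal

lemma integrable_id_stdNormal : Integrable (fun z : ℝ => z) stdNormal :=
  memLp_one_iff_integrable.1 (memLp_id_gaussianReal 1)

lemma integrable_mul_bend (t : ℝ) : Integrable (fun z => z * bend (t * z)) stdNormal :=
  integrable_id_stdNormal.mul_bdd (c := 3)
    (continuous_bend.comp (continuous_const.mul continuous_id)).aestronglyMeasurable
    (.of_forall fun z => abs_bend_le (t * z))

lemma concaveOn_bendAverage : ConcaveOn ℝ (Ici 0) bendAverage := by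
  refine ⟨convex_Ici 0, fun x hx y hy a b ha hb hab => ?_⟩
  simp only [bendAverage, smul_eq_mul]
  rw [← integral_const_mul, ← integral_const_mul,
    ← integral_add ((integrable_mul_bend x).const_mul a) ((integrable_mul_bend y).const_mul b)]
  refine integral_mono (((integrable_mul_bend x).const_mul a).add
    ((integrable_mul_bend y).const_mul b)) (integrable_mul_bend _) fun z => ?_
  exact (concaveOn_mul_bend z).2 hx hy ha hb hab

/-- The Gaussian average of `1 / cosh (t z)`. -/
def sechAverage (t : ℝ) : ℝ := ∫ z, 1 / Real.cosh (t * z) ∂stdNormal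

lemma hasDerivAt_sechAverage (t : ℝ) : HasDerivAt sechAverage
    (∫ z, -(z * (Real.sinh (t * z) / Real.cosh (t * z) ^ 2)) ∂stdNormal) t := by
  have hc : ∀ x, Real.cosh x ≠ 0 := fun x => (Real.cosh_pos x).ne'
  refine (hasDerivAt_integral_of_dominated_loc_of_deriv_le
    (F := fun t z => 1 / Real.cosh (t * z))
    (F' := fun t z => -(z * (Real.sinh (t * z) / Real.cosh (t * z) ^ 2)))
    (bound := fun z => |z|) univ_mem ?_ ?_ ?_ ?_ integrable_id_stdNormal.abs ?_).2
  · exact .of_forall fun s => by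
      have := Real.continuous_cosh.comp (continuous_const.mul continuous_id : Continuous fun z => s * z)
      exact (continuous_const.div this fun z => hc _).aestronglyMeasurable
  · refine Integrable.of_bound (C := 1) ?_ (.of_forall fun z => ?_)
    · have := Real.continuous_cosh.comp (continuous_const.mul continuous_id : Continuous fun z => t * z)
      exact (continuous_const.div this fun z => hc _).aestronglyMeasurable
    · rw [Real.norm_of_nonneg (by positivity)]
      exact (div_le_one (Real.cosh_pos _)).2 (Real.one_le_cosh _)
  · have h1 := Real.continuous_cosh.comp (continuous_const.mul continuous_id : Continuous fun z => t * z)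
    have h2 := Real.continuous_sinh.comp (continuous_const.mul continuous_id : Continuous fun z => t * z)
    exact (continuous_id.mul (h2.div (h1.pow 2) fun z => pow_ne_zero 2 (hc _))).neg.aestronglyMeasurable
  · refine .of_forall fun z s _ => ?_
    rw [norm_neg, Real.norm_eq_abs, abs_mul]
    exact mul_le_of_le_one_right (abs_nonneg _) (abs_sinh_div_cosh_sq_le _)
  · refine .of_forall fun z s _ => ?_
    have h1 : HasDerivAt (fun s => s * z) z s := by simpa using (hasDerivAt_id s).mul_const z
    have h := (hasDerivAt_const s (1 : ℝ)).div h1.cosh (hc _)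
    refine h.congr_deriv ?_
    ring

/-- Stein's identity `E[f'(Z)] = E[Z f(Z)]` for `f z = arctan (sinh (t * z))`, whose derivative is
`t / cosh (t * z)`. -/
lemma mul_sechAverage (t : ℝ) :
    t * sechAverage t = ∫ z, z * Real.arctan (Real.sinh (t * z)) ∂stdNormal := by
  have hc : ∀ x, Real.cosh x ≠ 0 := fun x => (Real.cosh_pos x).ne'
  have hcosh : Continuous fun z => Real.cosh (t * z) := by fun_prop
  have hat : Continuous fun z => Real.arctan (Real.sinh (t * z)) :=
    Real.continuous_arctan.comp (by fun_prop)
  have i1 : Integrable (fun z => z * Real.arctan (Real.sinh (t * z))) stdNormal :=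
    integrable_id_stdNormal.mul_bdd (c := 2) hat.aestronglyMeasurable
      (.of_forall fun z => abs_arctan_le _)
  have i2 : Integrable (fun z => t * (1 / Real.cosh (t * z))) stdNormal := by
    refine Integrable.const_mul (Integrable.of_bound (C := 1)
      (continuous_const.div hcosh fun z => hc _).aestronglyMeasurable (.of_forall fun z => ?_)) t
    change ‖1 / Real.cosh (t * z)‖ ≤ 1
    rw [Real.norm_of_nonneg (one_div_pos.2 (Real.cosh_pos _)).le]
    exact (div_le_one (Real.cosh_pos _)).2 (Real.one_le_cosh _)
  have i3 : Integrable (fun z => Real.arctan (Real.sinh (t * z))) stdNormal :=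
    Integrable.of_bound (C := 2) hat.aestronglyMeasurable (.of_forall fun z => abs_arctan_le _)
  have hd : ∀ z, HasDerivAt (fun z => stdDensity z * Real.arctan (Real.sinh (t * z)))
      (stdDensity z * (t * (1 / Real.cosh (t * z))) -
        stdDensity z * (z * Real.arctan (Real.sinh (t * z)))) z := by
    intro z
    have h1 : HasDerivAt stdDensity (-z * stdDensity z) z := by
      have e : stdDensity = fun z => (√(2 * Real.pi))⁻¹ * Real.exp (-z ^ 2 / 2) :=
        funext stdDensity_eq
      have h2 : HasDerivAt (fun z : ℝ => -z ^ 2 / 2) (-z) z := by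
        have := ((hasDerivAt_id z).pow 2).neg.div_const 2
        refine this.congr_deriv ?_
        simp; ring
      rw [e]
      refine (h2.exp.const_mul _).congr_deriv ?_
      simp only; ring
    have h3 : HasDerivAt (fun z => t * z) t z := by simpa using (hasDerivAt_id z).const_mul t
    have h4 := (hasDerivAt_arctan_sinh (t * z)).comp z h3
    refine (h1.mul h4).congr_deriv ?_
    simp only [Function.comp_apply]
    ring
  have h := integral_eq_zero_of_hasDerivAt_of_integrable hd
    ((integrable_stdNormal_iff.1 i2).sub (integrable_stdNormal_iff.1 i1))
    (integrable_stdNormal_iff.1 i3)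
  rw [integral_sub (integrable_stdNormal_iff.1 i2) (integrable_stdNormal_iff.1 i1),
    ← integral_stdNormal, ← integral_stdNormal, integral_const_mul] at h
  unfold sechAverage
  linarith

/-- The regret term of the oracle, as a function of the mean `t = 2 c` of the signal. -/
def oracleTerm (t : ℝ) : ℝ := 1 / 4 * (Real.exp (-(t ^ 2 / 2)) * sechAverage t)

/-- Differentiating the Gaussian factor produces `-t * sechAverage t`, which `mul_sechAverage`
rewrites as an average of `z * arctan (sinh (t * z))`. Together with the derivative of `sechAverage`
this is the average of `z * bend (t * z)`, which explains the two summands of `bend`. -/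
lemma hasDerivAt_oracleTerm (t : ℝ) :
    HasDerivAt oracleTerm (-(1 / 4 * Real.exp (-(t ^ 2 / 2)) * bendAverage t)) t := by
  have h1 : HasDerivAt (fun t : ℝ => -(t ^ 2 / 2)) (-t) t := by
    have := (((hasDerivAt_id t).pow 2).div_const 2).neg
    refine this.congr_deriv ?_
    simp
  have h := (h1.exp.mul (hasDerivAt_sechAverage t)).const_mul (1 / 4)
  refine h.congr_deriv ?_
  have i1 : Integrable (fun z => z * Real.arctan (Real.sinh (t * z))) stdNormal :=
    integrable_id_stdNormal.mul_bdd (c := 2)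
      (Real.continuous_arctan.comp (by fun_prop)).aestronglyMeasurable
      (.of_forall fun z => abs_arctan_le _)
  have i2 : Integrable (fun z => z * (Real.sinh (t * z) / Real.cosh (t * z) ^ 2)) stdNormal :=
    integrable_id_stdNormal.mul_bdd (c := 1)
      (Continuous.div (by fun_prop) (by fun_prop)
        fun z => pow_ne_zero 2 (Real.cosh_pos _).ne').aestronglyMeasurable
      (.of_forall fun z => abs_sinh_div_cosh_sq_le _)
  have e : bendAverage t = t * sechAverage t +
      ∫ z, z * (Real.sinh (t * z) / Real.cosh (t * z) ^ 2) ∂stdNormal := by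
    rw [mul_sechAverage, ← integral_add i1 i2]
    refine integral_congr_ae (.of_forall fun z => ?_)
    simp only [bend]; ring
  rw [e, integral_neg]
  ring

/-- A Laplace transform of a positive density is strictly convex. -/
lemma strictConvexOn_laplace {n : ℝ → ℝ} {K : ℝ} (hn : Measurable n) (hpos : ∀ z, 0 < n z)
    (hK : ∀ z, n z ≤ K) :
    StrictConvexOn ℝ univ fun t => ∫ z, Real.exp (t * z) * n z ∂stdNormal := by
  have hi : ∀ t, Integrable (fun z => Real.exp (t * z) * n z) stdNormal := fun t =>
    (integrable_exp_mul_gaussianReal t).mul_bdd (c := K) hn.aestronglyMeasurable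
      (.of_forall fun z => by rw [Real.norm_of_nonneg (hpos z).le]; exact hK z)
  refine ⟨convex_univ, fun x _ y _ hxy a b ha hb hab => ?_⟩
  simp only [smul_eq_mul]
  rw [← integral_const_mul, ← integral_const_mul,
    ← integral_add ((hi x).const_mul a) ((hi y).const_mul b), ← sub_pos,
    ← integral_sub (f := fun z => a * (Real.exp (x * z) * n z) + b * (Real.exp (y * z) * n z))
      (((hi x).const_mul a).add ((hi y).const_mul b)) (hi _)]
  set g : ℝ → ℝ := fun z => a * (Real.exp (x * z) * n z) + b * (Real.exp (y * z) * n z) -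
    Real.exp ((a * x + b * y) * z) * n z with hg
  have hgi : Integrable g stdNormal := (((hi x).const_mul a).add ((hi y).const_mul b)).sub (hi _)
  -- Strict convexity of the exponential needs `x * z ≠ y * z`. The exceptional point `0` is a null
  -- set.
  have hgpos : ∀ z, z ≠ 0 → 0 < g z := by
    intro z hz
    have h := strictConvexOn_exp.2 (mem_univ (x * z)) (mem_univ (y * z))
      (fun h => hxy (mul_right_cancel₀ hz h)) ha hb hab
    simp only [smul_eq_mul] at h
    have e : (a * x + b * y) * z = a * (x * z) + b * (y * z) := by ring
    simp only [hg, e]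
    nlinarith [mul_lt_mul_of_pos_right h (hpos z)]
  have hgnn : 0 ≤ g := fun z => by
    rcases eq_or_ne z 0 with rfl | hz
    · simp only [hg, mul_zero, Real.exp_zero, one_mul, Pi.zero_apply]
      have : a * n 0 + b * n 0 = n 0 := by rw [← add_mul, hab, one_mul]
      linarith
    · exact (hgpos z hz).le
  change 0 < ∫ z, g z ∂stdNormal
  refine (integral_pos_iff_support_of_nonneg hgnn hgi).2 ?_
  refine lt_of_lt_of_le ?_ (measure_mono (fun z hz => (hgpos z hz).ne' : ({0}ᶜ : Set ℝ) ⊆ _))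
  have : NullSingletonClass stdNormal := nullSingletonClass_gaussianReal one_ne_zero
  rw [prob_compl_eq_one_sub (measurableSet_singleton _)]
  simp

/-! ### Regularity of Bayes rules and uniqueness of the positive maximiser. -/

section BayesRule

variable {γ : ProbabilityMeasure ℝ} {C : ℝ}

/-- The derivative of the marginal likelihood. -/
def margDeriv (γ : ProbabilityMeasure ℝ) (z : ℝ) : ℝ :=
  ∫ c, 2 * c * limitLik c z ∂(γ : Measure ℝ)

lemma hasDerivAt_marg (hγ : γ ∈ boundedStrategies C) (z : ℝ) :
    HasDerivAt (limitModel.marg γ) (margDeriv γ z) z := by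
  have hm : ∀ z, AEStronglyMeasurable (fun c => limitLik c z) (γ : Measure ℝ) := fun z =>
    (limitModel.lik_meas_left z).aestronglyMeasurable
  refine (hasDerivAt_integral_of_dominated_loc_of_deriv_le (s := Metric.ball z 1)
    (F := fun z c => limitLik c z) (F' := fun z c => 2 * c * limitLik c z)
    (bound := fun _ => 2 * C * Real.exp (2 * C * (|z| + 1)))
    (Metric.ball_mem_nhds z one_pos) (.of_forall hm)
    (limitModel.lik_integrable_left (ae_mem_params hγ) z) ?_ ?_ (integrable_const _) ?_).2
  · exact ((measurable_const.mul measurable_id).mul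
      (limitModel.lik_meas_left z)).aestronglyMeasurable
  · filter_upwards [ae_mem_Icc hγ] with c hc y hy
    have hy' : |y| ≤ |z| + 1 := by
      have h1 := abs_sub_abs_le_abs_sub y z
      have h2 : |y - z| < 1 := hy
      linarith
    have h3 := limitLik_le ((abs_of_nonneg hc.1).trans_le hc.2) y
    have hC : 0 ≤ C := hc.1.trans hc.2
    rw [norm_mul, Real.norm_of_nonneg (limitLik_pos c y).le,
      Real.norm_of_nonneg (by linarith [hc.1])]
    refine mul_le_mul (by linarith [hc.2]) (h3.trans (Real.exp_le_exp.2 (by gcongr)))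
      (limitLik_pos c y).le (by linarith)
  · refine .of_forall fun c y _ => ?_
    have h1 : HasDerivAt (fun y => 2 * c * y - (2 * c) ^ 2 / 2) (2 * c) y := by
      simpa using ((hasDerivAt_id y).const_mul (2 * c)).sub_const ((2 * c) ^ 2 / 2)
    exact h1.exp.congr_deriv (mul_comm _ _)

lemma margDeriv_integrable (hγ : γ ∈ boundedStrategies C) (z : ℝ) :
    Integrable (fun c => 2 * c * limitLik c z) (γ : Measure ℝ) := by
  refine Integrable.mono' ((limitModel.lik_integrable_left (ae_mem_params hγ) z).const_mul
    (2 * C)) ((measurable_const.mul measurable_id).mul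
      (limitModel.lik_meas_left z)).aestronglyMeasurable ?_
  filter_upwards [ae_mem_Icc hγ] with c hc
  have h1 := limitLik_pos c z
  rw [Real.norm_of_nonneg (mul_nonneg (by linarith [hc.1]) h1.le)]
  change _ ≤ 2 * C * limitLik c z
  gcongr
  exact hc.2

lemma margDeriv_le (hγ : γ ∈ boundedStrategies C) (z : ℝ) :
    margDeriv γ z ≤ 2 * C * limitModel.marg γ z := by
  unfold margDeriv SignalModel.marg
  rw [← integral_const_mul]
  refine integral_mono_ae (margDeriv_integrable hγ z)
    ((limitModel.lik_integrable_left (ae_mem_params hγ) z).const_mul _) ?_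
  filter_upwards [ae_mem_Icc hγ] with c hc
  have h1 := limitLik_pos c z
  change _ ≤ 2 * C * limitLik c z
  gcongr
  exact hc.2

lemma margDeriv_pos (hγ : γ ∈ boundedStrategies C) (h0 : ¬ ∀ᵐ c ∂(γ : Measure ℝ), c = 0) (z : ℝ) :
    0 < margDeriv γ z := by
  refine (integral_pos_iff_support_of_nonneg_ae ?_ (margDeriv_integrable hγ z)).2 ?_
  · filter_upwards [ae_mem_Icc hγ] with c hc
    exact mul_nonneg (by linarith [hc.1]) (limitLik_pos c z).le
  · rw [pos_iff_ne_zero]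
    intro h
    refine h0 ?_
    rw [ae_iff]
    refine measure_mono_null (fun c hc => ?_) h
    have : c ≠ 0 := hc
    exact mul_ne_zero (mul_ne_zero two_ne_zero this) (limitLik_pos c z).ne'

lemma measurable_margDeriv : Measurable (margDeriv γ) := by
  have h : StronglyMeasurable fun p : ℝ × ℝ => 2 * p.2 * limitLik p.2 p.1 := by
    refine Measurable.stronglyMeasurable ?_
    unfold limitLik; fun_prop
  exact h.integral_prod_right.measurable

/-- The derivative of the Bayes rule. -/
def bayesDeriv (γ : ProbabilityMeasure ℝ) (z : ℝ) : ℝ :=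
  (margDeriv γ z * limitModel.marg γ (-z) + limitModel.marg γ z * margDeriv γ (-z)) /
    (limitModel.marg γ z + limitModel.marg γ (-z)) ^ 2

lemma limitBayes_eq (hγ : ∀ᵐ c ∂(γ : Measure ℝ), c ∈ limitModel.params) (z : ℝ) :
    limitModel.bayes γ z =
      limitModel.marg γ z / (limitModel.marg γ z + limitModel.marg γ (-z)) :=
  posterior_eq (add_pos (limitMarg_pos hγ z) (limitMarg_pos hγ (-z))).ne'

lemma hasDerivAt_bayes (hγ : γ ∈ boundedStrategies C) (z : ℝ) :
    HasDerivAt (limitModel.bayes γ) (bayesDeriv γ z) z := by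
  have hp := ae_mem_params hγ
  have h1 := limitMarg_pos hp z
  have h2 := limitMarg_pos hp (-z)
  have e : (limitModel.bayes γ : ℝ → ℝ) = fun z =>
      limitModel.marg γ z / (limitModel.marg γ z + limitModel.marg γ (-z)) :=
    funext (limitBayes_eq hp)
  have hn : HasDerivAt (fun z => limitModel.marg γ (-z)) (-margDeriv γ (-z)) z := by
    have := (hasDerivAt_marg hγ (-z)).comp z (hasDerivAt_neg z)
    simpa [Function.comp_def] using this
  rw [e]
  refine ((hasDerivAt_marg hγ z).div ((hasDerivAt_marg hγ z).add hn)
    (add_pos h1 h2).ne').congr_deriv ?_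
  simp only [bayesDeriv, Pi.add_apply]
  congr 1
  ring

lemma bayesDeriv_pos (hγ : γ ∈ boundedStrategies C) (h0 : ¬ ∀ᵐ c ∂(γ : Measure ℝ), c = 0)
    (z : ℝ) : 0 < bayesDeriv γ z := by
  have hp := ae_mem_params hγ
  have h1 := limitMarg_pos hp z
  have h2 := limitMarg_pos hp (-z)
  have h3 := margDeriv_pos hγ h0 z
  have h4 := margDeriv_pos hγ h0 (-z)
  unfold bayesDeriv
  positivity

lemma nonneg_of_mem_boundedStrategies (hγ : γ ∈ boundedStrategies C) : 0 ≤ C := by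
  obtain ⟨c, hc⟩ := (ae_mem_Icc hγ).exists
  exact hc.1.trans hc.2

lemma bayesDeriv_le (hγ : γ ∈ boundedStrategies C) (z : ℝ) : bayesDeriv γ z ≤ 4 * C := by
  have hp := ae_mem_params hγ
  have h1 := limitMarg_pos hp z
  have h2 := limitMarg_pos hp (-z)
  have h3 := margDeriv_le hγ z
  have h4 := margDeriv_le hγ (-z)
  have hC := nonneg_of_mem_boundedStrategies hγ
  unfold bayesDeriv
  rw [div_le_iff₀ (by positivity)]
  have h5 := mul_le_mul_of_nonneg_right h3 h2.le
  have h6 := mul_le_mul_of_nonneg_left h4 h1.le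
  have h7 : 0 ≤ C * (limitModel.marg γ z ^ 2 + limitModel.marg γ (-z) ^ 2) := by positivity
  have h8 : 0 ≤ C * (limitModel.marg γ z * limitModel.marg γ (-z)) := by positivity
  nlinarith

lemma measurable_bayesDeriv : Measurable (bayesDeriv γ) := by
  have h1 := measurable_margDeriv (γ := γ)
  have h2 : Measurable (limitModel.marg (γ : Measure ℝ)) := limitModel.marg_meas
  unfold bayesDeriv
  fun_prop

lemma continuous_limitBayes (hγ : γ ∈ boundedStrategies C) : Continuous (limitModel.bayes γ) :=
  continuous_iff_continuousAt.2 fun z => (hasDerivAt_bayes hγ z).continuousAt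

/-- The density in the Laplace transform representing the derivative of the regret. -/
def lossDensity (γ : ProbabilityMeasure ℝ) (z : ℝ) : ℝ :=
  2 * (1 - limitModel.bayes γ z) * bayesDeriv γ z

/-- The expected loss of the Bayes rule when the signal has mean `t` in state `1`. -/
def lossTerm (γ : ProbabilityMeasure ℝ) (t : ℝ) : ℝ :=
  ∫ z, (1 - limitModel.bayes γ (z + t)) ^ 2 ∂stdNormal

lemma limitBayes_lt_one (hγ : ∀ᵐ c ∂(γ : Measure ℝ), c ∈ limitModel.params) (z : ℝ) :
    limitModel.bayes γ z < 1 := by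
  have h1 := limitMarg_pos hγ z
  have h2 := limitMarg_pos hγ (-z)
  rw [limitBayes_eq hγ, div_lt_one (by positivity)]
  linarith

lemma measurable_limitBayes : Measurable (limitModel.bayes (γ : Measure ℝ) : ℝ → ℝ) :=
  limitModel.bayes_meas

lemma measurable_lossDensity : Measurable (lossDensity γ) := by
  have h1 := measurable_bayesDeriv (γ := γ)
  have h2 := measurable_limitBayes (γ := γ)
  unfold lossDensity
  fun_prop

lemma lossDensity_pos (hγ : γ ∈ boundedStrategies C) (h0 : ¬ ∀ᵐ c ∂(γ : Measure ℝ), c = 0)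
    (z : ℝ) : 0 < lossDensity γ z := by
  have h1 := bayesDeriv_pos hγ h0 z
  have h2 := limitBayes_lt_one (ae_mem_params hγ) z
  have h3 : 0 < 1 - limitModel.bayes γ z := by linarith
  unfold lossDensity
  positivity

lemma bayesDeriv_nonneg (hγ : γ ∈ boundedStrategies C) (z : ℝ) : 0 ≤ bayesDeriv γ z := by
  have hp := ae_mem_params hγ
  have h1 := limitMarg_pos hp z
  have h2 := limitMarg_pos hp (-z)
  have h3 : ∀ z, 0 ≤ margDeriv γ z := fun z => by
    refine integral_nonneg_of_ae ?_
    filter_upwards [ae_mem_Icc hγ] with c hc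
    exact mul_nonneg (by linarith [hc.1]) (limitLik_pos c z).le
  have := h3 z
  have := h3 (-z)
  unfold bayesDeriv
  positivity

lemma lossDensity_mem (hγ : γ ∈ boundedStrategies C) (z : ℝ) :
    lossDensity γ z ∈ Icc 0 (8 * C) := by
  have h1 := bayesDeriv_nonneg hγ z
  have h2 := bayesDeriv_le hγ z
  have h3 := limitModel.bayes_mem (ae_mem_params hγ) z
  have h4 : 0 ≤ 1 - limitModel.bayes γ z := by linarith [h3.2]
  have h5 : 1 - limitModel.bayes γ z ≤ 1 := by linarith [h3.1]
  unfold lossDensity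
  refine ⟨by positivity, ?_⟩
  nlinarith [mul_le_of_le_one_left h1 h5]

/-- The integrand has derivative `-lossDensity γ (z + t)`. Undoing the translation by exponential
tilting splits off `exp (-(t ^ 2 / 2))` and leaves a Laplace transform, which is convex in `t`. -/
lemma hasDerivAt_lossTerm (hγ : γ ∈ boundedStrategies C) (t : ℝ) :
    HasDerivAt (lossTerm γ) (-(Real.exp (-(t ^ 2 / 2)) *
      ∫ z, Real.exp (t * z) * lossDensity γ z ∂stdNormal)) t := by
  have hbm := measurable_limitBayes (γ := γ)
  have hb' := limitModel.bayes_mem (ae_mem_params hγ)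
  have h := (hasDerivAt_integral_of_dominated_loc_of_deriv_le (μ := stdNormal) (x₀ := t)
    (F := fun t z => (1 - limitModel.bayes γ (z + t)) ^ 2)
    (F' := fun t z => -lossDensity γ (z + t)) (bound := fun _ => 8 * C) univ_mem ?_ ?_ ?_ ?_
    (integrable_const _) ?_).2
  · refine h.congr_deriv ?_
    rw [integral_neg, ← integral_exp_mul_stdNormal (lossDensity γ) t, ← integral_const_mul]
    congr 1
    refine integral_congr_ae (.of_forall fun z => ?_)
    simp only [sub_eq_add_neg, Real.exp_add]
    ring
  · exact .of_forall fun s => (by fun_prop : Measurable fun z =>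
      (1 - limitModel.bayes γ (z + s)) ^ 2).aestronglyMeasurable
  · refine Integrable.of_bound (C := 1) (by fun_prop : Measurable fun z =>
      (1 - limitModel.bayes γ (z + t)) ^ 2).aestronglyMeasurable (.of_forall fun z => ?_)
    have h1 := hb' (z + t)
    rw [Real.norm_of_nonneg (sq_nonneg _)]
    nlinarith [h1.1, h1.2]
  · exact (measurable_lossDensity.comp (measurable_id.add_const t)).neg.aestronglyMeasurable
  · refine .of_forall fun z s _ => ?_
    have h1 := lossDensity_mem hγ (z + s)
    rw [norm_neg, Real.norm_of_nonneg h1.1]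
    exact h1.2
  · refine .of_forall fun z s _ => ?_
    have h1 : HasDerivAt (fun s => limitModel.bayes γ (z + s)) (bayesDeriv γ (z + s)) s := by
      have := (hasDerivAt_bayes hγ (z + s)).comp s ((hasDerivAt_id s).const_add z)
      simpa [Function.comp_def] using this
    refine ((h1.const_sub 1).pow 2).congr_deriv ?_
    simp only [lossDensity]
    ring

/-- By symmetry both states contribute equally to the expected loss. The oracle's loss `u * w / (u +
w)` becomes a Gaussian factor times `1 / cosh (2 * c * z)`. -/
lemma limitRisk_eq (hγ : γ ∈ boundedStrategies C) {c : ℝ} (hc : 0 ≤ c) :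
    limitModel.risk (limitModel.bayes γ) c = lossTerm γ (2 * c) - oracleTerm (2 * c) := by
  set b : ℝ → ℝ := limitModel.bayes γ with hb
  have hbm : Measurable b := measurable_limitBayes
  have hp := ae_mem_params hγ
  have hb' : ∀ z, b z ∈ Icc (0 : ℝ) 1 := limitModel.bayes_mem hp
  have hflip : ∀ z, b (-z) = 1 - b z := limitModel.bayes_flip
  have hsq : ∀ z, (1 - b z) ^ 2 ∈ Icc (0 : ℝ) 1 := fun z =>
    ⟨sq_nonneg _, by nlinarith [(hb' z).1, (hb' z).2]⟩
  have hi1 : Integrable (fun z => limitLik c z * (1 - b z) ^ 2) stdNormal :=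
    limitModel.lik_mul_integrable hc (by fun_prop) hsq
  have hi2 : Integrable (fun z => limitLik c (-z) * b z ^ 2) stdNormal := by
    refine (measurePreserving_neg_stdNormal.integrable_comp_of_integrable hi1).congr
      (.of_forall fun z => ?_)
    simp [hflip]
  have e2 : ∫ z, limitLik c (-z) * b z ^ 2 ∂stdNormal =
      ∫ z, limitLik c z * (1 - b z) ^ 2 ∂stdNormal := by
    refine Eq.trans ?_ (limitModel.integral_comp_flip (fun z => limitLik c z * (1 - b z) ^ 2)
      ((limitModel.lik_meas_right c).mul (by fun_prop)))
    refine integral_congr_ae (.of_forall fun z => ?_)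
    change _ = limitLik c (-z) * (1 - b (-z)) ^ 2
    simp [hflip]
  have e1 : ∫ z, limitLik c z * (1 - b z) ^ 2 ∂stdNormal = lossTerm γ (2 * c) :=
    integral_exp_mul_stdNormal (fun z => (1 - b z) ^ 2) (2 * c)
  have e3 : ∀ z, 1 / 2 * (limitLik c z * limitLik c (-z) / (limitLik c z + limitLik c (-z))) =
      1 / 4 * (Real.exp (-((2 * c) ^ 2 / 2)) * (1 / Real.cosh (2 * c * z))) := by
    intro z
    have hE := Real.exp_pos (-((2 * c) ^ 2 / 2))
    have hx := Real.exp_pos (2 * c * z)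
    have hy := Real.exp_pos (-(2 * c * z))
    have hxy : Real.exp (2 * c * z) * Real.exp (-(2 * c * z)) = 1 := by
      rw [← Real.exp_add]; simp
    rw [Real.cosh_eq]
    simp only [limitLik, sub_eq_add_neg, Real.exp_add, mul_neg]
    rw [← add_mul]
    field_simp
    linear_combination 4 * hxy
  have hi3 : Integrable (fun z => 1 / 4 * (Real.exp (-((2 * c) ^ 2 / 2)) *
      (1 / Real.cosh (2 * c * z)))) stdNormal := by
    refine Integrable.const_mul (Integrable.const_mul (Integrable.of_bound (C := 1)
      (Measurable.aestronglyMeasurable (by fun_prop)) (.of_forall fun z => ?_)) _) _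
    rw [Real.norm_of_nonneg (one_div_pos.2 (Real.cosh_pos _)).le]
    exact (div_le_one (Real.cosh_pos _)).2 (Real.one_le_cosh _)
  calc limitModel.risk b c
      = ∫ z, (1 / 2 * (limitLik c z * (1 - b z) ^ 2 + limitLik c (-z) * b z ^ 2) -
          1 / 4 * (Real.exp (-((2 * c) ^ 2 / 2)) * (1 / Real.cosh (2 * c * z)))) ∂stdNormal := by
        refine integral_congr_ae (.of_forall fun z => ?_)
        simp only [← e3]
        exact lossKernel_eq (limitLik_pos _ _).le (limitLik_pos _ _).le _
    _ = lossTerm γ (2 * c) - oracleTerm (2 * c) := by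
        rw [integral_sub (f := fun z =>
          1 / 2 * (limitLik c z * (1 - b z) ^ 2 + limitLik c (-z) * b z ^ 2))
          ((hi1.add hi2).const_mul _) hi3, integral_const_mul,
          integral_add hi1 hi2, e2, e1, integral_const_mul, integral_const_mul]
        simp only [oracleTerm, sechAverage]
        ring

/-- Against the Bayes rule of a nontrivial strategy, the regret has at most one positive maximiser. -/
lemma argmax_unique (hγ : γ ∈ boundedStrategies C) (h0 : ¬ ∀ᵐ c ∂(γ : Measure ℝ), c = 0) {v : ℝ}
    (hle : ∀ c, 0 ≤ c → limitModel.risk (limitModel.bayes γ) c ≤ v) {c₁ c₂ : ℝ} (h1 : 0 < c₁)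
    (h2 : 0 < c₂) (hv1 : limitModel.risk (limitModel.bayes γ) c₁ = v)
    (hv2 : limitModel.risk (limitModel.bayes γ) c₂ = v) : c₁ = c₂ := by
  by_contra hne
  wlog hlt : c₁ < c₂ generalizing c₁ c₂
  · exact this h2 h1 hv2 hv1 (Ne.symm hne) (lt_of_le_of_ne (not_lt.1 hlt) (Ne.symm hne))
  set A : ℝ → ℝ := fun t => ∫ z, Real.exp (t * z) * lossDensity γ z ∂stdNormal with hA
  -- The strictly convex factor: a Laplace transform of a positive density minus the concave
  -- function `1 / 4 * bendAverage`.
  set G : ℝ → ℝ := fun t => A t + -(1 / 4 * bendAverage t) with hG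
  set R : ℝ → ℝ := fun t => lossTerm γ t - oracleTerm t with hR
  have hRd : ∀ t, HasDerivAt R (-(Real.exp (-(t ^ 2 / 2)) * G t)) t := fun t => by
    refine ((hasDerivAt_lossTerm hγ t).sub (hasDerivAt_oracleTerm t)).congr_deriv ?_
    simp only [hG, hA]; ring
  have hG0 : ∀ t, -(Real.exp (-(t ^ 2 / 2)) * G t) = 0 → G t = 0 := fun t h => by
    have := Real.exp_pos (-(t ^ 2 / 2))
    rw [neg_eq_zero, mul_eq_zero] at h
    exact h.resolve_left this.ne'
  have hGc : StrictConvexOn ℝ (Ici 0) G := by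
    have hA' : StrictConvexOn ℝ (Ici 0) A := (strictConvexOn_laplace measurable_lossDensity
      (lossDensity_pos hγ h0) fun z => (lossDensity_mem hγ z).2).subset (subset_univ _)
        (convex_Ici 0)
    have hB : ConcaveOn ℝ (Ici 0) fun t => 1 / 4 * bendAverage t := by
      simpa [smul_eq_mul] using concaveOn_bendAverage.smul (by norm_num : (0 : ℝ) ≤ 1 / 4)
    exact hA'.add_convexOn hB.neg
  have hRle : ∀ t, 0 ≤ t → R t ≤ v := fun t ht => by
    have := hle (t / 2) (by linarith)
    rw [limitRisk_eq hγ (by linarith), mul_div_cancel₀ t two_ne_zero] at this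
    exact this
  have hmax : ∀ c, 0 < c → limitModel.risk (limitModel.bayes γ) c = v →
      R (2 * c) = v ∧ G (2 * c) = 0 := by
    intro c hc hcv
    rw [limitRisk_eq hγ hc.le] at hcv
    refine ⟨hcv, hG0 _ (IsLocalMax.hasDerivAt_eq_zero ?_ (hRd _))⟩
    have : ∀ᶠ t in 𝓝 (2 * c), 0 < t := lt_mem_nhds (by linarith)
    filter_upwards [this] with t ht
    exact (hRle t ht.le).trans hcv.ge
  obtain ⟨r1, g1⟩ := hmax c₁ h1 hv1
  obtain ⟨r2, g2⟩ := hmax c₂ h2 hv2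
  -- Rolle's theorem gives a zero of `G` strictly between the zeros at the two maximisers, where
  -- strict convexity makes `G` negative.
  obtain ⟨t, ht, htd⟩ := exists_hasDerivAt_eq_zero (f := R) (by linarith : 2 * c₁ < 2 * c₂)
    (fun t _ => (hRd t).continuousAt.continuousWithinAt) (r1.trans r2.symm) fun t _ => hRd t
  have g3 := hG0 t htd
  have hs := hGc.lt_on_openSegment (mem_Ici.2 (by linarith : 0 ≤ 2 * c₁))
    (mem_Ici.2 (by linarith : 0 ≤ 2 * c₂)) (by linarith : 2 * c₁ < 2 * c₂).ne
    (by rw [openSegment_eq_Ioo (by linarith)]; exact ht)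
  rw [g1, g2, g3, max_self] at hs
  exact lt_irrefl _ hs

end BayesRule

/-! ### Uniqueness of the equilibrium of the limit game. -/

/-- Optimality determines a rule only almost everywhere. A discrepancy at one point would, by
monotonicity of `g` and continuity of `h`, persist on an interval to one side, where the two
functions agree somewhere. -/
lemma Monotone.eq_of_ae_eq_continuous {g h : ℝ → ℝ} (hg : Monotone g) (hh : Continuous h)
    (hgh : ∀ᵐ z, g z = h z) : g = h := by
  have hd : Dense {z | g z = h z} := Measure.dense_of_ae hgh
  funext z
  refine le_antisymm (le_of_not_gt fun hlt => ?_) (le_of_not_gt fun hlt => ?_)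
  · obtain ⟨ε, hε, hb⟩ := Metric.eventually_nhds_iff.1
      (hh.continuousAt.eventually (gt_mem_nhds hlt))
    obtain ⟨w, hw, hw1, hw2⟩ := hd.exists_between (by linarith : z < z + ε)
    have h1 : h w < g z := hb (by rw [Real.dist_eq, abs_lt]; constructor <;> linarith)
    have h2 := hg hw1.le
    have h3 : g w = h w := hw
    linarith
  · obtain ⟨ε, hε, hb⟩ := Metric.eventually_nhds_iff.1
      (hh.continuousAt.eventually (lt_mem_nhds hlt))
    obtain ⟨w, hw, hw1, hw2⟩ := hd.exists_between (by linarith : z - ε < z)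
    have h1 : g z < h w := hb (by rw [Real.dist_eq, abs_lt]; constructor <;> linarith)
    have h2 := hg hw2.le
    have h3 : g w = h w := hw
    linarith

lemma stdNormal_ae_iff {p : ℝ → Prop} : (∀ᵐ z ∂stdNormal, p z) ↔ ∀ᵐ z, p z :=
  ⟨fun h => (gaussianReal_absolutelyContinuous' 0 one_ne_zero).ae_le h,
    fun h => (gaussianReal_absolutelyContinuous 0 one_ne_zero).ae_le h⟩

lemma mem_limitNature_iff {γ : ProbabilityMeasure ℝ} :
    γ ∈ limitNatureStrategies ↔ ∀ᵐ c ∂(γ : Measure ℝ), c ∈ limitModel.params :=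
  ae_mem_of_measure_eq_one measurableSet_Ici

/-- The excess regret in `average_risk_eq` is an integral of a square with strictly positive weight.
-/
lemma ae_eq_bayes_of_le {b : ℝ → ℝ} (hb : Measurable b) (hb' : ∀ z, b z ∈ Icc (0 : ℝ) 1)
    {γ : ProbabilityMeasure ℝ} (hγ : ∀ᵐ c ∂(γ : Measure ℝ), c ∈ limitModel.params)
    (hle : ∫ c, limitModel.risk b c ∂(γ : Measure ℝ) ≤ limitValue γ) :
    ∀ᵐ z, b z = limitModel.bayes γ z := by
  have h := limitModel.average_risk_eq hb hb' hγ
  set g : ℝ → ℝ := fun z => 1 / 2 * (limitModel.marg γ z + limitModel.marg γ (-z)) *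
    (b z - limitModel.bayes γ z) ^ 2 with hg
  have hpos : ∀ z, 0 < 1 / 2 * (limitModel.marg γ z + limitModel.marg γ (-z)) := fun z => by
    have := limitMarg_pos hγ z
    have := limitMarg_pos hγ (-z)
    positivity
  have hg0 : 0 ≤ g := fun z => mul_nonneg (hpos z).le (sq_nonneg _)
  have hgI : ∫ z, g z ∂stdNormal ≤ 0 := by
    have h' : ∫ c, limitModel.risk b c ∂(γ : Measure ℝ) = limitValue γ +
      ∫ z, g z ∂stdNormal := h
    linarith
  have hmint : Integrable (limitModel.marg γ) stdNormal :=
    (limitModel.lik_prod_integrable hγ).integral_prod_right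
  have hmint' : Integrable (fun z => limitModel.marg γ (-z)) stdNormal :=
    measurePreserving_neg_stdNormal.integrable_comp_of_integrable hmint
  have hbm := measurable_limitBayes (γ := γ)
  have hgi : Integrable g stdNormal := by
    refine ((hmint.add hmint').const_mul (1 / 2)).mul_bdd (c := 1)
      (Measurable.aestronglyMeasurable (by fun_prop)) (.of_forall fun z => ?_)
    have h1 := hb' z
    have h2 := limitModel.bayes_mem hγ z
    rw [Real.norm_of_nonneg (sq_nonneg _)]
    nlinarith [h1.1, h1.2, h2.1, h2.2]
  have h0 := (integral_eq_zero_iff_of_nonneg hg0 hgi).1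
    (le_antisymm hgI (integral_nonneg hg0))
  refine stdNormal_ae_iff.1 ?_
  filter_upwards [h0] with z hz
  have := (mul_eq_zero.1 hz).resolve_left (hpos z).ne'
  exact sub_eq_zero.1 (pow_eq_zero_iff two_ne_zero |>.1 this)

section

variable {γ : ProbabilityMeasure ℝ} {C : ℝ}

lemma monotone_limitBayes (hγ : γ ∈ boundedStrategies C) :
    Monotone (limitModel.bayes (γ : Measure ℝ) : ℝ → ℝ) :=
  monotone_of_hasDerivAt_nonneg (fun z => hasDerivAt_bayes hγ z) fun z => bayesDeriv_nonneg hγ z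

lemma limitBayes_mem (hγ : γ ∈ boundedStrategies C) :
    limitModel.bayes (γ : Measure ℝ) ∈ limitDMStrategies :=
  ⟨monotone_limitBayes hγ, limitModel.bayes_mem (ae_mem_params hγ)⟩

lemma limitRegret_eq_of_mem {a : ℝ → ℝ} (ha : a ∈ limitDMStrategies)
    (hγ : γ ∈ limitNatureStrategies) :
    limitRegret a γ = ∫ c, limitModel.risk a c ∂(γ : Measure ℝ) :=
  limitRegret_eq ha.1.measurable ha.2 (mem_limitNature_iff.1 hγ)

/-- If the signal is known to be uninformative, the Bayes rule is `1/2` and agrees with the oracle.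
-/
lemma not_ae_eq_zero {γ : ProbabilityMeasure ℝ}
    (hγ : ∀ᵐ c ∂(γ : Measure ℝ), c ∈ limitModel.params) (hv : 0 < limitValue γ) :
    ¬ ∀ᵐ c ∂(γ : Measure ℝ), c = 0 := by
  intro h0
  have hm : ∀ z, limitModel.marg γ z = 1 := fun z => by
    have : ∫ c, limitLik c z ∂(γ : Measure ℝ) = ∫ _, (1 : ℝ) ∂(γ : Measure ℝ) := by
      refine integral_congr_ae ?_
      filter_upwards [h0] with c hc
      simp [hc, limitLik]
    exact this.trans (by simp)
  have hz : limitModel.risk (limitModel.bayes γ) 0 = 0 := by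
    refine integral_eq_zero_of_ae (.of_forall fun z => ?_)
    change lossKernel (limitLik 0 z) (limitLik 0 (-z)) (limitModel.bayes γ z) = 0
    rw [limitBayes_eq hγ, hm, hm]
    simp [limitLik, lossKernel]
  refine hv.ne' (integral_eq_zero_of_ae ?_)
  filter_upwards [h0] with c hc
  rw [hc, hz]; rfl

lemma isLimitNash_bayes (hγ : γ ∈ boundedStrategies C)
    (hle : ∀ c, 0 ≤ c → limitModel.risk (limitModel.bayes γ) c ≤ limitValue γ) :
    IsLimitNash (limitModel.bayes γ) γ := by
  have hp := ae_mem_params hγ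
  have hN : γ ∈ limitNatureStrategies := mem_limitNature_iff.2 hp
  have ha := limitBayes_mem hγ
  refine ⟨ha, hN, fun a' ha' => ?_, fun γ' hγ' => ?_⟩
  · rw [limitRegret_eq_of_mem ha hN, limitRegret_eq_of_mem ha' hN]
    exact limitValue_le ha'.1.measurable ha'.2 hp
  · rw [limitRegret_eq_of_mem ha hN, limitRegret_eq_of_mem ha hγ']
    have hp' := mem_limitNature_iff.1 hγ'
    calc ∫ c, limitModel.risk (limitModel.bayes γ) c ∂(γ' : Measure ℝ)
        ≤ ∫ _, limitValue γ ∂(γ' : Measure ℝ) := by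
          refine integral_mono_ae (limitModel.risk_integrable ha.1.measurable ha.2 hp')
            (integrable_const _) ?_
          filter_upwards [hp'] with c hc using hle c hc
      _ = limitValue γ := by simp

lemma integral_two_point {c₀ : ℝ} (hae : ∀ᵐ c ∂(γ : Measure ℝ), c = 0 ∨ c = c₀)
    (f : ℝ → ℝ) : ∫ c, f c ∂(γ : Measure ℝ) =
      (γ : Measure ℝ).real {0} * f 0 + (1 - (γ : Measure ℝ).real {0}) * f c₀ := by
  have h : ∫ c, f c ∂(γ : Measure ℝ) =
      ∫ c, (({0} : Set ℝ).indicator (fun _ => f 0 - f c₀) c + f c₀) ∂(γ : Measure ℝ) := by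
    refine integral_congr_ae ?_
    filter_upwards [hae] with c hc
    rcases eq_or_ne c 0 with h0 | h0
    · subst h0; simp
    · rw [indicator_of_notMem (by simpa using h0), zero_add, hc.resolve_left h0]
  rw [h, integral_add ((integrable_const _).indicator (measurableSet_singleton _))
    (integrable_const _), integral_indicator (measurableSet_singleton _), setIntegral_const]
  simp only [smul_eq_mul, integral_const, probReal_univ, one_mul]
  ring

/-- The marginal likelihood is affine in the weight on `0`. After cross-multiplying, equality of the
posteriors at the single signal `1` reduces to `(p - q) * (limitLik c₀ 1 - limitLik c₀ (-1)) = 0`.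
-/
lemma eq_of_two_point {γ' : ProbabilityMeasure ℝ} {c₀ : ℝ} (hc₀ : 0 < c₀)
    (hae : ∀ᵐ c ∂(γ : Measure ℝ), c = 0 ∨ c = c₀) (hae' : ∀ᵐ c ∂(γ' : Measure ℝ), c = 0 ∨ c = c₀)
    (hb : limitModel.bayes (γ : Measure ℝ) = limitModel.bayes (γ' : Measure ℝ)) : γ' = γ := by
  have hp : ∀ {δ : ProbabilityMeasure ℝ}, (∀ᵐ c ∂(δ : Measure ℝ), c = 0 ∨ c = c₀) →
      ∀ᵐ c ∂(δ : Measure ℝ), c ∈ limitModel.params := fun h => h.mono fun c hc => by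
    rcases hc with rfl | rfl
    · exact le_refl (0 : ℝ)
    · exact hc₀.le
  set p := (γ : Measure ℝ).real {0} with hpdef
  set q := (γ' : Measure ℝ).real {0} with hqdef
  have h1 := congrFun hb 1
  rw [limitBayes_eq (hp hae), limitBayes_eq (hp hae')] at h1
  have m1 := limitMarg_pos (hp hae) 1
  have m2 := limitMarg_pos (hp hae) (-1)
  have m3 := limitMarg_pos (hp hae') 1
  have m4 := limitMarg_pos (hp hae') (-1)
  rw [div_eq_div_iff (by positivity) (by positivity)] at h1
  have hL : ∀ z, limitLik 0 z = 1 := fun z => by simp [limitLik]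
  have e1 : ∀ z, limitModel.marg γ z = p + (1 - p) * limitLik c₀ z := fun z => by
    have := integral_two_point hae fun c => limitLik c z
    rw [hL, mul_one] at this
    exact this
  have e2 : ∀ z, limitModel.marg γ' z = q + (1 - q) * limitLik c₀ z := fun z => by
    have := integral_two_point hae' fun c => limitLik c z
    rw [hL, mul_one] at this
    exact this
  rw [e1, e1, e2, e2] at h1
  have hxy : limitLik c₀ (-1) < limitLik c₀ 1 := Real.exp_lt_exp.2 (by linarith)
  have hpq : p = q := by
    have : (p - q) * (limitLik c₀ 1 - limitLik c₀ (-1)) = 0 := by linear_combination -h1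
    exact sub_eq_zero.1 ((mul_eq_zero.1 this).resolve_right (sub_pos.2 hxy).ne')
  refine Subtype.ext (Measure.ext fun s hs => ?_)
  have h2 := integral_two_point hae (s.indicator fun _ => 1)
  have h3 := integral_two_point hae' (s.indicator fun _ => 1)
  rw [← hpdef, hpq, ← h3, integral_indicator_const _ hs, integral_indicator_const _ hs] at h2
  simp only [smul_eq_mul, mul_one] at h2
  exact ((measureReal_eq_measureReal_iff).1 h2).symm

/-- The limit game has at most one equilibrium. -/
theorem limitNash_unique (hγ : γ ∈ boundedStrategies C) (hv : 0 < limitValue γ)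
    (hle : ∀ c, 0 ≤ c → limitModel.risk (limitModel.bayes γ) c ≤ limitValue γ) {a' : ℝ → ℝ}
    {γ' : ProbabilityMeasure ℝ} (h : IsLimitNash a' γ') :
    a' = limitModel.bayes γ ∧ γ' = γ := by
  set a : ℝ → ℝ := limitModel.bayes γ with ha
  have hN := isLimitNash_bayes hγ hle
  have hp := ae_mem_params hγ
  have hp' := mem_limitNature_iff.1 h.nature_mem
  have ham : Measurable a := hN.dm_mem.1.measurable
  have hR : ∀ {b δ}, b ∈ limitDMStrategies → δ ∈ limitNatureStrategies →
      limitRegret b δ = ∫ c, limitModel.risk b c ∂(δ : Measure ℝ) := limitRegret_eq_of_mem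
  have hval : limitRegret a γ = limitValue γ := hR hN.dm_mem hN.nature_mem
  -- The four inequalities close into a cycle, so all four regrets are equal: equilibria of a
  -- zero-sum game are interchangeable.
  have r1 := hN.dm_best a' h.dm_mem
  have r2 := h.nature_best γ hN.nature_mem
  have r3 := h.dm_best a hN.dm_mem
  have r4 := hN.nature_best γ' h.nature_mem
  have hsat : ∀ {δ : ProbabilityMeasure ℝ}, (∀ᵐ c ∂(δ : Measure ℝ), c ∈ limitModel.params) →
      limitValue γ ≤ ∫ c, limitModel.risk a c ∂(δ : Measure ℝ) →
      ∀ᵐ c ∂(δ : Measure ℝ), 0 ≤ c ∧ limitModel.risk a c = limitValue γ := by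
    intro δ hδ hint
    have hi := limitModel.risk_integrable ham hN.dm_mem.2 hδ
    have hnn : 0 ≤ᵐ[(δ : Measure ℝ)] fun c => limitValue γ - limitModel.risk a c := by
      filter_upwards [hδ] with c hc using sub_nonneg.2 (hle c hc)
    have h0 := (integral_eq_zero_iff_of_nonneg_ae hnn ((integrable_const _).sub hi)).1 (by
      refine le_antisymm ?_ (integral_nonneg_of_ae hnn)
      rw [integral_sub (integrable_const _) hi]
      simpa using hint)
    filter_upwards [h0, hδ] with c hc hc0
    exact ⟨hc0, (sub_eq_zero.1 hc).symm⟩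
  have s1 := hsat hp le_rfl
  have s2 := hsat hp' (by rw [← hR hN.dm_mem h.nature_mem]; linarith)
  have hne := not_ae_eq_zero hp hv
  obtain ⟨c₀, hc₀, hM⟩ : ∃ c₀ : ℝ, 0 < c₀ ∧ ∀ c, 0 ≤ c ∧ limitModel.risk a c = limitValue γ →
      c = 0 ∨ c = c₀ := by
    by_cases hex : ∃ c₀, 0 < c₀ ∧ limitModel.risk a c₀ = limitValue γ
    · obtain ⟨c₀, hc₀, hr⟩ := hex
      refine ⟨c₀, hc₀, fun c hc => ?_⟩
      rcases hc.1.eq_or_lt with h0 | h0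
      · exact Or.inl h0.symm
      · exact Or.inr (argmax_unique hγ hne hle h0 hc₀ hc.2 hr)
    · push Not at hex
      -- Here `0` is the only possible maximiser, and any positive number serves as `c₀`.
      refine ⟨1, one_pos, fun c hc => ?_⟩
      rcases hc.1.eq_or_lt with h0 | h0
      · exact Or.inl h0.symm
      · exact absurd hc.2 (hex c h0)
  have t1 : ∀ᵐ c ∂(γ : Measure ℝ), c = 0 ∨ c = c₀ := s1.mono fun c hc => hM c hc
  have t2 : ∀ᵐ c ∂(γ' : Measure ℝ), c = 0 ∨ c = c₀ := s2.mono fun c hc => hM c hc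
  have hγ' : γ' ∈ boundedStrategies c₀ :=
    (ae_mem_of_measure_eq_one measurableSet_Icc).2 (t2.mono fun c hc => by
      rcases hc with rfl | rfl
      · exact ⟨le_rfl, hc₀.le⟩
      · exact ⟨hc₀.le, le_rfl⟩)
  -- Both `a` and `a'` are optimal against `γ'`, so both coincide with its Bayes rule, which is
  -- continuous because `γ'` has bounded support.
  have r5 := h.dm_best _ (limitBayes_mem hγ')
  have hv' : limitRegret (limitModel.bayes (γ' : Measure ℝ)) γ' = limitValue γ' :=
    hR (limitBayes_mem hγ') h.nature_mem
  have q1 := ae_eq_bayes_of_le h.dm_mem.1.measurable h.dm_mem.2 hp' (by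
    rw [← hR h.dm_mem h.nature_mem]; linarith)
  have q2 := ae_eq_bayes_of_le ham hN.dm_mem.2 hp' (by
    rw [← hR hN.dm_mem h.nature_mem]; linarith)
  have e1 := Monotone.eq_of_ae_eq_continuous h.dm_mem.1 (continuous_limitBayes hγ') q1
  have e2 := Monotone.eq_of_ae_eq_continuous hN.dm_mem.1 (continuous_limitBayes hγ') q2
  exact ⟨e1.trans e2.symm, eq_of_two_point hc₀ t1 t2 e2⟩

end

/-! ### The binomial distribution and the central limit theorem. -/

/-- The binomial distribution with `n` trials and success probability `1/2`. -/
def binomBase (n : ℕ) : Measure (Fin (n + 1)) :=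
  ∑ k : Fin (n + 1), ENNReal.ofReal ((n.choose k : ℝ) / 2 ^ n) • Measure.dirac k

lemma integral_binomBase {E : Type*} [NormedAddCommGroup E] [NormedSpace ℝ E] [CompleteSpace E]
    (n : ℕ) (f : Fin (n + 1) → E) :
    ∫ k, f k ∂(binomBase n) = ∑ k : Fin (n + 1), ((n.choose k : ℝ) / 2 ^ n) • f k := by
  rw [binomBase, integral_finsetSum_measure]
  · refine Finset.sum_congr rfl fun k _ => ?_
    rw [integral_smul_measure, integral_dirac, ENNReal.toReal_ofReal (by positivity)]
  · exact fun k _ => (integrable_dirac (by simp)).smul_measure (by simp)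

instance isProbabilityMeasure_binomBase (n : ℕ) : IsProbabilityMeasure (binomBase n) := ⟨by
  simp only [binomBase, Measure.coe_finsetSum, Finset.sum_apply, Measure.smul_apply,
    measure_univ, smul_eq_mul, mul_one]
  rw [← ENNReal.ofReal_sum_of_nonneg fun k _ => by positivity, ← Finset.sum_div,
    Fin.sum_univ_eq_sum_range (fun k => (n.choose k : ℝ)) (n + 1), ← Nat.cast_sum,
    Nat.sum_range_choose]
  simp⟩

lemma integrable_binomBase {E : Type*} [NormedAddCommGroup E] (n : ℕ) (f : Fin (n + 1) → E) :
    Integrable f (binomBase n) := Integrable.of_finite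

/-- The standardised number of high signals. -/
def countScore (n : ℕ) (k : Fin (n + 1)) : ℝ := ((k : ℝ) - (n : ℝ) / 2) / (√(n : ℝ) / 2)

lemma countScore_eq (n : ℕ) (k : Fin (n + 1)) :
    countScore n k = (2 * (k : ℝ) - n) / √(n : ℝ) := by
  unfold countScore
  rw [div_div_eq_mul_div]
  congr 1; ring

/-- The law of the standardised number of high signals. -/
def countLaw (n : ℕ) : ProbabilityMeasure ℝ :=
  ⟨(binomBase n).map (countScore n), Measure.isProbabilityMeasure_map
    (measurable_of_finite _).aemeasurable⟩

lemma integral_countLaw {E : Type*} [NormedAddCommGroup E] [NormedSpace ℝ E] [CompleteSpace E]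
    (n : ℕ) {f : ℝ → E} (hf : StronglyMeasurable f) :
    ∫ z, f z ∂(countLaw n : Measure ℝ) = ∫ k, f (countScore n k) ∂(binomBase n) :=
  integral_map (measurable_of_finite _).aemeasurable hf.aestronglyMeasurable

lemma integrable_countLaw (n : ℕ) {f : ℝ → ℝ} (hf : Measurable f) :
    Integrable f (countLaw n : Measure ℝ) :=
  (integrable_map_measure hf.aestronglyMeasurable (measurable_of_finite _).aemeasurable).2
    (integrable_binomBase n _)

/-- The Rademacher distribution. -/
def signLaw : ProbabilityMeasure ℝ := mixture (1 / 2) (by norm_num) (pointMass 1) (pointMass (-1))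

lemma integral_signLaw (f : ℝ → ℝ) :
    ∫ x, f x ∂(signLaw : Measure ℝ) = 1 / 2 * f 1 + 1 / 2 * f (-1) := by
  rw [signLaw, integral_mixture _ (integrable_pointMass _ _) (integrable_pointMass _ _),
    integral_pointMass, integral_pointMass]
  norm_num

lemma charFun_signLaw (t : ℝ) : charFun (signLaw : Measure ℝ) t =
    (Complex.exp (t * Complex.I) + Complex.exp (-(t * Complex.I))) / 2 := by
  rw [charFun_apply_real]
  change ∫ x : ℝ, Complex.exp (t * x * Complex.I) ∂(ENNReal.ofReal (1 - 1 / 2) •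
    Measure.dirac (1 : ℝ) + ENNReal.ofReal (1 / 2) • Measure.dirac (-1 : ℝ)) = _
  rw [integral_add_measure ((integrable_dirac (by simp)).smul_measure (by simp))
    ((integrable_dirac (by simp)).smul_measure (by simp)), integral_smul_measure,
    integral_smul_measure, integral_dirac, integral_dirac, ENNReal.toReal_ofReal (by norm_num),
    ENNReal.toReal_ofReal (by norm_num)]
  simp only [Complex.real_smul, Complex.ofReal_neg, Complex.ofReal_one, mul_one, mul_neg, neg_mul]
  push_cast
  ring

/-- Averages of powers under the symmetric binomial distribution. -/
lemma sum_choose_mul_pow {R : Type*} [Field R] (n : ℕ) (x y : R) :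
    ∑ k : Fin (n + 1), ((n.choose k : R) / 2 ^ n) * (x ^ (k : ℕ) * y ^ (n - (k : ℕ))) =
      ((x + y) / 2) ^ n := by
  rw [Fin.sum_univ_eq_sum_range (fun k => ((n.choose k : R) / 2 ^ n) * (x ^ k * y ^ (n - k))) (n + 1),
    div_pow, add_pow, Finset.sum_div]
  exact Finset.sum_congr rfl fun k _ => by ring

/-- The score has the law of a normalised sum of `n` independent signs. Since `2 * k - n = k - (n -
k)`, the binomial theorem factors the characteristic function. -/
lemma charFun_countLaw (n : ℕ) (t : ℝ) :
    charFun (countLaw n : Measure ℝ) t = charFun (signLaw : Measure ℝ) ((√n)⁻¹ * t) ^ n := by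
  rw [charFun_apply_real, integral_countLaw n (Continuous.stronglyMeasurable (by fun_prop)),
    integral_binomBase, charFun_signLaw, ← sum_choose_mul_pow]
  refine Finset.sum_congr rfl fun k _ => ?_
  rw [Complex.real_smul]
  push_cast
  congr 1
  rw [← Complex.exp_nat_mul, ← Complex.exp_nat_mul, ← Complex.exp_add]
  congr 1
  rw [countScore_eq]
  push_cast [Nat.cast_sub (Nat.lt_succ_iff.1 k.2)]
  ring

lemma tendsto_countLaw : Tendsto countLaw atTop (𝓝 ⟨stdNormal, inferInstance⟩) := by
  refine ProbabilityMeasure.tendsto_iff_tendsto_charFun.2 fun t => ?_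
  have h := tendsto_charFun_inv_sqrt_mul_pow (P := (signLaw : Measure ℝ)) (X := id) aemeasurable_id
    (by rw [show (∫ x, id x ∂(signLaw : Measure ℝ)) = _ from integral_signLaw id]; simp)
    (by
      have := integral_signLaw fun x => x ^ 2
      simp only [Pi.pow_apply, id_eq]
      rw [this]; norm_num) t
  rw [Measure.map_id] at h
  simp only [charFun_countLaw]
  convert h using 2
  change charFun stdNormal t = _
  rw [charFun_gaussianReal]
  simp [neg_div]

/-- The moment generating function is `cosh (r / √n) ^ n ≤ exp (r ^ 2 / 2)`. The bound is uniform in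
`n` and controls the tails in the central limit theorem. -/
lemma integral_exp_abs_countLaw_le {n : ℕ} (hn : n ≠ 0) (s : ℝ) :
    ∫ z, Real.exp (s * |z|) ∂(countLaw n : Measure ℝ) ≤ 2 * Real.exp (s ^ 2 / 2) := by
  have h1 : ∀ r : ℝ, ∫ z, Real.exp (r * z) ∂(countLaw n : Measure ℝ) ≤ Real.exp (r ^ 2 / 2) := by
    intro r
    rw [integral_countLaw n (Continuous.stronglyMeasurable (by fun_prop)), integral_binomBase]
    have e : ∑ k : Fin (n + 1), ((n.choose k : ℝ) / 2 ^ n) • Real.exp (r * countScore n k) =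
        Real.cosh ((√n)⁻¹ * r) ^ n := by
      rw [Real.cosh_eq, ← sum_choose_mul_pow]
      refine Finset.sum_congr rfl fun k _ => ?_
      rw [smul_eq_mul, ← Real.exp_nat_mul, ← Real.exp_nat_mul, ← Real.exp_add, countScore_eq,
        Nat.cast_sub (Nat.lt_succ_iff.1 k.2)]
      congr 2; ring
    rw [e]
    calc Real.cosh ((√n)⁻¹ * r) ^ n ≤ Real.exp (((√n)⁻¹ * r) ^ 2 / 2) ^ n :=
          pow_le_pow_left₀ (Real.cosh_pos _).le (Real.cosh_le_exp_half_sq _) n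
      _ = Real.exp (r ^ 2 / 2) := by
          rw [← Real.exp_nat_mul, mul_pow, inv_pow, Real.sq_sqrt n.cast_nonneg]
          congr 1
          have : (n : ℝ) ≠ 0 := Nat.cast_ne_zero.2 hn
          field_simp
  have hi : ∀ r : ℝ, Integrable (fun z => Real.exp (r * z)) (countLaw n : Measure ℝ) := fun r =>
    integrable_countLaw n (by fun_prop)
  calc ∫ z, Real.exp (s * |z|) ∂(countLaw n : Measure ℝ)
      ≤ ∫ z, (Real.exp (s * z) + Real.exp (-s * z)) ∂(countLaw n : Measure ℝ) := by
        refine integral_mono (integrable_countLaw n (by fun_prop)) ((hi s).add (hi (-s)))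
          fun z => ?_
        rcases abs_cases z with ⟨h, _⟩ | ⟨h, _⟩ <;> simp only [h]
        · linarith [Real.exp_pos (-s * z)]
        · rw [mul_neg, ← neg_mul]
          linarith [Real.exp_pos (s * z)]
    _ ≤ 2 * Real.exp (s ^ 2 / 2) := by
        rw [integral_add (hi s) (hi (-s))]
        have h2 := h1 s
        have h3 := h1 (-s)
        rw [neg_sq] at h3
        linarith

/-- A continuous cutoff function. -/
def cutoff (M z : ℝ) : ℝ := max 0 (min 1 (M + 1 - |z|))

lemma continuous_cutoff (M : ℝ) : Continuous (cutoff M) := by unfold cutoff; fun_prop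

lemma cutoff_mem (M z : ℝ) : cutoff M z ∈ Icc (0 : ℝ) 1 :=
  ⟨le_max_left _ _, max_le zero_le_one (min_le_left _ _)⟩

lemma cutoff_eq_one {M z : ℝ} (h : |z| ≤ M) : cutoff M z = 1 := by
  unfold cutoff
  rw [min_eq_left (by linarith), max_eq_right zero_le_one]

lemma cutoff_eq_zero {M z : ℝ} (h : M + 1 ≤ |z|) : cutoff M z = 0 := by
  unfold cutoff
  rw [max_eq_left]
  exact (min_le_right _ _).trans (by linarith)

/-- Where the cutoff differs from `1` one has `|z| ≥ M`, so the spare factor `exp |z|` pays for `exp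
(-M)`. -/
lemma integral_sub_cutoff_le {μ : Measure ℝ} {g : ℝ → ℝ} {K s M : ℝ} (hg : Integrable g μ)
    (hi : Integrable (fun z => Real.exp ((s + 1) * |z|)) μ) (hK : 0 ≤ K)
    (hgK : ∀ z, |g z| ≤ K * Real.exp (s * |z|)) :
    |∫ z, g z ∂μ - ∫ z, g z * cutoff M z ∂μ| ≤
      K * Real.exp (-M) * ∫ z, Real.exp ((s + 1) * |z|) ∂μ := by
  have hgc : Integrable (fun z => g z * cutoff M z) μ :=
    hg.mul_bdd (c := 1) (continuous_cutoff M).aestronglyMeasurable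
      (.of_forall fun z => by
        rw [Real.norm_of_nonneg (cutoff_mem M z).1]; exact (cutoff_mem M z).2)
  rw [← integral_sub hg hgc, ← integral_const_mul]
  refine (abs_integral_le_integral_abs).trans (integral_mono (hg.sub hgc).abs (hi.const_mul _)
    fun z => ?_)
  have hE : 0 < Real.exp ((s + 1) * |z|) := Real.exp_pos _
  rcases le_total |z| M with h | h
  · simp only [cutoff_eq_one h, mul_one, sub_self, abs_zero]
    positivity
  · have h1 : |g z - g z * cutoff M z| ≤ |g z| := by
      rw [← mul_one_sub, abs_mul]
      refine mul_le_of_le_one_right (abs_nonneg _) ?_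
      have := cutoff_mem M z
      rw [abs_of_nonneg (by linarith [this.2])]
      linarith [this.1]
    refine (h1.trans (hgK z)).trans ?_
    rw [mul_assoc, ← Real.exp_add]
    refine mul_le_mul_of_nonneg_left (Real.exp_le_exp.2 ?_) hK
    linarith

/-- A central limit theorem for test functions that vary with the index. -/
theorem tendsto_integral_countLaw {ι : Type*} {L : Filter ι} {N : ι → ℕ} (hN : Tendsto N L atTop)
    {g : ι → ℝ → ℝ} {g₀ : ℝ → ℝ} {K s : ℝ} (hgm : ∀ᶠ i in L, Measurable (g i))
    (hg₀ : Continuous g₀) (hlim : ∀ z, Tendsto (fun p : ι × ℝ => g p.1 p.2) (L ×ˢ 𝓝 z) (𝓝 (g₀ z)))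
    (hK : 0 ≤ K) (hgK : ∀ᶠ i in L, ∀ z, |g i z| ≤ K * Real.exp (s * |z|))
    (hg₀K : ∀ z, |g₀ z| ≤ K * Real.exp (s * |z|)) :
    Tendsto (fun i => ∫ z, g i z ∂(countLaw (N i) : Measure ℝ)) L (𝓝 (∫ z, g₀ z ∂stdNormal)) := by
  rw [Metric.tendsto_nhds]
  intro ε hε
  set B : ℝ := 2 * Real.exp ((s + 1) ^ 2 / 2) + ∫ z, Real.exp ((s + 1) * |z|) ∂stdNormal with hB
  have hI0 : 0 ≤ ∫ z, Real.exp ((s + 1) * |z|) ∂stdNormal :=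
    integral_nonneg fun z => (Real.exp_pos _).le
  have hE0 := Real.exp_pos ((s + 1) ^ 2 / 2)
  -- The error splits into four parts of size `ε / 4`: truncation under each of the two laws,
  -- replacement of `g i` by `g₀` on a compact interval, and weak convergence.
  obtain ⟨M, hM⟩ : ∃ M : ℝ, K * Real.exp (-M) * B < ε / 4 := by
    have h : Tendsto (fun M : ℝ => K * Real.exp (-M) * B) atTop (𝓝 0) := by
      simpa using (Real.tendsto_exp_neg_atTop_nhds_zero.const_mul K).mul_const B
    exact (h.eventually (gt_mem_nhds (by positivity))).exists
  -- Continuous convergence is uniform on compact sets.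
  have hunif : ∀ᶠ i in L, ∀ z ∈ Icc (-(M + 1)) (M + 1), |g i z - g₀ z| < ε / 4 := by
    have h1 : ∀ z ∈ Icc (-(M + 1)) (M + 1), {p : ι × ℝ | |g p.1 p.2 - g₀ p.2| < ε / 4} ∈
        L ×ˢ 𝓝 z := by
      intro z _
      have h2 : Tendsto (fun p : ι × ℝ => |g p.1 p.2 - g₀ p.2|) (L ×ˢ 𝓝 z) (𝓝 0) := by
        have := ((hlim z).sub ((hg₀.tendsto z).comp tendsto_snd)).abs
        simpa using this
      exact h2.eventually (gt_mem_nhds (by positivity))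
    obtain ⟨t, ht, u, hu, htu⟩ := mem_prod_iff.1
      (isCompact_Icc.mem_prod_nhdsSet_of_forall h1)
    filter_upwards [ht] with i hi z hz
    exact htu (⟨hi, subset_of_mem_nhdsSet hu hz⟩ : (i, z) ∈ t ×ˢ u)
  have hmid : Tendsto (fun i => ∫ z, g₀ z * cutoff M z ∂(countLaw (N i) : Measure ℝ)) L
      (𝓝 (∫ z, g₀ z * cutoff M z ∂stdNormal)) := by
    obtain ⟨D, hD⟩ := (isCompact_Icc (a := -(M + 1)) (b := M + 1)).exists_bound_of_continuousOn
      hg₀.continuousOn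
    let F : BoundedContinuousFunction ℝ ℝ := .ofNormedAddCommGroup
      (fun z => g₀ z * cutoff M z) (hg₀.mul (continuous_cutoff M)) |D| fun z => by
        rcases le_total (M + 1) |z| with h | h
        · simp [cutoff_eq_zero h]
        · rw [norm_mul, Real.norm_of_nonneg (cutoff_mem M z).1]
          exact (mul_le_of_le_one_right (norm_nonneg _) (cutoff_mem M z).2).trans
            ((hD z (abs_le.1 h)).trans (le_abs_self D))
    exact ProbabilityMeasure.tendsto_iff_forall_integral_tendsto.1 (tendsto_countLaw.comp hN) F
  filter_upwards [hgm, hgK, hunif, Metric.tendsto_nhds.1 hmid (ε / 4) (by positivity),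
    hN.eventually (eventually_ne_atTop 0)] with i him hiK hiu hmi hNi
  have hg₀m : Measurable g₀ := hg₀.measurable
  have t1 := integral_sub_cutoff_le (M := M) (integrable_countLaw (N i) him)
    (integrable_countLaw (N i) (by fun_prop)) hK hiK
  have hg₀i : Integrable g₀ stdNormal :=
    Integrable.mono' ((integrable_exp_mul_abs_stdNormal s).const_mul K)
      hg₀.aestronglyMeasurable (.of_forall hg₀K)
  have t2 := integral_sub_cutoff_le (M := M) hg₀i (integrable_exp_mul_abs_stdNormal (s + 1)) hK hg₀K
  have b1 := integral_exp_abs_countLaw_le hNi (s + 1)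
  have hKM : 0 ≤ K * Real.exp (-M) := by positivity
  have t1' : |∫ z, g i z ∂(countLaw (N i) : Measure ℝ) -
      ∫ z, g i z * cutoff M z ∂(countLaw (N i) : Measure ℝ)| < ε / 4 :=
    (t1.trans (mul_le_mul_of_nonneg_left (by linarith) hKM)).trans_lt hM
  have t2' : |∫ z, g₀ z ∂stdNormal - ∫ z, g₀ z * cutoff M z ∂stdNormal| < ε / 4 :=
    (t2.trans (mul_le_mul_of_nonneg_left (by linarith) hKM)).trans_lt hM
  have hcm := (continuous_cutoff M).measurable
  have t3 : |∫ z, g i z * cutoff M z ∂(countLaw (N i) : Measure ℝ) -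
      ∫ z, g₀ z * cutoff M z ∂(countLaw (N i) : Measure ℝ)| ≤ ε / 4 := by
    have i1 := integrable_countLaw (N i) (him.mul hcm)
    have i2 := integrable_countLaw (N i) (hg₀m.mul hcm)
    change |∫ z, (g i * cutoff M) z ∂(countLaw (N i) : Measure ℝ) -
      ∫ z, (g₀ * cutoff M) z ∂(countLaw (N i) : Measure ℝ)| ≤ ε / 4
    rw [← integral_sub i1 i2]
    refine abs_integral_le_integral_abs.trans ?_
    calc ∫ z, |(g i * cutoff M) z - (g₀ * cutoff M) z| ∂(countLaw (N i) : Measure ℝ)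
        ≤ ∫ _, ε / 4 ∂(countLaw (N i) : Measure ℝ) := by
          refine integral_mono (i1.sub i2).abs (integrable_const _) fun z => ?_
          simp only [Pi.mul_apply, ← sub_mul, abs_mul]
          rcases le_total (M + 1) |z| with h | h
          · rw [cutoff_eq_zero h, abs_zero, mul_zero]
            positivity
          · rw [abs_of_nonneg (cutoff_mem M z).1]
            exact (mul_le_of_le_one_right (abs_nonneg _) (cutoff_mem M z).2).trans
              (hiu z (abs_le.1 h)).le
      _ = ε / 4 := by simp
  rw [Real.dist_eq] at hmi ⊢
  rw [abs_lt] at t1' t2' hmi ⊢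
  rw [abs_le] at t3
  constructor <;> linarith [t1'.1, t1'.2, t2'.1, t2'.2, hmi.1, hmi.2, t3.1, t3.2]

/-! ### The finite games as symmetric experiments. -/

/-- The likelihood of `k` high signals in state `1` relative to fair coin tosses. -/
def countLik (n : ℕ) (c : ℝ) (k : Fin (n + 1)) : ℝ :=
  (1 + 2 * c / √(n : ℝ)) ^ (k : ℕ) * (1 - 2 * c / √(n : ℝ)) ^ (n - (k : ℕ))

lemma countLik_eq (n : ℕ) (c : ℝ) (k : Fin (n + 1)) : countLik n c k = 2 ^ n * likOne n c k := by
  have hk : (k : ℕ) + (n - (k : ℕ)) = n := Nat.add_sub_cancel' (Nat.lt_succ_iff.1 k.2)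
  have e1 : 1 + 2 * c / √(n : ℝ) = 2 * precision n c := by unfold precision; ring
  have e2 : 1 - 2 * c / √(n : ℝ) = 2 * (1 - precision n c) := by unfold precision; ring
  unfold countLik likOne
  have e3 : (2 : ℝ) ^ n = 2 ^ (k : ℕ) * 2 ^ (n - (k : ℕ)) := by rw [← pow_add, hk]
  rw [e1, e2, mul_pow, mul_pow, e3]
  ring

lemma countLik_rev (n : ℕ) (c : ℝ) (k : Fin (n + 1)) :
    countLik n c k.rev = 2 ^ n * likZero n c k := by
  have hk : (k : ℕ) ≤ n := Nat.lt_succ_iff.1 k.2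
  have e : (k.rev : ℕ) = n - k := by rw [Fin.val_rev]; omega
  rw [countLik_eq, likOne, likZero, e, Nat.sub_sub_self hk, mul_comm (precision n c ^ _)]

section

variable {n : ℕ} {c : ℝ}

lemma sqrt_pos_of_one_le (hn : 1 ≤ n) : 0 < √(n : ℝ) :=
  Real.sqrt_pos.2 (Nat.cast_pos.2 hn)

lemma ratio_mem (hn : 1 ≤ n) (hc : c ∈ Icc 0 (√(n : ℝ) / 2)) :
    2 * c / √(n : ℝ) ∈ Icc (0 : ℝ) 1 := by
  have h := sqrt_pos_of_one_le hn
  exact ⟨div_nonneg (by linarith [hc.1]) h.le, (div_le_one h).2 (by linarith [hc.2])⟩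

lemma countLik_nonneg (hn : 1 ≤ n) (hc : c ∈ Icc 0 (√(n : ℝ) / 2)) (k : Fin (n + 1)) :
    0 ≤ countLik n c k := by
  have h := ratio_mem hn hc
  exact mul_nonneg (pow_nonneg (by linarith [h.1]) _) (pow_nonneg (by linarith [h.2]) _)

lemma countScore_rev (k : Fin (n + 1)) : countScore n k.rev = -countScore n k := by
  have e : ((k.rev : ℕ) : ℝ) = n - k := by
    rw [Fin.val_rev, ← Nat.cast_sub (Nat.lt_succ_iff.1 k.2)]
    congr 1; omega
  rw [countScore_eq, countScore_eq, e, ← neg_div]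
  congr 1; ring

lemma measurePreserving_rev (n : ℕ) :
    MeasurePreserving (Fin.rev : Fin (n + 1) → Fin (n + 1)) (binomBase n) (binomBase n) := by
  refine ⟨measurable_of_finite _, ?_⟩
  rw [binomBase, Measure.map_finset_sum (measurable_of_finite _).aemeasurable]
  simp only [Measure.map_smul, Measure.map_dirac' (measurable_of_finite _)]
  refine Fintype.sum_equiv Fin.revPerm _ _ fun k => ?_
  have e : ((Fin.revPerm k : Fin (n + 1)) : ℕ) = n - k := by
    rw [Fin.revPerm_apply, Fin.val_rev]; omega
  rw [e, Nat.choose_symm (Nat.lt_succ_iff.1 k.2)]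
  rfl

lemma sum_countLik (n : ℕ) (c : ℝ) : ∫ k, countLik n c k ∂(binomBase n) = 1 := by
  rw [integral_binomBase]
  simp only [smul_eq_mul, countLik]
  rw [sum_choose_mul_pow]
  ring_nf

/-- The binomial variance, taken from the variance identity for Bernstein polynomials, is `4 * p *
(1 - p) ≤ 1` after standardisation. -/
lemma sum_countLik_sq_le (hn : 1 ≤ n) (c : ℝ) :
    ∫ k, countLik n c k * (countScore n k - 2 * c) ^ 2 ∂(binomBase n) ≤ 1 := by
  have hs := sqrt_pos_of_one_le hn
  have hs2 : √(n : ℝ) ^ 2 = n := Real.sq_sqrt n.cast_nonneg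
  have hn0 : (0 : ℝ) < n := Nat.cast_pos.2 hn
  set p := precision n c with hp
  have hv := congrArg (Polynomial.eval p) (bernsteinPolynomial.variance ℝ n)
  simp only [Polynomial.eval_finsetSum, Polynomial.eval_mul, Polynomial.eval_pow,
    Polynomial.eval_sub, Polynomial.eval_X, Polynomial.eval_natCast,
    Polynomial.eval_one, nsmul_eq_mul, bernsteinPolynomial] at hv
  have e : ∫ k, countLik n c k * (countScore n k - 2 * c) ^ 2 ∂(binomBase n) =
      4 / (n : ℝ) * ∑ ν ∈ Finset.range (n + 1),
        ((n : ℝ) * p - (ν : ℝ)) ^ 2 * ((n.choose ν : ℝ) * p ^ ν * (1 - p) ^ (n - ν)) := by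
    rw [integral_binomBase, Finset.mul_sum,
      ← Fin.sum_univ_eq_sum_range (fun ν : ℕ => 4 / (n : ℝ) *
        (((n : ℝ) * p - (ν : ℝ)) ^ 2 *
          ((n.choose ν : ℝ) * p ^ ν * (1 - p) ^ (n - ν)))) (n + 1)]
    refine Finset.sum_congr rfl fun k _ => ?_
    have e1 : (countScore n k - 2 * c) ^ 2 = 4 / (n : ℝ) * ((n : ℝ) * p - ((k : ℕ) : ℝ)) ^ 2 := by
      rw [countScore_eq, hp, precision]
      have : (2 * (k : ℝ) - n) / √(n : ℝ) - 2 * c =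
          -2 / √(n : ℝ) * (n * (1 / 2 + c / √(n : ℝ)) - k) := by
        have key : ∀ s m : ℝ, 0 < s → s ^ 2 = m →
            (2 * (k : ℝ) - m) / s - 2 * c = -2 / s * (m * (1 / 2 + c / s) - k) := by
          intro s m hs h
          subst h
          field_simp
          ring
        exact key _ _ hs hs2
      rw [this, mul_pow, div_pow, hs2]
      norm_num
    rw [e1, countLik_eq, likOne, smul_eq_mul, ← hp]
    field_simp
  rw [e]
  have hv' : ∑ ν ∈ Finset.range (n + 1),
      ((n : ℝ) * p - (ν : ℝ)) ^ 2 * ((n.choose ν : ℝ) * p ^ ν * (1 - p) ^ (n - ν)) =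
        n * p * (1 - p) := by
    simpa using hv
  rw [hv']
  have : 4 / (n : ℝ) * (n * p * (1 - p)) = 4 * p * (1 - p) := by field_simp
  rw [this]
  nlinarith [sq_nonneg (2 * p - 1)]

/-- On this range `log (1 + x) ≥ x / (1 + x) ≥ 2/3 * x`, and `-log (1 - x) ≥ x`. -/
lemma le_log_ratio {x : ℝ} (hx : 0 ≤ x) (hx' : x ≤ 1 / 2) :
    5 / 3 * x ≤ Real.log (1 + x) - Real.log (1 - x) := by
  have h1 := Real.one_sub_inv_le_log_of_pos (by linarith : 0 < 1 + x)
  have h2 := Real.log_le_sub_one_of_pos (by linarith : 0 < 1 - x)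
  have h3 : 2 / 3 * x ≤ 1 - (1 + x)⁻¹ := by
    have : 1 - (1 + x)⁻¹ = x / (1 + x) := by
      have : 1 + x ≠ 0 := by linarith
      field_simp; ring
    rw [this, le_div_iff₀ (by linarith)]
    nlinarith
  linarith

lemma le_log_one_sub_sq {x : ℝ} (hx : 0 ≤ x) (hx' : x ≤ 1 / 2) :
    -(4 / 3 * x ^ 2) ≤ Real.log (1 - x ^ 2) := by
  have hx2 : x ^ 2 ≤ 1 / 4 := by nlinarith
  have h1 := Real.one_sub_inv_le_log_of_pos (by linarith : 0 < 1 - x ^ 2)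
  refine le_trans ?_ h1
  have : 1 - (1 - x ^ 2)⁻¹ = -(x ^ 2 / (1 - x ^ 2)) := by
    have : 1 - x ^ 2 ≠ 0 := by linarith
    field_simp; ring
  rw [this, neg_le_neg_iff, div_le_iff₀ (by linarith)]
  nlinarith [sq_nonneg x]

/-- The likelihood as a function of a real score. -/
def scoreLik (n : ℕ) (c z : ℝ) : ℝ :=
  Real.exp ((n : ℝ) / 2 * Real.log (1 - (2 * c / √(n : ℝ)) ^ 2) +
    z * √(n : ℝ) / 2 * (Real.log (1 + 2 * c / √(n : ℝ)) - Real.log (1 - 2 * c / √(n : ℝ))))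

/-- Writing `k = (n + z * √n) / 2` extends the likelihood from the grid to the line, where it can be
compared with the Gaussian one. The bound on the ratio keeps both logarithms genuine. -/
lemma scoreLik_countScore (hn : 1 ≤ n) (hx : |2 * c / √(n : ℝ)| < 1) (k : Fin (n + 1)) :
    scoreLik n c (countScore n k) = countLik n c k := by
  have hs := sqrt_pos_of_one_le hn
  unfold scoreLik countLik
  rw [countScore_eq, div_mul_cancel₀ _ hs.ne']
  set x := 2 * c / √(n : ℝ)
  have h1 : 0 < 1 + x := by linarith [(abs_lt.1 hx).1]
  have h2 : 0 < 1 - x := by linarith [(abs_lt.1 hx).2]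
  have e : 1 - x ^ 2 = (1 + x) * (1 - x) := by ring
  rw [e, Real.log_mul h1.ne' h2.ne', ← Real.exp_log (pow_pos h1 _), ← Real.exp_log (pow_pos h2 _),
    ← Real.exp_add, Real.log_pow, Real.log_pow, Nat.cast_sub (Nat.lt_succ_iff.1 k.2)]
  congr 1
  ring

/-- The experiments of the finite game. -/
def finiteModel (n : ℕ) (hn : 1 ≤ n) : SignalModel (Fin (n + 1)) where
  base := binomBase n
  prob := inferInstance
  flip := Fin.rev
  score := countScore n
  lik := countLik n
  params := Icc 0 (√(n : ℝ) / 2)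
  params_nonneg _ h := h.1
  flip_mp := measurePreserving_rev n
  flip_flip := Fin.rev_rev
  score_meas := measurable_of_finite _
  score_flip := countScore_rev
  lik_meas := measurable_from_prod_countable_left fun k => by unfold countLik; fun_prop
  lik_nonneg _ hc k := countLik_nonneg hn hc k
  lik_bdd k := ⟨2 ^ (k : ℕ), fun c hc => by
    have h := ratio_mem hn hc
    refine (mul_le_of_le_one_right (pow_nonneg (by linarith [h.1]) _)
      (pow_le_one₀ (by linarith [h.2]) (by linarith [h.1]))).trans ?_
    exact pow_le_pow_left₀ (by linarith [h.1]) (by linarith [h.2]) _⟩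
  lik_integral c _ := sum_countLik n c
  moment_integrable c _ := integrable_binomBase n _
  moment_le c _ := sum_countLik_sq_le hn c
  lik_le_one c hc k hk := by
    have h := ratio_mem hn hc
    have hs := sqrt_pos_of_one_le hn
    rw [countScore_eq, div_nonpos_iff] at hk
    have hk' : 2 * (k : ℕ) ≤ n := by
      rcases hk with ⟨_, h2⟩ | ⟨h1, _⟩
      · linarith
      · exact_mod_cast (by linarith : 2 * ((k : ℕ) : ℝ) ≤ n)
    unfold countLik
    set x := 2 * c / √(n : ℝ)
    -- Each high signal is paired with a low one, which gives `(1 - x ^ 2) ^ k * (1 - x) ^ (n - 2 *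
    -- k)`.
    have e : n - (k : ℕ) = k + (n - 2 * k) := by omega
    rw [e, pow_add, ← mul_assoc, ← mul_pow]
    refine mul_le_one₀ (pow_le_one₀ (mul_nonneg (by linarith [h.1]) (by linarith [h.2])) ?_)
      (pow_nonneg (by linarith [h.2]) _) (pow_le_one₀ (by linarith [h.2]) (by linarith [h.1]))
    nlinarith [sq_nonneg x]
  exp_le_lik c hc c' hc' hcc k hk := by
    have hs := sqrt_pos_of_one_le hn
    have hs2 : √(n : ℝ) ^ 2 = n := Real.sq_sqrt n.cast_nonneg
    have h := ratio_mem hn hc'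
    -- Since `2 * c' ≤ c ≤ √n / 2`, the ratio lies in the range of the logarithm bounds.
    have hx : 2 * c' / √(n : ℝ) ≤ 1 / 2 := by
      rw [div_le_iff₀ hs]
      linarith [hc.2]
    rw [← scoreLik_countScore hn (by rw [abs_of_nonneg h.1]; linarith)]
    refine Real.exp_le_exp.2 ?_
    set z := countScore n k
    have l1 := le_log_one_sub_sq h.1 hx
    have l2 := le_log_ratio h.1 hx
    have hc0 : 0 ≤ c := hc.1
    have hc0' : 0 ≤ c' := hc'.1
    have hz : 0 ≤ z := by linarith
    have m1 := mul_le_mul_of_nonneg_left l1 (by positivity : 0 ≤ (n : ℝ) / 2)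
    have m2 := mul_le_mul_of_nonneg_left l2 (by positivity : 0 ≤ z * √(n : ℝ) / 2)
    have e1 : (n : ℝ) / 2 * -(4 / 3 * (2 * c' / √(n : ℝ)) ^ 2) = -(8 / 3 * c' ^ 2) := by
      rw [div_pow, hs2]
      have : (n : ℝ) ≠ 0 := by positivity
      field_simp; ring
    have e2 : z * √(n : ℝ) / 2 * (5 / 3 * (2 * c' / √(n : ℝ))) = 5 / 3 * (z * c') := by
      field_simp
    rw [e1] at m1
    rw [e2] at m2
    refine le_trans ?_ (add_le_add m1 m2)
    -- With `z ≥ 3/2 * c` and `c' ≤ c / 2` the exponent is at least `(5/2 - 4/3) * c' * c`, which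
    -- exceeds `c' * c` with little to spare.
    nlinarith [mul_nonneg hc0' (sub_nonneg.2 hk), mul_nonneg hc0' (sub_nonneg.2 hcc),
      mul_nonneg hc0' hc0]
  lik_sub_le c hc _ k := by
    have hs := sqrt_pos_of_one_le hn
    have hs2 : √(n : ℝ) ^ 2 = n := Real.sq_sqrt n.cast_nonneg
    have h := ratio_mem hn hc
    have key : ∀ k : Fin (n + 1), n ≤ 2 * (k : ℕ) → countLik n c k.rev ≤ countLik n c k ∧
        countLik n c k - countLik n c k.rev ≤
          4 * c * countScore n k * (countLik n c k + countLik n c k.rev) := by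
      intro k hk
      have hkn : (k : ℕ) ≤ n := Nat.lt_succ_iff.1 k.2
      have e : (k.rev : ℕ) = n - k := by rw [Fin.val_rev]; omega
      set x := 2 * c / √(n : ℝ) with hx
      have hA : 0 < 1 + x := by linarith [h.1]
      have hB : 0 ≤ 1 - x := by linarith [h.2]
      set m := n - (k : ℕ) with hm
      -- The surplus of high over low signals: the two likelihoods share the factor `(1 + x) ^ m *
      -- (1 - x) ^ m` and differ only in the `d`-th power.
      set d := 2 * (k : ℕ) - n with hd
      have hkmd : (k : ℕ) = m + d := by omega
      have hP : 0 ≤ (1 + x) ^ m * (1 - x) ^ m := by positivity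
      have u1 : countLik n c k = (1 + x) ^ m * (1 - x) ^ m * (1 + x) ^ d := by
        unfold countLik; rw [← hx, ← hm, hkmd, pow_add]; ring
      have u2 : countLik n c k.rev = (1 + x) ^ m * (1 - x) ^ m * (1 - x) ^ d := by
        unfold countLik
        rw [← hx, e, (by omega : n - m = m + d), pow_add]; ring
      have hdz : (d : ℝ) * (2 * x) = 4 * c * countScore n k := by
        rw [countScore_eq, hx, hd, Nat.cast_sub hk]
        push_cast
        field_simp; ring
      have hmono : (1 - x) ^ d ≤ (1 + x) ^ d := pow_le_pow_left₀ hB (by linarith [h.1]) d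
      have hbern : (1 + x) ^ d - (1 - x) ^ d ≤ d * (2 * x) * (1 + x) ^ d := by
        -- Bernoulli's inequality gives `((1 - x) / (1 + x)) ^ d ≥ 1 - d * (2 * x)`, and `d * (2 *
        -- x)` is `4 * c` times the score.
        have b1 := one_add_mul_le_pow (a := (1 - x) / (1 + x) - 1)
          (by have : 0 ≤ (1 - x) / (1 + x) := by positivity
              linarith) d
        rw [add_sub_cancel, div_pow, le_div_iff₀ (by positivity)] at b1
        have b2 : (1 - x) / (1 + x) - 1 = -(2 * x) / (1 + x) := by field_simp; ring
        have b3 : -(2 * x) ≤ -(2 * x) / (1 + x) := by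
          rw [le_div_iff₀ hA]; nlinarith [h.1, sq_nonneg x]
        have b4 : (d : ℝ) * -(2 * x) ≤ d * ((1 - x) / (1 + x) - 1) := by
          rw [b2]; exact mul_le_mul_of_nonneg_left b3 d.cast_nonneg
        have b5 := mul_le_mul_of_nonneg_right b4 (pow_nonneg hA.le d)
        nlinarith
      have hdn : 0 ≤ (d : ℝ) * (2 * x) := by have := h.1; positivity
      rw [u1, u2, ← hdz]
      refine ⟨mul_le_mul_of_nonneg_left hmono hP, ?_⟩
      have c1 := mul_le_mul_of_nonneg_left hbern hP
      have c2 : 0 ≤ (d : ℝ) * (2 * x) * ((1 + x) ^ m * (1 - x) ^ m * (1 - x) ^ d) := by positivity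
      nlinarith
    have hsgn : ∀ k : Fin (n + 1), n ≤ 2 * (k : ℕ) → 0 ≤ countScore n k := fun k hk => by
      rw [countScore_eq]
      refine div_nonneg ?_ hs.le
      have : (n : ℝ) ≤ 2 * ((k : ℕ) : ℝ) := by exact_mod_cast hk
      linarith
    rcases le_total n (2 * (k : ℕ)) with hk | hk
    · obtain ⟨h1, h2⟩ := key k hk
      rw [abs_of_nonneg (hsgn k hk), abs_of_nonneg (sub_nonneg.2 h1)]
      exact h2
    · have hk' : n ≤ 2 * (k.rev : ℕ) := by rw [Fin.val_rev]; omega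
      obtain ⟨h1, h2⟩ := key k.rev hk'
      have h3 := hsgn k.rev hk'
      rw [countScore_rev] at h2 h3
      rw [Fin.rev_rev] at h1 h2
      rw [abs_of_nonpos (by linarith : countScore n k ≤ 0), abs_of_nonpos (sub_nonpos.2 h1)]
      linarith

lemma regretAt_eq (hn : 1 ≤ n) (a : Fin (n + 1) → ℝ) (c : ℝ) :
    regretAt n a c = (finiteModel n hn).risk a c := by
  change _ = ∫ k, lossKernel (countLik n c k) (countLik n c k.rev) (a k) ∂(binomBase n)
  rw [integral_binomBase]
  refine Finset.sum_congr rfl fun k _ => ?_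
  have h2 : (2 : ℝ) ^ n ≠ 0 := by positivity
  rw [countLik_eq, countLik_rev, lossKernel, ← mul_add, mul_div_mul_left _ _ h2, prCount,
    oraclePosterior, smul_eq_mul]
  field_simp

lemma regret_eq (hn : 1 ≤ n) (a : Fin (n + 1) → ℝ) (γ : ProbabilityMeasure ℝ) :
    regret n a γ = ∫ c, (finiteModel n hn).risk a c ∂(γ : Measure ℝ) := by
  simp only [regret, regretAt_eq hn]

end

/-! ### Convergence of likelihoods, Bayes rules and regrets. -/

/-- Joint passage to the limit in the integrand and in the measure, for measures on `[0, C]` and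
continuously convergent integrands. -/
lemma tendsto_integral_of_continuous_convergence {ι : Type*} {L : Filter ι} {C : ℝ} (hC : 0 ≤ C)
    {γ : ι → ProbabilityMeasure ℝ} {γ₀ : ProbabilityMeasure ℝ} (h : Tendsto γ L (𝓝 γ₀))
    (hγ : ∀ᶠ i in L, γ i ∈ boundedStrategies C) (hγ₀ : γ₀ ∈ boundedStrategies C)
    {f : ι → ℝ → ℝ} {f₀ : ℝ → ℝ} (hf₀ : ContinuousOn f₀ (Icc 0 C))
    (hfi : ∀ᶠ i in L, Integrable (f i) (γ i : Measure ℝ))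
    (hf : ∀ c ∈ Icc 0 C,
      Tendsto (fun p : ι × ℝ => f p.1 p.2) (L ×ˢ 𝓝[Icc 0 C] c) (𝓝 (f₀ c))) :
    Tendsto (fun i => ∫ c, f i c ∂(γ i : Measure ℝ)) L (𝓝 (∫ c, f₀ c ∂(γ₀ : Measure ℝ))) := by
  have h1 := tendsto_integral_of_boundedStrategies hC h hγ hγ₀ hf₀
  suffices h2 : Tendsto (fun i => ∫ c, f i c ∂(γ i : Measure ℝ) - ∫ c, f₀ c ∂(γ i : Measure ℝ))
      L (𝓝 0) by
    simpa using h2.add h1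
  -- Compactness of `[0, C]` turns continuous convergence into uniform convergence.
  have key : ∀ ε > 0, ∀ᶠ i in L, ∀ c ∈ Icc 0 C, |f i c - f₀ c| < ε := by
    intro ε hε
    refine isCompact_Icc.induction_on (p := fun s => ∀ᶠ i in L, ∀ c ∈ s, |f i c - f₀ c| < ε)
      (by simp) (fun s t hst ht => ht.mono fun i hi c hc => hi c (hst hc))
      (fun s t hs ht => (hs.and ht).mono fun i hi c hc => hc.elim (hi.1 c) (hi.2 c)) ?_
    intro x hx
    have e1 := Metric.tendsto_nhds.1 (hf x hx) (ε / 2) (by positivity)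
    have e2 := Metric.tendsto_nhds.1 (hf₀ x hx) (ε / 2) (by positivity)
    obtain ⟨pa, ha, pb, hb, hab⟩ := eventually_prod_iff.1 (e1.and (e2.prod_inr L))
    refine ⟨{c | pb c}, hb, ha.mono fun i hi c hc => ?_⟩
    obtain ⟨u1, u2⟩ := hab hi hc
    rw [Real.dist_eq] at u1 u2
    rw [abs_lt] at *
    constructor <;> linarith [u1.1, u1.2, u2.1, u2.2]
  refine Metric.tendsto_nhds.2 fun ε hε => ?_
  obtain ⟨K, hK⟩ := isCompact_Icc.exists_bound_of_continuousOn hf₀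
  filter_upwards [key (ε / 2) (by positivity), hγ, hfi] with i hi hγi hfi
  have hf₀i : Integrable f₀ (γ i : Measure ℝ) := by
    have e : (γ i : Measure ℝ).restrict (Icc 0 C) = γ i :=
      Measure.restrict_eq_self_of_ae_mem (ae_mem_Icc hγi)
    have := (hf₀.integrableOn_Icc (μ := (γ i : Measure ℝ)))
    rwa [IntegrableOn, e] at this
  rw [Real.dist_eq, sub_zero, ← integral_sub hfi hf₀i]
  have := norm_integral_le_of_norm_le_const (μ := (γ i : Measure ℝ)) (C := ε / 2)
    (f := fun c => f i c - f₀ c) ((ae_mem_Icc hγi).mono fun c hc => (hi c hc).le)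
  simp only [Real.norm_eq_abs, probReal_univ, mul_one] at this
  linarith

section

variable {ι : Type*} {L : Filter ι} {N : ι → ℕ}

lemma tendsto_sqrt_natCast (hN : Tendsto N L atTop) :
    Tendsto (fun i => √(N i : ℝ)) L atTop :=
  Real.tendsto_sqrt_atTop.comp (tendsto_natCast_atTop_atTop.comp hN)

/-- Local asymptotic normality: with `x = 2 * c / √n`, the terms `n / 2 * log (1 - x ^ 2)` and `z *
√n / 2 * (log (1 + x) - log (1 - x))` tend to `-2 * c ^ 2` and `2 * c * z`. -/
lemma tendsto_scoreLik (hN : Tendsto N L atTop) {c z : ι → ℝ} {c₀ z₀ : ℝ}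
    (hc : Tendsto c L (𝓝 c₀)) (hz : Tendsto z L (𝓝 z₀)) :
    Tendsto (fun i => scoreLik (N i) (c i) (z i)) L (𝓝 (limitLik c₀ z₀)) := by
  have hx : Tendsto (fun i => 2 * c i / √(N i : ℝ)) L (𝓝 0) :=
    (hc.const_mul 2).div_atTop (tendsto_sqrt_natCast hN)
  have hx2 : Tendsto (fun i => (2 * c i / √(N i : ℝ)) ^ 2) L (𝓝 0) := by
    simpa using hx.pow 2
  -- Dividing by the argument with `dslope` makes the powers of `√n` cancel exactly and leaves
  -- factors that tend to the derivatives at `0`.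
  set h : ℝ → ℝ := fun y => Real.log (1 - y) with hh
  set g : ℝ → ℝ := fun x => Real.log (1 + x) - Real.log (1 - x) with hg
  have dh : HasDerivAt h (-1) 0 := by
    have := ((hasDerivAt_id (0 : ℝ)).const_sub 1).log (by simp)
    simpa using this
  have dg : HasDerivAt g 2 0 := by
    have := (((hasDerivAt_id (0 : ℝ)).const_add 1).log (by simp)).sub dh
    rw [show (2 : ℝ) = 1 / (1 + id 0) - -1 by norm_num]
    exact this
  have ch : Tendsto (dslope h 0) (𝓝 0) (𝓝 (-1)) := by
    have := (continuousAt_dslope_same.2 dh.differentiableAt).tendsto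
    rwa [dslope_same, dh.deriv] at this
  have cg : Tendsto (dslope g 0) (𝓝 0) (𝓝 2) := by
    have := (continuousAt_dslope_same.2 dg.differentiableAt).tendsto
    rwa [dslope_same, dg.deriv] at this
  have hlim : Tendsto (fun i => Real.exp (2 * c i ^ 2 * dslope h 0 ((2 * c i / √(N i : ℝ)) ^ 2) +
      z i * c i * dslope g 0 (2 * c i / √(N i : ℝ)))) L (𝓝 (limitLik c₀ z₀)) := by
    have e : limitLik c₀ z₀ = Real.exp (2 * c₀ ^ 2 * (-1) + z₀ * c₀ * 2) := by
      unfold limitLik; congr 1; ring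
    rw [e]
    exact (Real.continuous_exp.tendsto _).comp
      ((((hc.pow 2).const_mul 2).mul (ch.comp hx2)).add ((hz.mul hc).mul (cg.comp hx)))
  refine hlim.congr' ?_
  filter_upwards [hN.eventually_ge_atTop 1] with i hi
  have hs := sqrt_pos_of_one_le hi
  have hs2 : √(N i : ℝ) ^ 2 = N i := Real.sq_sqrt (N i).cast_nonneg
  have e1 := sub_smul_dslope h 0 ((2 * c i / √(N i : ℝ)) ^ 2)
  have e2 := sub_smul_dslope g 0 (2 * c i / √(N i : ℝ))
  have h0 : h 0 = 0 := by simp [hh]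
  have g0 : g 0 = 0 := by simp [hg]
  rw [h0, sub_zero, sub_zero, smul_eq_mul] at e1
  rw [g0, sub_zero, sub_zero, smul_eq_mul] at e2
  unfold scoreLik
  change _ = Real.exp ((N i : ℝ) / 2 * h ((2 * c i / √(N i : ℝ)) ^ 2) +
    z i * √(N i : ℝ) / 2 * g (2 * c i / √(N i : ℝ)))
  rw [← e1, ← e2]
  congr 2
  · rw [← mul_assoc]
    congr 1
    rw [div_pow, hs2]
    have : (N i : ℝ) ≠ 0 := by rw [← hs2]; positivity
    field_simp
  · rw [← mul_assoc]
    congr 1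
    field_simp

/-- The condition on `n` forces `x = 2 * c / √n ≤ 1/2`, where the log ratio is at most `4 * x`. The
exponent has the form of `limitLik_le` with `K = 2 * C`, so one bound dominates both likelihoods. -/
lemma scoreLik_le {n : ℕ} (hn : 1 ≤ n) {c C : ℝ} (hc : c ∈ Icc 0 C) (hC : 4 * C ≤ √(n : ℝ))
    (z : ℝ) : scoreLik n c z ≤ Real.exp (2 * (2 * C) * |z|) := by
  have hs := sqrt_pos_of_one_le hn
  set x := 2 * c / √(n : ℝ) with hx
  have hx0 : 0 ≤ x := div_nonneg (by linarith [hc.1]) hs.le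
  have hx1 : x ≤ 1 / 2 := by rw [hx, div_le_iff₀ hs]; linarith [hc.2]
  have l1 : Real.log (1 - x ^ 2) ≤ 0 := Real.log_nonpos (by nlinarith) (by nlinarith)
  have l2 := Real.log_le_sub_one_of_pos (by linarith : 0 < 1 + x)
  have l3 := Real.one_sub_inv_le_log_of_pos (by linarith : 0 < 1 - x)
  have l4 := Real.log_nonneg (by linarith : 1 ≤ 1 + x)
  have l5 := Real.log_nonpos (by linarith : 0 ≤ 1 - x) (by linarith)
  have l6 : (1 - x)⁻¹ ≤ 1 + 2 * x := by
    rw [inv_le_iff_one_le_mul₀ (by linarith)]; nlinarith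
  unfold scoreLik
  refine Real.exp_le_exp.2 ?_
  rw [← hx]
  set G := Real.log (1 + x) - Real.log (1 - x)
  have hG : G ≤ 4 * x := by simp only [G]; linarith
  have hG0 : 0 ≤ G := by simp only [G]; linarith
  have m1 : (n : ℝ) / 2 * Real.log (1 - x ^ 2) ≤ 0 :=
    mul_nonpos_of_nonneg_of_nonpos (by positivity) l1
  have m2 : z * √(n : ℝ) / 2 * G ≤ |z| * (√(n : ℝ) / 2 * (4 * x)) := by
    rw [mul_div_assoc, mul_assoc]
    refine (mul_le_mul_of_nonneg_right (le_abs_self z) (by positivity)).trans ?_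
    gcongr
  have m3 : √(n : ℝ) / 2 * (4 * x) = 4 * c := by rw [hx]; field_simp
  rw [m3] at m2
  have := mul_le_mul_of_nonneg_left hc.2 (abs_nonneg z)
  linarith

lemma measurable_scoreLik (n : ℕ) : Measurable fun p : ℝ × ℝ => scoreLik n p.1 p.2 := by
  unfold scoreLik; fun_prop

/-- The marginal likelihood of a real score. -/
def scoreMarg (n : ℕ) (ν : ProbabilityMeasure ℝ) (z : ℝ) : ℝ :=
  ∫ c, scoreLik n c z ∂(ν : Measure ℝ)

/-- The Bayes rule as a function of a real score. -/
def scoreBayes (n : ℕ) (ν : ProbabilityMeasure ℝ) (z : ℝ) : ℝ :=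
  posterior (scoreMarg n ν z) (scoreMarg n ν (-z))

lemma scoreMarg_nonneg (n : ℕ) (ν : ProbabilityMeasure ℝ) (z : ℝ) : 0 ≤ scoreMarg n ν z :=
  integral_nonneg fun _ => (Real.exp_pos _).le

lemma scoreBayes_mem (n : ℕ) (ν : ProbabilityMeasure ℝ) (z : ℝ) :
    scoreBayes n ν z ∈ Icc (0 : ℝ) 1 :=
  posterior_mem (scoreMarg_nonneg n ν z) (scoreMarg_nonneg n ν (-z))

lemma measurable_scoreMarg (n : ℕ) (ν : ProbabilityMeasure ℝ) : Measurable (scoreMarg n ν) := by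
  have : StronglyMeasurable fun p : ℝ × ℝ => scoreLik n p.2 p.1 :=
    ((measurable_scoreLik n).comp measurable_swap).stronglyMeasurable
  exact this.integral_prod_right'.measurable

lemma measurable_scoreBayes (n : ℕ) (ν : ProbabilityMeasure ℝ) : Measurable (scoreBayes n ν) :=
  measurable_posterior (measurable_scoreMarg n ν) ((measurable_scoreMarg n ν).comp measurable_neg)

/-- The Bayes rule of the finite game. -/
def finiteBayes (n : ℕ) (ν : ProbabilityMeasure ℝ) (k : Fin (n + 1)) : ℝ :=
  posterior (∫ c, countLik n c k ∂(ν : Measure ℝ)) (∫ c, countLik n c k.rev ∂(ν : Measure ℝ))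

lemma abs_ratio_lt_one {n : ℕ} (hn : 1 ≤ n) {c C : ℝ} (hc : c ∈ Icc 0 C)
    (hC : 4 * C ≤ √(n : ℝ)) : |2 * c / √(n : ℝ)| < 1 := by
  have hs := sqrt_pos_of_one_le hn
  rw [abs_of_nonneg (div_nonneg (by linarith [hc.1]) hs.le), div_lt_one hs]
  linarith [hc.2]

lemma finiteBayes_eq_scoreBayes {n : ℕ} (hn : 1 ≤ n) {C : ℝ} (hC : 4 * C ≤ √(n : ℝ))
    {ν : ProbabilityMeasure ℝ} (hν : ν ∈ boundedStrategies C) (k : Fin (n + 1)) :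
    finiteBayes n ν k = scoreBayes n ν (countScore n k) := by
  have h : ∀ k, ∫ c, countLik n c k ∂(ν : Measure ℝ) = scoreMarg n ν (countScore n k) := fun k =>
    integral_congr_ae ((ae_mem_Icc hν).mono fun c hc =>
      (scoreLik_countScore hn (abs_ratio_lt_one hn hc hC) k).symm)
  rw [finiteBayes, scoreBayes, h, h, countScore_rev]

lemma regretAt_eq_integral {n : ℕ} (hn : 1 ≤ n) {c C : ℝ} (hc : c ∈ Icc 0 C)
    (hC : 4 * C ≤ √(n : ℝ)) {b : ℝ → ℝ} (hb : Measurable b) :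
    regretAt n (fun k => b (countScore n k)) c =
      ∫ z, lossKernel (scoreLik n c z) (scoreLik n c (-z)) (b z) ∂(countLaw n : Measure ℝ) := by
  have hm : Measurable fun z => scoreLik n c z := (measurable_scoreLik n).of_uncurry_left
  have hl : Measurable fun z => lossKernel (scoreLik n c z) (scoreLik n c (-z)) (b z) :=
    Measurable.lossKernel hm (hm.comp measurable_neg) hb
  rw [regretAt_eq hn, integral_countLaw n hl.stronglyMeasurable]
  refine integral_congr_ae (ae_of_all _ fun k => ?_)
  have hx := abs_ratio_lt_one hn hc hC
  beta_reduce
  rw [← countScore_rev, scoreLik_countScore hn hx, scoreLik_countScore hn hx]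
  rfl

variable {C : ℝ} {γ : ι → ProbabilityMeasure ℝ} {γ₀ : ProbabilityMeasure ℝ}

lemma eventually_le_sqrt (hN : Tendsto N L atTop) (K : ℝ) :
    ∀ᶠ i in L, 1 ≤ N i ∧ K ≤ √(N i : ℝ) :=
  (hN.eventually_ge_atTop 1).and ((tendsto_sqrt_natCast hN).eventually_ge_atTop K)

lemma tendsto_scoreMarg (hC : 0 ≤ C) (hN : Tendsto N L atTop) (h : Tendsto γ L (𝓝 γ₀))
    (hγ : ∀ᶠ i in L, γ i ∈ boundedStrategies C) (hγ₀ : γ₀ ∈ boundedStrategies C)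
    {z : ι → ℝ} {z₀ : ℝ} (hz : Tendsto z L (𝓝 z₀)) :
    Tendsto (fun i => scoreMarg (N i) (γ i) (z i)) L (𝓝 (limitModel.marg γ₀ z₀)) := by
  refine tendsto_integral_of_continuous_convergence hC h hγ hγ₀
    (f := fun i c => scoreLik (N i) c (z i)) (f₀ := fun c => limitLik c z₀)
    (continuous_limitLik.comp (by fun_prop : Continuous fun c : ℝ => (c, z₀))).continuousOn ?_ ?_
  · filter_upwards [hγ, eventually_le_sqrt hN (4 * C)] with i hi ⟨h1, h2⟩
    refine Integrable.of_bound (measurable_scoreLik (N i)).of_uncurry_right.aestronglyMeasurable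
      (Real.exp (2 * (2 * C) * |z i|)) ((ae_mem_Icc hi).mono fun c hc => ?_)
    rw [Real.norm_of_nonneg (by exact (Real.exp_pos _).le)]
    exact scoreLik_le h1 hc h2 _
  · exact fun c _ => tendsto_scoreLik (hN.comp tendsto_fst)
      (tendsto_snd.mono_right nhdsWithin_le_nhds) (hz.comp tendsto_fst)

lemma tendsto_scoreBayes (hC : 0 ≤ C) (hN : Tendsto N L atTop) (h : Tendsto γ L (𝓝 γ₀))
    (hγ : ∀ᶠ i in L, γ i ∈ boundedStrategies C) (hγ₀ : γ₀ ∈ boundedStrategies C)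
    {z : ι → ℝ} {z₀ : ℝ} (hz : Tendsto z L (𝓝 z₀)) :
    Tendsto (fun i => scoreBayes (N i) (γ i) (z i)) L (𝓝 (limitModel.bayes γ₀ z₀)) := by
  have hu := tendsto_scoreMarg hC hN h hγ hγ₀ hz
  have hw := tendsto_scoreMarg hC hN h hγ hγ₀ hz.neg
  have hp := ae_mem_params hγ₀
  have h0 : limitModel.marg γ₀ z₀ + limitModel.marg γ₀ (-z₀) ≠ 0 :=
    (add_pos (limitMarg_pos hp _) (limitMarg_pos hp _)).ne'
  exact (((hu.sub hw).div (hu.add hw) h0).const_add 1).const_mul (1 / 2)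

/-- The sample size, the strategy and the parameter vary together along an arbitrary filter. Used on
`L ×ˢ 𝓝[Icc 0 C] c`, this yields the continuous convergence needed to integrate against converging
strategies. -/
lemma tendsto_regretAt (hC : 0 ≤ C) (hN : Tendsto N L atTop) (h : Tendsto γ L (𝓝 γ₀))
    (hγ : ∀ᶠ i in L, γ i ∈ boundedStrategies C) (hγ₀ : γ₀ ∈ boundedStrategies C)
    {c : ι → ℝ} {c₀ : ℝ} (hc : Tendsto c L (𝓝 c₀)) (hcC : ∀ᶠ i in L, c i ∈ Icc 0 C)
    (hc₀ : c₀ ∈ Icc 0 C) :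
    Tendsto (fun i => regretAt (N i) (finiteBayes (N i) (γ i)) (c i)) L
      (𝓝 (limitModel.risk (limitModel.bayes γ₀) c₀)) := by
  have hp := ae_mem_params hγ₀
  have hev := eventually_le_sqrt hN (4 * C)
  have hpos : ∀ z, limitLik c₀ z + limitLik c₀ (-z) ≠ 0 := fun z =>
    (add_pos (limitLik_pos _ _) (limitLik_pos _ _)).ne'
  have hlik : ∀ z₀ : ℝ, Tendsto (fun z => limitLik c₀ z) (𝓝 z₀) (𝓝 (limitLik c₀ z₀)) := fun z₀ =>
    (continuous_limitLik.comp (by fun_prop : Continuous fun z : ℝ => (c₀, z))).tendsto z₀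
  have key := tendsto_integral_countLaw (L := L) (N := N) (K := 1) (s := 2 * (2 * C)) hN
    (g := fun i z => lossKernel (scoreLik (N i) (c i) z) (scoreLik (N i) (c i) (-z))
      (scoreBayes (N i) (γ i) z))
    (g₀ := fun z => lossKernel (limitLik c₀ z) (limitLik c₀ (-z)) (limitModel.bayes γ₀ z))
    (Eventually.of_forall fun i => ?_) ?_ ?_ zero_le_one ?_ ?_
  · refine key.congr' ?_
    filter_upwards [hγ, hcC, hev] with i h1 h2 ⟨h3, h4⟩
    rw [← regretAt_eq_integral h3 h2 h4 (measurable_scoreBayes _ _)]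
    congr 1
    exact funext fun k => (finiteBayes_eq_scoreBayes h3 h4 h1 k).symm
  · have hm : Measurable fun z => scoreLik (N i) (c i) z :=
      (measurable_scoreLik (N i)).of_uncurry_left
    exact Measurable.lossKernel hm (hm.comp measurable_neg) (measurable_scoreBayes _ _)
  · refine continuous_iff_continuousAt.2 fun z => tendsto_lossKernel (hlik z) ?_
      (continuous_limitBayes hγ₀).continuousAt (hpos z)
    exact (hlik (-z)).comp (continuous_neg.tendsto z)
  · intro z
    have hN' := hN.comp (tendsto_fst (f := L) (g := 𝓝 z))
    have hc' := hc.comp (tendsto_fst (f := L) (g := 𝓝 z))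
    exact tendsto_lossKernel (tendsto_scoreLik hN' hc' tendsto_snd)
      (tendsto_scoreLik hN' hc' tendsto_snd.neg)
      (tendsto_scoreBayes hC hN' (h.comp tendsto_fst) (hγ.prod_inl _) hγ₀ tendsto_snd) (hpos z)
  · filter_upwards [hcC, hev] with i h2 ⟨h3, h4⟩ z
    have p1 : 0 ≤ scoreLik (N i) (c i) z := (Real.exp_pos _).le
    have p2 : 0 ≤ scoreLik (N i) (c i) (-z) := (Real.exp_pos _).le
    have q1 := scoreLik_le h3 h2 h4 z
    have q2 := scoreLik_le h3 h2 h4 (-z)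
    rw [abs_neg] at q2
    rw [abs_of_nonneg (lossKernel_nonneg p1 p2 _)]
    have := lossKernel_le_half p1 p2 (scoreBayes_mem (N i) (γ i) z)
    linarith
  · intro z
    have := lossKernel_limitLik_le (c := c₀) (K := 2 * C)
      (by rw [abs_of_nonneg hc₀.1]; linarith [hc₀.2]) (limitModel.bayes_mem hp z) z
    rw [Real.norm_eq_abs] at this
    linarith

end

/-! ### Equilibria of the finite games. -/

section

variable {n : ℕ} {b : Fin (n + 1) → ℝ} {ν : ProbabilityMeasure ℝ}

lemma mem_natureStrategies_iff {n : ℕ} {ν : ProbabilityMeasure ℝ} :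
    ν ∈ natureStrategies n ↔ ∀ᵐ c ∂(ν : Measure ℝ), c ∈ Icc 0 (√(n : ℝ) / 2) :=
  ae_mem_of_measure_eq_one measurableSet_Icc

lemma choose_div_pos (k : Fin (n + 1)) : 0 < (n.choose k : ℝ) / 2 ^ n :=
  div_pos (Nat.cast_pos.2 (Nat.choose_pos (Nat.lt_succ_iff.1 k.2))) (by positivity)

lemma eq_zero_of_integral_binomBase_le {f : Fin (n + 1) → ℝ} (hf : ∀ k, 0 ≤ f k)
    (h : ∫ k, f k ∂(binomBase n) ≤ 0) (k : Fin (n + 1)) : f k = 0 := by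
  rw [integral_binomBase] at h
  have hnn : ∀ k ∈ (Finset.univ : Finset (Fin (n + 1))), 0 ≤ ((n.choose k : ℝ) / 2 ^ n) • f k := fun k _ =>
    mul_nonneg (choose_div_pos k).le (hf k)
  have h0 := (Finset.sum_eq_zero_iff_of_nonneg hnn).1 (le_antisymm h (Finset.sum_nonneg hnn)) k
    (Finset.mem_univ k)
  exact (mul_eq_zero.1 h0).resolve_left (choose_div_pos k).ne'

lemma regret_bayes_le (hn : 1 ≤ n) (hb : ∀ k, b k ∈ Icc (0 : ℝ) 1) (hν : ν ∈ natureStrategies n) :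
    regret n (finiteBayes n ν) ν ≤ regret n b ν := by
  have hν' := mem_natureStrategies_iff.1 hν
  rw [regret_eq hn, regret_eq hn,
    (finiteModel n hn).average_risk_eq (measurable_of_finite b) hb hν']
  refine le_add_of_nonneg_right (integral_nonneg fun k => ?_)
  have h1 := (finiteModel n hn).marg_nonneg hν' k
  have h2 := (finiteModel n hn).marg_nonneg hν' ((finiteModel n hn).flip k)
  simp only [Pi.zero_apply]
  positivity

lemma finiteBayes_mem (hn : 1 ≤ n) (hν : ν ∈ natureStrategies n) (k : Fin (n + 1)) :
    finiteBayes n ν k ∈ Icc (0 : ℝ) 1 :=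
  (finiteModel n hn).bayes_mem (mem_natureStrategies_iff.1 hν) k

/-- The total marginal likelihood of a signal count vanishes only if Nature almost surely reveals
the state. -/
lemma finiteMarg_pos (hn : 1 ≤ n) (hν : ν ∈ natureStrategies n)
    (h : ¬ ∀ᵐ c ∂(ν : Measure ℝ), c = √(n : ℝ) / 2) (k : Fin (n + 1)) :
    0 < ∫ c, countLik n c k ∂(ν : Measure ℝ) := by
  have hν' := mem_natureStrategies_iff.1 hν
  have hs := sqrt_pos_of_one_le hn
  have hnn := (finiteModel n hn).marg_nonneg hν' k
  refine lt_of_le_of_ne hnn fun h0 => h ?_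
  have h1 := (integral_eq_zero_iff_of_nonneg_ae
    (hν'.mono fun c hc => countLik_nonneg hn hc k)
    ((finiteModel n hn).lik_integrable_left hν' k)).1 h0.symm
  filter_upwards [h1, hν'] with c hc hc'
  by_contra hne
  have hlt : 2 * c / √(n : ℝ) < 1 := by
    rw [div_lt_one hs]
    have := lt_of_le_of_ne hc'.2 hne
    linarith
  have h2 := ratio_mem hn hc'
  have : 0 < countLik n c k := mul_pos (pow_pos (by linarith [h2.1]) _) (pow_pos (by linarith) _)
  exact this.ne' hc

/-- The belief rule that is optimal against fully informative signals. -/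
def revealingRule (n : ℕ) (k : Fin (n + 1)) : ℝ := if k = Fin.last n then 1 else 0

lemma lossKernel_revealingRule (hn : 1 ≤ n) (k : Fin (n + 1)) :
    lossKernel (countLik n (√(n : ℝ) / 2) k) (countLik n (√(n : ℝ) / 2) k.rev)
      (revealingRule n k) = 0 := by
  have hs := sqrt_pos_of_one_le hn
  have hr : 2 * (√(n : ℝ) / 2) / √(n : ℝ) = 1 := by field_simp
  have hlik : ∀ k : Fin (n + 1), k ≠ Fin.last n → countLik n (√(n : ℝ) / 2) k = 0 := by
    intro k hk
    have : n - (k : ℕ) ≠ 0 := by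
      have := Fin.val_lt_last hk
      omega
    rw [countLik, hr, sub_self, zero_pow this, mul_zero]
  by_cases hk : k = Fin.last n
  · have hrev : k.rev ≠ Fin.last n := by
      rw [hk, Fin.rev_last]
      exact fun h => by have := congrArg Fin.val h; simp at this; omega
    have hpos : countLik n (√(n : ℝ) / 2) k ≠ 0 := by
      rw [countLik, hr, hk]; simp
    rw [hlik _ hrev, revealingRule, if_pos hk, lossKernel]
    simp [div_self hpos]
  · rw [hlik k hk, revealingRule, if_neg hk, lossKernel]
    simp

lemma IsFiniteNash.regretAt_le (h : IsFiniteNash n b ν) {c : ℝ} (hc : c ∈ Icc 0 (√(n : ℝ) / 2)) :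
    regretAt n b c ≤ regret n b ν := by
  have := h.nature_best (pointMass c) (mem_natureStrategies_iff.2 (ae_pointMass hc))
  rwa [regret, integral_pointMass] at this

/-- If Nature always revealed the state, the revealing rule would bring the value down to `0`, and
no parameter could have positive regret against `b`. But `c = 0` requires `b = 1/2` after `n` high
signals, while full revelation requires `1`. -/
lemma IsFiniteNash.not_ae_eq (h : IsFiniteNash n b ν) (hn : 1 ≤ n) : ¬ ∀ᵐ c ∂(ν : Measure ℝ), c = √(n : ℝ) / 2 := by
  intro hc
  have hs := sqrt_pos_of_one_le hn
  have hmem : √(n : ℝ) / 2 ∈ Icc 0 (√(n : ℝ) / 2) := ⟨by positivity, le_rfl⟩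
  have h0 : (0 : ℝ) ∈ Icc 0 (√(n : ℝ) / 2) := ⟨le_rfl, by positivity⟩
  have hv : regret n b ν ≤ 0 := by
    refine (h.dm_best (revealingRule n) fun k => ?_).trans_eq (integral_eq_zero_of_ae ?_)
    · unfold revealingRule; split_ifs <;> norm_num
    · filter_upwards [hc] with c hc
      rw [hc, regretAt_eq hn]
      exact integral_eq_zero_of_ae (ae_of_all _ (lossKernel_revealingRule hn))
  have hz : ∀ c ∈ Icc 0 (√(n : ℝ) / 2), ∀ k,
      lossKernel (countLik n c k) (countLik n c k.rev) (b k) = 0 := by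
    intro c hc
    refine eq_zero_of_integral_binomBase_le
      (fun k => lossKernel_nonneg (countLik_nonneg hn hc k) (countLik_nonneg hn hc _) _) ?_
    have := h.regretAt_le hc
    rw [regretAt_eq hn] at this
    exact this.trans hv
  have e1 := hz 0 h0 (Fin.last n)
  have e2 := hz _ hmem (Fin.last n)
  have e3 := lossKernel_revealingRule hn (Fin.last n)
  have hr : 2 * (√(n : ℝ) / 2) / √(n : ℝ) = 1 := by field_simp
  have hA : countLik n (√(n : ℝ) / 2) (Fin.last n) = 2 ^ n := by
    rw [countLik, hr]; norm_num
  have hB : countLik n (√(n : ℝ) / 2) (Fin.last n).rev = 0 := by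
    rw [countLik, hr]; simp; omega
  have hb : b (Fin.last n) = 1 / 2 := by
    simp [countLik, lossKernel, sub_eq_zero] at e1
    linarith
  rw [hA, hB, hb, lossKernel, add_zero, div_self (by positivity)] at e2
  have : (0 : ℝ) < 2 ^ n := by positivity
  linarith

/-- Every count has positive marginal probability by `not_ae_eq`, so the excess regret vanishes only
at the Bayes rule. -/
lemma IsFiniteNash.eq_bayes (h : IsFiniteNash n b ν) (hn : 1 ≤ n) : b = finiteBayes n ν := by
  have hν' := mem_natureStrategies_iff.1 h.nature_mem
  have h1 := h.dm_best _ (finiteBayes_mem hn h.nature_mem)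
  rw [regret_eq hn, regret_eq hn,
    (finiteModel n hn).average_risk_eq (measurable_of_finite b) h.dm_mem hν'] at h1
  have h2 := eq_zero_of_integral_binomBase_le (fun k => ?_) (nonpos_of_add_le_right h1)
  · funext k
    have hp := finiteMarg_pos hn h.nature_mem (h.not_ae_eq hn)
    have hk := (mul_eq_zero.1 (h2 k)).resolve_left
      (mul_pos (by norm_num) (add_pos (hp k) (hp k.rev))).ne'
    exact sub_eq_zero.1 (pow_eq_zero_iff two_ne_zero |>.1 hk)
  · have h1 := (finiteModel n hn).marg_nonneg hν' k
    have h2 := (finiteModel n hn).marg_nonneg hν' ((finiteModel n hn).flip k)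
    positivity

/-- Turning `d` low signals into high ones replaces `(1 - x) ^ d` by `(1 + x) ^ d`. The marginal in
state `1` thus increases with the count and the reversed one decreases. -/
lemma IsFiniteNash.monotone (h : IsFiniteNash n b ν) (hn : 1 ≤ n) : Monotone b := by
  have hν' := mem_natureStrategies_iff.1 h.nature_mem
  have hp := finiteMarg_pos hn h.nature_mem (h.not_ae_eq hn)
  have hmono : ∀ k l : Fin (n + 1), k ≤ l →
      ∫ c, countLik n c k ∂(ν : Measure ℝ) ≤ ∫ c, countLik n c l ∂(ν : Measure ℝ) := by
    intro k l hkl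
    refine integral_mono_ae ((finiteModel n hn).lik_integrable_left hν' k)
      ((finiteModel n hn).lik_integrable_left hν' l) ?_
    filter_upwards [hν'] with c hc
    have hx := ratio_mem hn hc
    obtain ⟨d, hd⟩ := Nat.exists_eq_add_of_le (Fin.le_def.1 hkl)
    have hl : (l : ℕ) ≤ n := Nat.lt_succ_iff.1 l.2
    have e : n - (k : ℕ) = (n - l) + d := by omega
    change (1 + 2 * c / √(n : ℝ)) ^ (k : ℕ) * (1 - 2 * c / √(n : ℝ)) ^ (n - (k : ℕ)) ≤
      (1 + 2 * c / √(n : ℝ)) ^ (l : ℕ) * (1 - 2 * c / √(n : ℝ)) ^ (n - (l : ℕ))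
    have p1 : 0 ≤ 1 - 2 * c / √(n : ℝ) := by linarith [hx.2]
    have p2 : 0 ≤ 1 + 2 * c / √(n : ℝ) := by linarith [hx.1]
    rw [e, hd, pow_add, pow_add]
    have := mul_le_mul_of_nonneg_left
      (pow_le_pow_left₀ p1 (by linarith [hx.1] : 1 - 2 * c / √(n : ℝ) ≤ 1 + 2 * c / √(n : ℝ)) d)
      (mul_nonneg (pow_nonneg p2 (k : ℕ)) (pow_nonneg p1 (n - ((k : ℕ) + d))))
    linarith
  intro k l hkl
  rw [h.eq_bayes hn, finiteBayes, finiteBayes, posterior_eq (add_pos (hp _) (hp _)).ne',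
    posterior_eq (add_pos (hp _) (hp _)).ne', div_le_div_iff₀ (add_pos (hp _) (hp _))
    (add_pos (hp _) (hp _))]
  have m1 := mul_le_mul (hmono k l hkl) (hmono l.rev k.rev (Fin.rev_le_rev.2 hkl)) (hp _).le
    (hp _).le
  linarith

/-- Complementary slackness: the regret never exceeds its average under `ν`, so it equals the
average almost surely. -/
lemma IsFiniteNash.ae_le_regretAt (h : IsFiniteNash n b ν) (hn : 1 ≤ n) :
    ∀ᵐ c ∂(ν : Measure ℝ), regret n b ν ≤ regretAt n b c := by
  have hν' := mem_natureStrategies_iff.1 h.nature_mem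
  have hi : Integrable (regretAt n b) (ν : Measure ℝ) := by
    have := (finiteModel n hn).risk_integrable (measurable_of_finite b) h.dm_mem hν'
    exact this.congr (ae_of_all _ fun c => (regretAt_eq hn b c).symm)
  have hnn : 0 ≤ᵐ[(ν : Measure ℝ)] fun c => regret n b ν - regretAt n b c := by
    filter_upwards [hν'] with c hc using sub_nonneg.2 (h.regretAt_le hc)
  have h0 := (integral_eq_zero_iff_of_nonneg_ae hnn ((integrable_const _).sub hi)).1 (by
    rw [integral_sub (integrable_const _) hi]
    simp [regret])
  filter_upwards [h0] with c hc
  exact (sub_eq_zero.1 hc).le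

end

/-! ### A common support bound for all finite equilibria. -/

/-- A lower bound on the values of the finite games. -/
lemma exists_regret_lower_bound : ∃ (v : ℝ) (n₀ : ℕ), 0 < v ∧ ∀ n, 1 ≤ n → n₀ ≤ n →
    ∀ (b : Fin (n + 1) → ℝ) (ν : ProbabilityMeasure ℝ), IsFiniteNash n b ν →
      v ≤ regret n b ν := by
  have hmem := referenceStrategy_mem le_rfl
  have ht : ∀ c ∈ Icc (0 : ℝ) 1, Tendsto
      (fun n => regretAt n (finiteBayes n referenceStrategy) c) atTop
      (𝓝 (limitModel.risk (limitModel.bayes referenceStrategy) c)) := fun c hc =>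
    tendsto_regretAt (C := 1) zero_le_one tendsto_id tendsto_const_nhds
      (Eventually.of_forall fun _ => hmem) hmem tendsto_const_nhds (Eventually.of_forall fun _ => hc)
      hc
  have ht' : Tendsto (fun n => regret n (finiteBayes n referenceStrategy) referenceStrategy) atTop
      (𝓝 (limitValue referenceStrategy)) := by
    simp only [regret, limitValue, integral_referenceStrategy]
    exact ((ht 0 (by norm_num)).const_mul _).add ((ht 1 (by norm_num)).const_mul _)
  have hv := limitValue_referenceStrategy_pos
  obtain ⟨n₁, hn₁⟩ := eventually_atTop.1 (ht'.eventually (lt_mem_nhds (half_lt_self hv)))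
  -- For `n ≥ 4` the parameter `1` is at most `√n / 2`, so the reference strategy is available to
  -- Nature.
  refine ⟨limitValue referenceStrategy / 2, max n₁ 4, half_pos hv, fun n hn hn₀ b ν h => ?_⟩
  have h4 : (4 : ℝ) ≤ n := by exact_mod_cast (le_max_right _ _).trans hn₀
  have hs : 2 ≤ √(n : ℝ) := Real.le_sqrt_of_sq_le (by linarith)
  have href : referenceStrategy ∈ natureStrategies n :=
    mem_natureStrategies_iff.2 (ae_referenceStrategy ⟨le_rfl, by linarith⟩ ⟨by norm_num, by linarith⟩)
  exact (hn₁ n ((le_max_left _ _).trans hn₀)).le.trans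
    ((regret_bayes_le hn h.dm_mem href).trans (h.nature_best _ href))

/-- For large `n` the values are bounded below and `exists_risk_lt` supplies a constant independent
of the experiment. The remaining finitely many games are covered by `√n / 2 ≤ √n₀ / 2`. -/
lemma exists_common_bound : ∃ C : ℝ, 0 < C ∧ ∀ n, 1 ≤ n →
    ∀ (b : Fin (n + 1) → ℝ) (ν : ProbabilityMeasure ℝ), IsFiniteNash n b ν →
      ν ∈ boundedStrategies C := by
  obtain ⟨v, n₀, hv, hlow⟩ := exists_regret_lower_bound
  obtain ⟨C, hC, hrisk⟩ := SignalModel.exists_risk_lt hv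
  refine ⟨max C (√(n₀ : ℝ) / 2), lt_max_of_lt_left hC, fun n hn b ν h => ?_⟩
  have hν' := mem_natureStrategies_iff.1 h.nature_mem
  refine (ae_mem_of_measure_eq_one measurableSet_Icc).2 ?_
  rcases le_total n₀ n with h0 | h0
  · have hle : ∀ᵐ c ∂(ν : Measure ℝ), v ≤ (finiteModel n hn).risk ((finiteModel n hn).bayes ν) c := by
      filter_upwards [h.ae_le_regretAt hn] with c hc
      have := (hlow n hn h0 b ν h).trans hc
      rw [regretAt_eq hn, h.eq_bayes hn] at this
      exact this
    filter_upwards [hν', hle] with c hc hc'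
    refine ⟨hc.1, le_max_of_le_left ?_⟩
    by_contra hlt
    exact absurd (hrisk _ (finiteModel n hn) ν hν' hle c hc (not_le.1 hlt).le) (not_lt.2 hc')
  · filter_upwards [hν'] with c hc
    refine ⟨hc.1, le_max_of_le_right (hc.2.trans ?_)⟩
    gcongr

lemma boundedStrategies_mono {C C' : ℝ} (h : C ≤ C') :
    boundedStrategies C ⊆ boundedStrategies C' := fun _ hγ =>
  (ae_mem_of_measure_eq_one measurableSet_Icc).2
    ((ae_mem_Icc hγ).mono fun _ hc => ⟨hc.1, hc.2.trans h⟩)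

/-! ### Convergence of Nature's equilibrium strategies. -/

section

variable {b : (n : ℕ) → Fin (n + 1) → ℝ} {ν : ℕ → ProbabilityMeasure ℝ} {C : ℝ}

/-- Limit points of Nature's equilibrium strategies are equilibrium strategies of the limit
game. -/
lemma isLimitNash_of_tendsto (hC : 0 ≤ C) (h : ∀ n, 1 ≤ n → IsFiniteNash n (b n) (ν n))
    (hνC : ∀ n, 1 ≤ n → ν n ∈ boundedStrategies C) {L : Filter ℕ} [L.NeBot] (hL : L ≤ atTop)
    {γ : ProbabilityMeasure ℝ} (hγ : γ ∈ boundedStrategies C) (ht : Tendsto ν L (𝓝 γ)) :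
    IsLimitNash (limitModel.bayes γ) γ := by
  have hN : Tendsto (fun n : ℕ => n) L atTop := tendsto_id'.2 hL
  have hev : ∀ᶠ n in L, 1 ≤ n := hN.eventually_ge_atTop 1
  have hνL : ∀ᶠ n in L, ν n ∈ boundedStrategies C := hev.mono hνC
  have hval : Tendsto (fun n => regret n (b n) (ν n)) L (𝓝 (limitValue γ)) := by
    have key : Tendsto
        (fun n => ∫ c, regretAt n (finiteBayes n (ν n)) c ∂(ν n : Measure ℝ)) L
        (𝓝 (limitValue γ)) := by
      refine tendsto_integral_of_continuous_convergence hC ht hνL hγ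
        (f := fun n => regretAt n (finiteBayes n (ν n)))
        (continuous_limitRisk limitModel.bayes_meas
          (limitModel.bayes_mem (ae_mem_params hγ))).continuousOn ?_ ?_
      · filter_upwards [hev] with n hn
        have hm := (h n hn).nature_mem
        exact ((finiteModel n hn).risk_integrable (measurable_of_finite _) (finiteBayes_mem hn hm)
          (mem_natureStrategies_iff.1 hm)).congr (ae_of_all _ fun c => (regretAt_eq hn _ c).symm)
      · exact fun c hc => tendsto_regretAt hC (hN.comp tendsto_fst) (ht.comp tendsto_fst)
          (hνL.prod_inl _) hγ (tendsto_snd.mono_right nhdsWithin_le_nhds)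
          (eventually_mem_nhdsWithin.prod_inr L) hc
    refine key.congr' ?_
    filter_upwards [hev] with n hn
    rw [regret, ← (h n hn).eq_bayes hn]
  refine isLimitNash_bayes hγ fun c hc => ?_
  -- Deviations outside `[0, C]` have to be excluded as well, so the window is enlarged to contain
  -- `c`.
  have hle : C ≤ max C c := le_max_left _ _
  have hc' : c ∈ Icc 0 (max C c) := ⟨hc, le_max_right _ _⟩
  have hrisk := tendsto_regretAt (hC.trans hle) hN ht
    (hνL.mono fun _ hn => boundedStrategies_mono hle hn) (boundedStrategies_mono hle hγ)
    (tendsto_const_nhds (x := c)) (Eventually.of_forall fun _ => hc') hc'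
  refine le_of_tendsto_of_tendsto hrisk hval ?_
  -- Eventually `c ≤ √n / 2`, so `c` is an admissible deviation in the finite game.
  filter_upwards [eventually_le_sqrt hN (2 * c)] with n ⟨hn, hn'⟩
  rw [← (h n hn).eq_bayes hn]
  exact (h n hn).regretAt_le ⟨hc, by linarith⟩

/-- In a compact set, a sequence with only one cluster point converges to it. -/
lemma tendsto_natureStrategy (hC : 0 ≤ C) (h : ∀ n, 1 ≤ n → IsFiniteNash n (b n) (ν n))
    (hνC : ∀ n, 1 ≤ n → ν n ∈ boundedStrategies C) {γ : ProbabilityMeasure ℝ}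
    (huniq : ∀ (a' : ℝ → ℝ) (γ' : ProbabilityMeasure ℝ), IsLimitNash a' γ' → γ' = γ) :
    Tendsto ν atTop (𝓝 γ) := by
  refine (isCompact_boundedStrategies C).tendsto_nhds_of_unique_mapClusterPt
    ((eventually_ge_atTop 1).mono hνC) fun δ hδ hcl => ?_
  obtain ⟨U, hU, hUδ⟩ := mapClusterPt_iff_ultrafilter.1 hcl
  exact huniq _ δ (isLimitNash_of_tendsto hC h hνC hU hδ hUδ)

end

/-! The embedding into the common space -/

lemma monotone_stdCDF : Monotone stdCDF := monotone_cdf _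

lemma stdCDF_mem (z : ℝ) : stdCDF z ∈ Icc (0 : ℝ) 1 := ⟨cdf_nonneg _ z, cdf_le_one _ z⟩

lemma strictMono_stdCDF : StrictMono stdCDF := by
  refine fun x y hlt => lt_of_le_of_ne (monotone_stdCDF hlt.le) fun hxy => ?_
  have h1 : (gaussianReal 0 1) (Ioc x y) = 0 := by
    unfold stdCDF at hxy
    rw [← measure_cdf (gaussianReal 0 1), StieltjesFunction.measure_Ioc, hxy, sub_self,
      ENNReal.ofReal_zero]
  have h2 := gaussianReal_absolutelyContinuous' 0 (v := 1) one_ne_zero h1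
  rw [Real.volume_Ioc, ENNReal.ofReal_eq_zero] at h2
  linarith

section

variable {y : ℝ}

lemma quantileSet_nonempty (hy : y < 1) : {z : ℝ | y ≤ stdCDF z}.Nonempty := by
  have h := (tendsto_cdf_atTop (gaussianReal 0 1)).eventually (lt_mem_nhds hy)
  obtain ⟨z, hz⟩ := h.exists
  exact ⟨z, hz.le⟩

lemma quantileSet_bddBelow (hy : 0 < y) : BddBelow {z : ℝ | y ≤ stdCDF z} := by
  have h := (tendsto_cdf_atBot (gaussianReal 0 1)).eventually (gt_mem_nhds hy)
  obtain ⟨z, hz⟩ := h.exists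
  refine ⟨z, fun w hw => ?_⟩
  by_contra hlt
  exact absurd (lt_of_le_of_lt (hw.trans (monotone_stdCDF (not_le.1 hlt).le)) hz) (lt_irrefl _)

lemma stdCDF_lt_of_lt_stdQuantile (hy : 0 < y) {z : ℝ} (hz : z < stdQuantile y) :
    stdCDF z < y :=
  not_le.1 fun h => notMem_of_lt_csInf hz (quantileSet_bddBelow hy) h

lemma le_stdCDF_of_stdQuantile_lt (hy : y < 1) {z : ℝ} (hz : stdQuantile y < z) :
    y ≤ stdCDF z := by
  obtain ⟨w, hw, hwz⟩ := exists_lt_of_csInf_lt (quantileSet_nonempty hy) hz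
  exact le_trans hw (monotone_stdCDF hwz.le)

end

lemma embedLimit_mem {a : ℝ → ℝ} (ha : a ∈ limitDMStrategies) : embedLimit a ∈ commonDMSpace := by
  have hbb : BddBelow (range a) := ⟨0, by rintro _ ⟨z, rfl⟩; exact (ha.2 z).1⟩
  have hba : BddAbove (range a) := ⟨1, by rintro _ ⟨z, rfl⟩; exact (ha.2 z).2⟩
  have hinf : ∀ z, ⨅ z, a z ≤ a z := ciInf_le hbb
  have hsup : ∀ z, a z ≤ ⨆ z, a z := le_ciSup hba
  constructor
  · intro x _ y _ hxy
    unfold embedLimit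
    split_ifs with h1 h2 h3 h4 h5 h6 h7
    · exact le_rfl
    · exact (hinf 0).trans (hsup 0)
    · exact hinf _
    · linarith
    · exact le_rfl
    · linarith
    · linarith
    · exact hsup _
    · exact ha.1 (csInf_le_csInf (quantileSet_bddBelow (not_le.1 h1))
        (quantileSet_nonempty (not_le.1 ‹¬ 1 ≤ y›)) fun z hz => le_trans hxy hz)
  · intro y _
    unfold embedLimit
    split_ifs with h1 h2
    · exact ⟨le_ciInf fun z => (ha.2 z).1, (hinf 0).trans (ha.2 0).2⟩
    · exact ⟨(ha.2 0).1.trans (hsup 0), ciSup_le fun z => (ha.2 z).2⟩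
    · exact ha.2 _

lemma gridPoint_strictMono {n : ℕ} (hn : 1 ≤ n) : StrictMono (gridPoint n) := by
  intro k l hkl
  have hs := sqrt_pos_of_one_le hn
  have : (k : ℝ) < l := Nat.cast_lt.2 hkl
  exact strictMono_stdCDF (div_lt_div_of_pos_right (by linarith) (by positivity))

section

variable {n : ℕ} {b : Fin (n + 1) → ℝ}

/-- Telescoping, in the shape of `embedFinite` with each ramp replaced by a step, so that values and
interpolation can be compared summand by summand. -/
lemma sum_increments (b : Fin (n + 1) → ℝ) (k : Fin (n + 1)) :
    b k = b 0 + ∑ j : Fin n, (b j.succ - b j.castSucc) * (if (j : ℕ) < k then 1 else 0) := by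
  have hk : (k : ℕ) ≤ n := Nat.lt_succ_iff.1 k.2
  set B : ℕ → ℝ := fun j => b (Fin.ofNat (n + 1) j) with hB
  have hBj : ∀ j : Fin (n + 1), b j = B j := fun j => by
    simp only [hB]; congr 1; ext; simp
  have e : ∑ j : Fin n, (b j.succ - b j.castSucc) * (if (j : ℕ) < k then (1 : ℝ) else 0) =
      ∑ j ∈ Finset.range n, (B (j + 1) - B j) * (if j < (k : ℕ) then 1 else 0) := by
    rw [← Fin.sum_univ_eq_sum_range
      (fun j : ℕ => (B (j + 1) - B j) * (if j < (k : ℕ) then (1 : ℝ) else 0)) n]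
    refine Finset.sum_congr rfl fun j _ => ?_
    rw [hBj, hBj]
    simp
  rw [e]
  simp only [mul_ite, mul_one, mul_zero]
  rw [← Finset.sum_filter]
  have hf : (Finset.range n).filter (fun j => j < (k : ℕ)) = Finset.range k := by
    ext j; simp; omega
  rw [hf, Finset.sum_range_sub, hBj, hBj]
  simp

lemma increment_nonneg (hb : Monotone b) (j : Fin n) : 0 ≤ b j.succ - b j.castSucc :=
  sub_nonneg.2 (hb (Fin.castSucc_lt_succ).le)

lemma le_embedFinite (hn : 1 ≤ n) (hb : Monotone b) {k : Fin (n + 1)} {y : ℝ}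
    (hy : gridPoint n k ≤ y) : b k ≤ embedFinite n b y := by
  rw [sum_increments b k, embedFinite]
  refine add_le_add_right (Finset.sum_le_sum fun j _ =>
    mul_le_mul_of_nonneg_left ?_ (increment_nonneg hb j)) _
  split_ifs with hj
  · have h1 := gridPoint_strictMono hn (Nat.lt_succ_self (j : ℕ))
    have h2 := (gridPoint_strictMono hn).monotone (Nat.succ_le_of_lt hj)
    refine le_max_of_le_right (le_min le_rfl ?_)
    rw [one_le_div (sub_pos.2 h1)]
    simp only [Nat.succ_eq_add_one] at h2
    linarith
  · exact le_max_left _ _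

lemma embedFinite_le (hn : 1 ≤ n) (hb : Monotone b) {k : Fin (n + 1)} {y : ℝ}
    (hy : y ≤ gridPoint n k) : embedFinite n b y ≤ b k := by
  rw [sum_increments b k, embedFinite]
  refine add_le_add_right (Finset.sum_le_sum fun j _ =>
    mul_le_mul_of_nonneg_left ?_ (increment_nonneg hb j)) _
  split_ifs with hj
  · exact max_le zero_le_one (min_le_left _ _)
  · have h1 := gridPoint_strictMono hn (Nat.lt_succ_self (j : ℕ))
    have h2 := (gridPoint_strictMono hn).monotone (not_lt.1 hj)
    refine max_le le_rfl (min_le_of_right_le (div_nonpos_of_nonpos_of_nonneg ?_ ?_))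
    · linarith
    · exact (sub_pos.2 h1).le

lemma monotone_embedFinite (hn : 1 ≤ n) (hb : Monotone b) : Monotone (embedFinite n b) := by
  intro x y hxy
  refine add_le_add_right (Finset.sum_le_sum fun j _ =>
    mul_le_mul_of_nonneg_left ?_ (increment_nonneg hb j)) _
  have h1 := sub_pos.2 (gridPoint_strictMono hn (Nat.lt_succ_self (j : ℕ)))
  simp only [Nat.succ_eq_add_one] at h1
  gcongr

lemma embedFinite_bounds (hb : Monotone b) (y : ℝ) :
    embedFinite n b y ∈ Icc (b 0) (b (Fin.last n)) := by
  constructor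
  · exact le_add_of_nonneg_right (Finset.sum_nonneg fun j _ =>
      mul_nonneg (increment_nonneg hb j) (le_max_left _ _))
  · rw [sum_increments b (Fin.last n), embedFinite]
    refine add_le_add_right (Finset.sum_le_sum fun j _ =>
      mul_le_mul_of_nonneg_left ?_ (increment_nonneg hb j)) _
    rw [if_pos (by simp)]
    exact max_le zero_le_one (min_le_left _ _)

lemma embedFinite_mem (hn : 1 ≤ n) (hb : Monotone b) (hb' : ∀ k, b k ∈ Icc (0 : ℝ) 1) :
    embedFinite n b ∈ commonDMSpace :=
  ⟨(monotone_embedFinite hn hb).monotoneOn _, fun y _ =>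
    ⟨(hb' 0).1.trans (embedFinite_bounds hb y).1, (embedFinite_bounds hb y).2.trans (hb' _).2⟩⟩

end

/-! ### Convergence of the embedded belief rules. -/

/-- Every real number is a limit of standardised signal counts. -/
lemma exists_tendsto_countScore (z : ℝ) :
    ∃ k : (n : ℕ) → Fin (n + 1), Tendsto (fun n => countScore n (k n)) atTop (𝓝 z) := by
  -- The real count whose score is exactly `z`. Rounding it down moves the score by less than `2 /
  -- √n`.
  set x : ℕ → ℝ := fun n => n / 2 + z * √(n : ℝ) / 2 with hx
  -- The minimum only makes the index valid for small `n`; it is inactive once `√n ≥ |z|`.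
  refine ⟨fun n => ⟨min ⌊x n⌋₊ n, Nat.lt_succ_of_le (min_le_right _ _)⟩, ?_⟩
  have hs := tendsto_sqrt_natCast (tendsto_id (α := ℕ) (x := atTop))
  have h0 : Tendsto (fun n : ℕ => 2 / √(n : ℝ)) atTop (𝓝 0) := hs.const_div_atTop 2
  rw [tendsto_iff_dist_tendsto_zero]
  refine squeeze_zero' (Eventually.of_forall fun _ => dist_nonneg) ?_ h0
  filter_upwards [hs.eventually_ge_atTop |z|, eventually_ge_atTop 1] with n hn hn1
  have hs := sqrt_pos_of_one_le hn1
  have hs2 : √(n : ℝ) ^ 2 = n := Real.sq_sqrt n.cast_nonneg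
  obtain ⟨hz1, hz2⟩ := abs_le.1 hn
  simp only [id] at hz1 hz2
  have hx0 : 0 ≤ x n := by simp only [hx]; nlinarith
  have hxn : x n ≤ n := by simp only [hx]; nlinarith
  have hfl : ⌊x n⌋₊ ≤ n := Nat.floor_le_of_le hxn
  have f1 := Nat.floor_le hx0
  have f2 := Nat.lt_floor_add_one (x n)
  rw [countScore_eq, Real.dist_eq]
  simp only [min_eq_left hfl]
  have e : (2 * (⌊x n⌋₊ : ℝ) - n) / √(n : ℝ) - z = 2 * (⌊x n⌋₊ - x n) / √(n : ℝ) := by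
    simp only [hx]; field_simp; ring
  rw [e, abs_div, abs_of_pos hs]
  refine div_le_div_of_nonneg_right ?_ hs.le
  rw [abs_le]
  constructor <;> linarith

section

variable {C : ℝ} {γ : ProbabilityMeasure ℝ}

/-- The inequality `exp u ≥ 1 + u` bounds the marginal below by an affine function of `z` whose
slope is twice the mean of `γ`, hence positive. -/
lemma tendsto_limitMarg_atTop (hγ : γ ∈ boundedStrategies C)
    (h0 : ¬ ∀ᵐ c ∂(γ : Measure ℝ), c = 0) : Tendsto (limitModel.marg γ) atTop atTop := by
  have hI := ae_mem_Icc hγ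
  have hi : Integrable (fun c : ℝ => c) (γ : Measure ℝ) :=
    Integrable.of_bound measurable_id.aestronglyMeasurable C (hI.mono fun c hc => by
      rw [Real.norm_of_nonneg hc.1]; exact hc.2)
  have hpos : 0 < ∫ c, c ∂(γ : Measure ℝ) := by
    refine lt_of_le_of_ne (integral_nonneg_of_ae (hI.mono fun c hc => hc.1)) fun h => h0 ?_
    exact (integral_eq_zero_iff_of_nonneg_ae (hI.mono fun c hc => hc.1) hi).1 h.symm
  have hlow : ∀ z : ℝ, 0 ≤ z → (1 - 2 * C ^ 2) + (2 * ∫ c, c ∂(γ : Measure ℝ)) * z ≤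
      limitModel.marg γ z := by
    intro z hz
    have e : (1 - 2 * C ^ 2) + (2 * ∫ c, c ∂(γ : Measure ℝ)) * z =
        ∫ c, (1 - 2 * C ^ 2) + (2 * z) * c ∂(γ : Measure ℝ) := by
      rw [integral_add (integrable_const _) (hi.const_mul _), integral_const_mul]
      simp; ring
    rw [e]
    refine integral_mono_ae ((integrable_const _).add (hi.const_mul _))
      (limitModel.lik_integrable_left (ae_mem_params hγ) z) (hI.mono fun c hc => ?_)
    change 1 - 2 * C ^ 2 + 2 * z * c ≤ Real.exp (2 * c * z - (2 * c) ^ 2 / 2)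
    have h1 := Real.add_one_le_exp (2 * c * z - (2 * c) ^ 2 / 2)
    have h2 : c ^ 2 ≤ C ^ 2 := pow_le_pow_left₀ hc.1 hc.2 2
    linarith
  refine tendsto_atTop_mono' _ ((eventually_ge_atTop 0).mono hlow) ?_
  exact tendsto_atTop_add_const_left _ _ (tendsto_id.const_mul_atTop (by positivity))

lemma limitMarg_neg_le_one (hγ : γ ∈ boundedStrategies C) {z : ℝ} (hz : 0 ≤ z) :
    limitModel.marg γ (-z) ≤ 1 := by
  have hp := ae_mem_params hγ
  have := integral_mono_ae (limitModel.lik_integrable_left hp (-z))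
    (integrable_const (1 : ℝ)) ((ae_mem_Icc hγ).mono fun c hc => by
      change Real.exp (2 * c * (-z) - (2 * c) ^ 2 / 2) ≤ 1
      refine Real.exp_le_one_iff.2 ?_
      nlinarith [mul_nonneg hc.1 hz, sq_nonneg c])
  exact this.trans_eq (by simp)

/-- The marginal diverges in state `1` and stays below `1` in state `0`. This identifies the value
of the embedded rule at the endpoint `1`. -/
lemma tendsto_limitBayes_atTop (hγ : γ ∈ boundedStrategies C)
    (h0 : ¬ ∀ᵐ c ∂(γ : Measure ℝ), c = 0) : Tendsto (limitModel.bayes γ) atTop (𝓝 1) := by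
  have hp := ae_mem_params hγ
  have hm := tendsto_limitMarg_atTop hγ h0
  have hlim : Tendsto (fun z => 1 - (limitModel.marg γ z)⁻¹) atTop (𝓝 1) := by
    simpa using hm.inv_tendsto_atTop.const_sub 1
  refine tendsto_of_tendsto_of_tendsto_of_le_of_le' hlim tendsto_const_nhds ?_
    (Eventually.of_forall fun z => (limitModel.bayes_mem hp z).2)
  filter_upwards [eventually_ge_atTop 0] with z hz
  have u1 := limitMarg_pos hp z
  have u2 := limitMarg_pos hp (-z)
  have u3 := limitMarg_neg_le_one hγ hz
  rw [limitBayes_eq hp, le_div_iff₀ (by positivity), sub_mul, one_mul, inv_mul_eq_div]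
  have : limitModel.marg γ (-z) ≤
      (limitModel.marg γ z + limitModel.marg γ (-z)) / limitModel.marg γ z := by
    rw [le_div_iff₀ u1]
    nlinarith
  linarith

lemma tendsto_limitBayes_atBot (hγ : γ ∈ boundedStrategies C)
    (h0 : ¬ ∀ᵐ c ∂(γ : Measure ℝ), c = 0) : Tendsto (limitModel.bayes γ) atBot (𝓝 0) := by
  have h := ((tendsto_limitBayes_atTop hγ h0).comp tendsto_neg_atBot_atTop).const_sub 1
  rw [sub_self] at h
  refine h.congr fun z => ?_
  have : limitModel.bayes γ (-z) = 1 - limitModel.bayes γ z := limitModel.bayes_flip z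
  simp only [Function.comp_apply, this]
  ring

variable {b : (n : ℕ) → Fin (n + 1) → ℝ} {ν : ℕ → ProbabilityMeasure ℝ}

/-- Convergence of the belief rules at signal counts whose standardisations converge. -/
lemma tendsto_finiteRule (hC : 0 ≤ C) (h : ∀ n, 1 ≤ n → IsFiniteNash n (b n) (ν n))
    (hνC : ∀ n, 1 ≤ n → ν n ∈ boundedStrategies C) (hγ : γ ∈ boundedStrategies C)
    (ht : Tendsto ν atTop (𝓝 γ)) {k : (n : ℕ) → Fin (n + 1)} {z : ℝ}
    (hk : Tendsto (fun n => countScore n (k n)) atTop (𝓝 z)) :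
    Tendsto (fun n => b n (k n)) atTop (𝓝 (limitModel.bayes γ z)) := by
  have key := tendsto_scoreBayes hC tendsto_id ht ((eventually_ge_atTop 1).mono hνC) hγ hk
  refine key.congr' ?_
  filter_upwards [eventually_le_sqrt (tendsto_id (α := ℕ) (x := atTop)) (4 * C)] with n ⟨hn, hn'⟩
  simp only [id] at hn hn'
  rw [(h n hn).eq_bayes hn, finiteBayes_eq_scoreBayes hn hn' (hνC n hn)]
  rfl

/-- Counts with scores tending to `z` have grid points to the left of `y`, and monotonicity bounds
the interpolation at `y` below by the rule at these counts. -/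
lemma eventually_lt_embedFinite (hC : 0 ≤ C) (h : ∀ n, 1 ≤ n → IsFiniteNash n (b n) (ν n))
    (hνC : ∀ n, 1 ≤ n → ν n ∈ boundedStrategies C) (hγ : γ ∈ boundedStrategies C)
    (ht : Tendsto ν atTop (𝓝 γ)) {y z l : ℝ} (hz : ∀ᶠ w in 𝓝 z, stdCDF w ≤ y)
    (hl : l < limitModel.bayes γ z) : ∀ᶠ n in atTop, l < embedFinite n (b n) y := by
  obtain ⟨k, hk⟩ := exists_tendsto_countScore z
  filter_upwards [hk.eventually hz, eventually_ge_atTop 1,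
    (tendsto_finiteRule hC h hνC hγ ht hk).eventually (lt_mem_nhds hl)] with n h1 hn h2
  exact h2.trans_le (le_embedFinite hn ((h n hn).monotone hn) h1)

lemma eventually_embedFinite_lt (hC : 0 ≤ C) (h : ∀ n, 1 ≤ n → IsFiniteNash n (b n) (ν n))
    (hνC : ∀ n, 1 ≤ n → ν n ∈ boundedStrategies C) (hγ : γ ∈ boundedStrategies C)
    (ht : Tendsto ν atTop (𝓝 γ)) {y z u : ℝ} (hz : ∀ᶠ w in 𝓝 z, y ≤ stdCDF w)
    (hu : limitModel.bayes γ z < u) : ∀ᶠ n in atTop, embedFinite n (b n) y < u := by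
  obtain ⟨k, hk⟩ := exists_tendsto_countScore z
  filter_upwards [hk.eventually hz, eventually_ge_atTop 1,
    (tendsto_finiteRule hC h hνC hγ ht hk).eventually (gt_mem_nhds hu)] with n h1 hn h2
  exact (embedFinite_le hn ((h n hn).monotone hn) h1).trans_lt h2

/-- At an interior `y` the interpolation is squeezed between the limit rule at signals just below
and just above the quantile, and `bayes γ` is continuous there. At the endpoints one bound comes
from `[0,1]` and the other from the limits of `bayes γ` at infinity. -/
lemma tendsto_embedFinite (hC : 0 ≤ C) (h : ∀ n, 1 ≤ n → IsFiniteNash n (b n) (ν n))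
    (hνC : ∀ n, 1 ≤ n → ν n ∈ boundedStrategies C) (hγ : γ ∈ boundedStrategies C)
    (h0 : ¬ ∀ᵐ c ∂(γ : Measure ℝ), c = 0) (ht : Tendsto ν atTop (𝓝 γ)) {y : ℝ}
    (hy : y ∈ Icc (0 : ℝ) 1) :
    Tendsto (fun n => embedFinite n (b n) y) atTop (𝓝 (embedLimit (limitModel.bayes γ) y)) := by
  have hmem := limitBayes_mem hγ
  have hbd : ∀ n, 1 ≤ n → embedFinite n (b n) y ∈ Icc (0 : ℝ) 1 := fun n hn =>
    (embedFinite_mem hn ((h n hn).monotone hn) (h n hn).dm_mem).2 y hy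
  have hcont := continuous_limitBayes hγ
  unfold embedLimit
  split_ifs with hy0 hy1
  · have e : ⨅ z, limitModel.bayes γ z = 0 := tendsto_nhds_unique
      (tendsto_atBot_ciInf hmem.1 ⟨0, by rintro _ ⟨z, rfl⟩; exact (hmem.2 z).1⟩)
      (tendsto_limitBayes_atBot hγ h0)
    rw [e]
    refine tendsto_order.2 ⟨fun l hl => (eventually_ge_atTop 1).mono fun n hn =>
      hl.trans_le (hbd n hn).1, fun u hu => ?_⟩
    obtain ⟨z, hz⟩ := ((tendsto_limitBayes_atBot hγ h0).eventually (gt_mem_nhds hu)).exists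
    exact eventually_embedFinite_lt hC h hνC hγ ht
      (Eventually.of_forall fun w => hy0.trans (stdCDF_mem w).1) hz
  · have e : ⨆ z, limitModel.bayes γ z = 1 := tendsto_nhds_unique
      (tendsto_atTop_ciSup hmem.1 ⟨1, by rintro _ ⟨z, rfl⟩; exact (hmem.2 z).2⟩)
      (tendsto_limitBayes_atTop hγ h0)
    rw [e]
    refine tendsto_order.2 ⟨fun l hl => ?_, fun u hu => (eventually_ge_atTop 1).mono fun n hn =>
      (hbd n hn).2.trans_lt hu⟩
    obtain ⟨z, hz⟩ := ((tendsto_limitBayes_atTop hγ h0).eventually (lt_mem_nhds hl)).exists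
    exact eventually_lt_embedFinite hC h hνC hγ ht
      (Eventually.of_forall fun w => (stdCDF_mem w).2.trans hy1) hz
  · rw [not_le] at hy0 hy1
    set q := stdQuantile y
    refine tendsto_order.2 ⟨fun l hl => ?_, fun u hu => ?_⟩
    · have h1 : ∀ᶠ z in 𝓝[<] q, l < limitModel.bayes γ z :=
        (hcont.continuousAt.eventually (lt_mem_nhds hl)).filter_mono nhdsWithin_le_nhds
      obtain ⟨z, hz, hzq⟩ := (h1.and self_mem_nhdsWithin).exists
      exact eventually_lt_embedFinite hC h hνC hγ ht ((gt_mem_nhds hzq).mono fun w hw =>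
        (stdCDF_lt_of_lt_stdQuantile hy0 hw).le) hz
    · have h1 : ∀ᶠ z in 𝓝[>] q, limitModel.bayes γ z < u :=
        (hcont.continuousAt.eventually (gt_mem_nhds hu)).filter_mono nhdsWithin_le_nhds
      obtain ⟨z, hz, hzq⟩ := (h1.and self_mem_nhdsWithin).exists
      exact eventually_embedFinite_lt hC h hνC hγ ht ((lt_mem_nhds hzq).mono fun w hw =>
        le_stdCDF_of_stdQuantile_lt hy1 hw) hz

end

end RobustLearning

end

theorem theorem3 :
    ∃ (a : ℝ → ℝ) (γ : ProbabilityMeasure ℝ),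
      -- `(a, γ)` is the unique Nash equilibrium of the limit game
      RobustLearning.IsLimitNash a γ ∧
      (∀ (a' : ℝ → ℝ) (γ' : ProbabilityMeasure ℝ),
        RobustLearning.IsLimitNash a' γ' → a' = a ∧ γ' = γ) ∧
      -- the equilibria of all the games lie in the common compact spaces
      RobustLearning.embedLimit a ∈ RobustLearning.commonDMSpace ∧
      (∃ C : ℝ, 0 < C ∧ (γ : Measure ℝ) (Icc 0 C) = 1 ∧
        ∀ n : ℕ, 1 ≤ n → ∀ (b : Fin (n + 1) → ℝ) (ν : ProbabilityMeasure ℝ),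
          RobustLearning.IsFiniteNash n b ν →
            RobustLearning.embedFinite n b ∈ RobustLearning.commonDMSpace ∧
            (ν : Measure ℝ) (Icc 0 C) = 1) ∧
      -- convergence of every sequence of equilibria of the finite games
      ∀ (b : (n : ℕ) → Fin (n + 1) → ℝ) (ν : ℕ → ProbabilityMeasure ℝ),
        (∀ n : ℕ, 1 ≤ n → RobustLearning.IsFiniteNash n (b n) (ν n)) →
          Tendsto ν atTop (𝓝 γ) ∧
          ∀ y ∈ Icc (0 : ℝ) 1,
            ContinuousWithinAt (RobustLearning.embedLimit a) (Icc 0 1) y →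
              Tendsto (fun n => RobustLearning.embedFinite n (b n) y) atTop
                (𝓝 (RobustLearning.embedLimit a y)) := by
  obtain ⟨γ, C₁, hC₁, hγ₁, hv, hle⟩ := RobustLearning.exists_limit_saddle
  obtain ⟨C₂, hC₂, hfin⟩ := RobustLearning.exists_common_bound
  have hC : 0 < max C₁ C₂ := lt_max_of_lt_left hC₁
  have hγ := RobustLearning.boundedStrategies_mono (le_max_left C₁ C₂) hγ₁
  have hfin' : ∀ n, 1 ≤ n → ∀ (b : Fin (n + 1) → ℝ) (ν : ProbabilityMeasure ℝ),
      RobustLearning.IsFiniteNash n b ν → ν ∈ RobustLearning.boundedStrategies (max C₁ C₂) :=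
    fun n hn b ν h => RobustLearning.boundedStrategies_mono (le_max_right C₁ C₂) (hfin n hn b ν h)
  have huniq := fun (a' : ℝ → ℝ) (γ' : ProbabilityMeasure ℝ) =>
    RobustLearning.limitNash_unique (a' := a') (γ' := γ') hγ hv hle
  refine ⟨RobustLearning.limitModel.bayes γ, γ, RobustLearning.isLimitNash_bayes hγ hle, huniq,
    RobustLearning.embedLimit_mem (RobustLearning.limitBayes_mem hγ),
    ⟨max C₁ C₂, hC, hγ, fun n hn b ν h => ⟨RobustLearning.embedFinite_mem hn (h.monotone hn)
      h.dm_mem, hfin' n hn b ν h⟩⟩, fun b ν h => ?_⟩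
  have hνC := fun n hn => hfin' n hn (b n) (ν n) (h n hn)
  have ht := RobustLearning.tendsto_natureStrategy hC.le h hνC fun a' γ' h' => (huniq a' γ' h').2
  exact ⟨ht, fun y hy _ => RobustLearning.tendsto_embedFinite hC.le h hνC hγ
    (RobustLearning.not_ae_eq_zero (RobustLearning.ae_mem_params hγ) hv) ht hy⟩
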